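/- **Setting.** Let $\mu$ be a $\sigma$-finite measure on a measurable space $\mathcal X$, let $\Theta\subset\mathbb R^p$ be open, and let $\{f_\theta:\theta\in\Theta\}$ be an identifiable family of probability densities with respect to $\mu$ with common support, measurable in $(\theta,x)$. Let $r<p$, and let $g:\Theta\to\mathbb R^r$ be continuously differentiable with $p\times r$ matrix $G(\theta)=\partial g^T(\theta)/\partial\theta$ of rank $r$. Put $\Theta_0=\{\theta\in\Theta: g(\theta)=0\}$, let $\theta_0\in\Theta_0$, and let $\omega\subset\Theta$ be an open neighbourhood of $\theta_0$. Let $\beta,\gamma\ge 0$, and write $u_\theta(x)=\partial\log f_\theta(x)/\partial\theta$, $$J_\tau(\theta)=\int u_\theta u_\theta^Tf_\theta^{1+\tau}d\mu,\quad \xi_\beta(\theta)=\int u_\theta f_\theta^{1+\beta}d\mu,\quad K_\beta(\theta)=\int u_\theta u_\theta^Tf_\theta^{1+2\beta}d\mu-\xi_\beta(\theta)\xi_\beta(\theta)^T,$$ $$A_\gamma(\theta)=(1+\gamma)\int f_\theta^{\gamma-1}\frac{\partial f_\theta}{\partial\theta}\frac{\partial f_\theta}{\partial\theta^T}d\mu,\qquad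 B_\beta=J_\beta^{-1}G\,[G^TJ_\beta^{-1}G]^{-1}G^TJ_\beta^{-1},$$ $V^\tau_\theta(x)=\int f_\theta^{1+\tau}d\mu-(1+\frac1\tau)f_\theta^\tau(x)$ for $\tau>0$ and $V^0_\theta(x)=-\log f_\theta(x)$. The density power divergence is $d_\gamma(h,f)=\int\{f^{1+\gamma}-(1+\frac1\gamma)f^\gamma h+\frac1\gamma h^{1+\gamma}\}d\mu$ for $\gamma>0$ and $d_0(h,f)=\int h\log(h/f)\,d\mu$. **Conditions.** For $\mu$-almost every $x$ the map $\theta\mapsto f_\theta(x)$ is three times continuously differentiable on $\omega$. (Lehmann conditions) Under $f_{\theta_0}$ the score $u_{\theta_0}$ has mean $0$; the Fisher information is finite, positive definite, and equal to the mean of $-\partial^2\log f_\theta/\partial\theta\,\partial\theta^T$ at $\theta=\theta_0$; and the third partial derivatives of $\log f_\theta(x)$ are bounded for $\theta\in\omega$ by functions of $x$ with finite mean under $f_{\theta_0}$. (Basu et al. conditions, with exponent $\tau$ and a set $N\ni\theta_0$ of true parameters) For every $\theta'\in N$, $\int f_\theta^{1+\tau}d\mu$ and $\int f_\theta^\tau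 f_{\theta'}d\mu$ are three times differentiable in $\theta\in\omega$, and their derivatives can be taken under the integral sign. The matrix $J_\tau$ is finite and positive definite on $N$, and continuous at $\theta_0$ within $N$. The third partial derivatives of $V^\tau_\theta(x)$ are bounded for $\theta\in\omega$ by functions of $x$ whose means under $f_{\theta'}$ are bounded over $\theta'\in N$. Assume the Lehmann conditions, the Basu et al. conditions with $\tau=\beta$, $N=\{\theta_0\}$, the Basu et al. conditions with $\tau=\gamma$, $N=\omega$, and that the integrals defining $K_\beta(\theta_0)$ are finite. **Estimators.** Let $\widehat\theta_\beta$ be a minimum density power divergence estimator: a measurable function of the sample that, with probability tending to one, is a (local or global) minimizer over $\Theta$ of $\frac1n\sum_{i}V^\beta_\theta(X_i)$ or a root of the estimating equation $\frac1n\sum_iu_\theta(X_i)f_\theta^\beta(X_i)-\xi_\beta(\theta)=0$. Let $\widetilde\theta_\beta$ be a restricted one: with probability tending to one it lies in $\Theta_0$ and is a (local or global) minimizer of the same objective over $\Theta_0$, or solves $\frac1n\sum_iu_\theta(X_i)f_\theta^\beta(X_i)-\xi_\beta(\theta)=G(\theta)c$ for some $c\in\mathbb R^r$. Both are assumed consistent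 for $\theta_0$ when the sample is drawn from $f_{\theta_0}$; the probabilities above are also under $f_{\theta_0}$. Let $T_\gamma(\widehat\theta_\beta,\widetilde\theta_\beta)=2n\,d_\gamma(f_{\widehat\theta_\beta},f_{\widetilde\theta_\beta})$. **Theorem.** Let $d\in\mathbb R^p$ and let $X_1,\dots,X_n$ be a random sample from $f_{\theta_n}$ with $\theta_n=\theta_0+n^{-1/2}d$. Write $A=A_\gamma(\theta_0)$, $B=B_\beta(\theta_0)$, $J=J_\beta(\theta_0)$, $K=K_\beta(\theta_0)$. Let $\lambda_1,\dots,\lambda_k$ be the positive eigenvalues of $ABKB$, counted with multiplicity, and $\Lambda_k=\mathrm{diag}(\lambda_1,\dots,\lambda_k)$. Let $S$ be any $p\times m$ matrix with $SS^T=BKB$, and let $V$ be an $m\times k$ matrix whose columns are orthonormal eigenvectors of $S^TAS$ for $\lambda_1,\dots,\lambda_k$. Put $$w=\Lambda_k^{-1}V^TS^TABJd,\qquad \eta=(BJd)^TA\,BJd-w^T\Lambda_kw .$$ Then, as $n\to\infty$, $T_\gamma(\widehat\theta_\beta,\widetilde\theta_\beta)$ converges in law to $$\sum_{i=1}^k\lambda_i(Z_i+w_i)^2+\eta,$$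 where $Z_1,\dots,Z_k$ are independent standard normal variables. -/

import Mathlib

open MeasureTheory Filter Topology ProbabilityTheory
open scoped Matrix BoundedContinuousFunction

noncomputable section

namespace DPD

/-- The ambient Euclidean space of the parameter. -/
abbrev Param (p : ℕ) := EuclideanSpace ℝ (Fin p)

/-- The `j`-th coordinate direction. -/
def dir {p : ℕ} (j : Fin p) : Param p := EuclideanSpace.single j 1

section Model

variable {𝒳 : Type*} [MeasurableSpace 𝒳] {p r : ℕ}

/-- The probability measure with density `f θ` with respect to `μ`. -/
def law (μ : Measure 𝒳) (f : Param p → 𝒳 → ℝ) (θ : Param p) : Measure 𝒳 :=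
  μ.withDensity fun x => ENNReal.ofReal (f θ x)

/-- The law of a random sample of size `n` from the density `f θ`. -/
def sampleLaw (μ : Measure 𝒳) (f : Param p → 𝒳 → ℝ) (n : ℕ) (θ : Param p) :
    Measure (Fin n → 𝒳) :=
  Measure.pi fun _ => law μ f θ

/-- An identifiable family of probability densities with common support, indexed by an open
parameter set `Θ` (the values of `f` off `Θ` play no role). -/
structure IsModel (μ : Measure 𝒳) (f : Param p → 𝒳 → ℝ) (Θ : Set (Param p)) : Prop where
  isOpen : IsOpen Θ
  measurable : Measurable (Function.uncurry f)
  nonneg : ∀ θ ∈ Θ, ∀ x, 0 ≤ f θ x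
  integrable : ∀ θ ∈ Θ, Integrable (f θ) μ
  integral_eq_one : ∀ θ ∈ Θ, ∫ x, f θ x ∂μ = 1
  identifiable : Set.InjOn (law μ f) Θ
  common_support : ∀ θ ∈ Θ, ∀ θ' ∈ Θ, {x | 0 < f θ x} = {x | 0 < f θ' x}

/-- The likelihood score function, `u_θ(x) = ∂/∂θ log f_θ(x)`. -/
def score (f : Param p → 𝒳 → ℝ) (θ : Param p) (x : 𝒳) : Fin p → ℝ :=
  fun j => fderiv ℝ (fun t => Real.log (f t x)) θ (dir j)

/-- `J_τ(θ) = ∫ u_θ u_θᵀ f_θ^(1+τ)`; for `τ = 0` this is the Fisher information matrix. -/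
def matJ (μ : Measure 𝒳) (f : Param p → 𝒳 → ℝ) (τ : ℝ) (θ : Param p) :
    Matrix (Fin p) (Fin p) ℝ :=
  Matrix.of fun j k => ∫ x, score f θ x j * score f θ x k * f θ x ^ (1 + τ) ∂μ

/-- `ξ_β(θ) = ∫ u_θ f_θ^(1+β)`. -/
def vecXi (μ : Measure 𝒳) (f : Param p → 𝒳 → ℝ) (β : ℝ) (θ : Param p) : Fin p → ℝ :=
  fun j => ∫ x, score f θ x j * f θ x ^ (1 + β) ∂μ

/-- `K_β(θ) = ∫ u_θ u_θᵀ f_θ^(1+2β) - ξ_β(θ) ξ_β(θ)ᵀ`. -/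
def matK (μ : Measure 𝒳) (f : Param p → 𝒳 → ℝ) (β : ℝ) (θ : Param p) :
    Matrix (Fin p) (Fin p) ℝ :=
  Matrix.of fun j k => (∫ x, score f θ x j * score f θ x k * f θ x ^ (1 + 2 * β) ∂μ)
    - vecXi μ f β θ j * vecXi μ f β θ k

/-- `A_γ(θ) = (1+γ) ∫ f_θ^(γ-1) (∂f_θ/∂θ_i) (∂f_θ/∂θ_j)`. -/
def matA (μ : Measure 𝒳) (f : Param p → 𝒳 → ℝ) (γ : ℝ) (θ : Param p) :
    Matrix (Fin p) (Fin p) ℝ :=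
  Matrix.of fun i j => (1 + γ) * ∫ x, f θ x ^ (γ - 1) *
    fderiv ℝ (fun t => f t x) θ (dir j) * fderiv ℝ (fun t => f t x) θ (dir i) ∂μ

/-- The `p × r` matrix `G(θ) = ∂gᵀ(θ)/∂θ`. -/
def matG (g : Param p → EuclideanSpace ℝ (Fin r)) (θ : Param p) : Matrix (Fin p) (Fin r) ℝ :=
  Matrix.of fun j i => fderiv ℝ g θ (dir j) i

/-- `B_β(θ) = J⁻¹ G (Gᵀ J⁻¹ G)⁻¹ Gᵀ J⁻¹` with `J = J_β(θ)`, `G = G(θ)`. -/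
def matB (μ : Measure 𝒳) (f : Param p → 𝒳 → ℝ) (g : Param p → EuclideanSpace ℝ (Fin r))
    (β : ℝ) (θ : Param p) : Matrix (Fin p) (Fin p) ℝ :=
  (matJ μ f β θ)⁻¹ * matG g θ * ((matG g θ)ᵀ * (matJ μ f β θ)⁻¹ * matG g θ)⁻¹
    * (matG g θ)ᵀ * (matJ μ f β θ)⁻¹

/-- The density power divergence `d_τ(h, f)` between two densities, `τ ≥ 0`. -/
def divergence (μ : Measure 𝒳) (τ : ℝ) (h f : 𝒳 → ℝ) : ℝ :=
  if τ = 0 then ∫ x, h x * Real.log (h x / f x) ∂μ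
  else ∫ x, (f x ^ (1 + τ) - (1 + 1 / τ) * (f x ^ τ * h x) + 1 / τ * h x ^ (1 + τ)) ∂μ

/-- The contribution `V_θ(x)` of one observation to the objective function. -/
def objTerm (μ : Measure 𝒳) (f : Param p → 𝒳 → ℝ) (τ : ℝ) (θ : Param p) (x : 𝒳) : ℝ :=
  if τ = 0 then -Real.log (f θ x)
  else (∫ y, f θ y ^ (1 + τ) ∂μ) - (1 + 1 / τ) * f θ x ^ τ

/-- The empirical objective function `n⁻¹ ∑ V_θ(X_i)`. -/
def objective (μ : Measure 𝒳) (f : Param p → 𝒳 → ℝ) (β : ℝ) {n : ℕ} (X : Fin n → 𝒳)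
    (θ : Param p) : ℝ :=
  1 / (n : ℝ) * ∑ i, objTerm μ f β θ (X i)

/-- The estimating function `n⁻¹ ∑ u_θ(X_i) f_θ^β(X_i) - ∫ u_θ f_θ^(1+β)`. -/
def estFun (μ : Measure 𝒳) (f : Param p → 𝒳 → ℝ) (β : ℝ) {n : ℕ} (X : Fin n → 𝒳)
    (θ : Param p) : Fin p → ℝ :=
  fun j => 1 / (n : ℝ) * ∑ i, score f θ (X i) j * f θ (X i) ^ β - vecXi μ f β θ j

/-- The restricted parameter set. -/
def nullSet (Θ : Set (Param p)) (g : Param p → EuclideanSpace ℝ (Fin r)) : Set (Param p) :=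
  {θ ∈ Θ | g θ = 0}

/-- `θ` is a value of the minimum density power divergence estimator at the sample `X`:
a (local or global) minimizer of the objective function over `Θ`, or a root of the estimating
equation. -/
def IsMDPDE (μ : Measure 𝒳) (f : Param p → 𝒳 → ℝ) (Θ : Set (Param p)) (β : ℝ) {n : ℕ}
    (X : Fin n → 𝒳) (θ : Param p) : Prop :=
  θ ∈ Θ ∧ (IsLocalMinOn (objective μ f β X) Θ θ ∨ estFun μ f β X θ = 0)

/-- `θ` is a value of the restricted estimator at the sample `X`: a (local or global) minimizer
of the objective function over the restricted set, or a solution of the constrained estimating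
equations with Lagrange multipliers. -/
def IsRMDPDE (μ : Measure 𝒳) (f : Param p → 𝒳 → ℝ) (Θ : Set (Param p))
    (g : Param p → EuclideanSpace ℝ (Fin r)) (β : ℝ) {n : ℕ}
    (X : Fin n → 𝒳) (θ : Param p) : Prop :=
  θ ∈ nullSet Θ g ∧ (IsLocalMinOn (objective μ f β X) (nullSet Θ g) θ ∨
    ∃ c : Fin r → ℝ, estFun μ f β X θ = matG g θ *ᵥ c)

/-- `θ̂ n` satisfies `E n` with probability tending to one and is consistent for `θ₀`, when
the sample comes from `f θ₀`. -/
def IsConsistentSolution (μ : Measure 𝒳) (f : Param p → 𝒳 → ℝ) (θ₀ : Param p)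
    (E : ∀ n : ℕ, (Fin n → 𝒳) → Param p → Prop)
    (est : ∀ n : ℕ, (Fin n → 𝒳) → Param p) : Prop :=
  (∀ n, Measurable (est n)) ∧
  Tendsto (fun n => sampleLaw μ f n θ₀ {X | ¬ E n X (est n X)}) atTop (𝓝 0) ∧
  ∀ ε : ℝ, 0 < ε →
    Tendsto (fun n => sampleLaw μ f n θ₀ {X | ε ≤ dist (est n X) θ₀}) atTop (𝓝 0)

/-- `∫ φ_θ dμ` is three times differentiable in `θ ∈ ω`, and its partial derivatives of order at
most three are obtained by differentiation under the integral sign. -/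
def DiffUnderIntegral (μ : Measure 𝒳) (ω : Set (Param p)) (φ : Param p → 𝒳 → ℝ) : Prop :=
  (∀ m : ℕ, m < 3 → DifferentiableOn ℝ (iteratedFDeriv ℝ m fun t => ∫ x, φ t x ∂μ) ω) ∧
  ∀ m : ℕ, m ≤ 3 → ∀ s : Fin m → Fin p, ∀ θ ∈ ω,
    Integrable (fun x => iteratedFDeriv ℝ m (fun t => φ t x) θ fun i => dir (s i)) μ ∧
    iteratedFDeriv ℝ m (fun t => ∫ x, φ t x ∂μ) θ (fun i => dir (s i)) =
      ∫ x, iteratedFDeriv ℝ m (fun t => φ t x) θ (fun i => dir (s i)) ∂μ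

/-- The third partial derivatives of `V_θ(x)` (exponent `τ`) are bounded on `ω` by functions of
`x` whose means are bounded over the true parameters in `N`. -/
def ThirdDerivBound (μ : Measure 𝒳) (f : Param p → 𝒳 → ℝ) (ω N : Set (Param p)) (τ : ℝ) :
    Prop :=
  ∃ (M : Fin p → Fin p → Fin p → 𝒳 → ℝ) (m : Fin p → Fin p → Fin p → ℝ),
    (∀ᵐ x ∂μ, ∀ θ ∈ ω, ∀ j k l,
      |iteratedFDeriv ℝ 3 (fun t => objTerm μ f τ t x) θ ![dir j, dir k, dir l]| ≤ M j k l x) ∧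
    ∀ θ' ∈ N, ∀ j k l, Integrable (M j k l) (law μ f θ') ∧
      ∫ x, M j k l x ∂(law μ f θ') ≤ m j k l

/-- For almost every `x` the density is three times continuously differentiable in `θ ∈ ω`. -/
def SmoothDensity (μ : Measure 𝒳) (f : Param p → 𝒳 → ℝ) (ω : Set (Param p)) : Prop :=
  ∀ᵐ x ∂μ, ContDiffOn ℝ 3 (fun θ => f θ x) ω

/-- The Lehmann conditions at the parameter `θ₀`: smooth density, score with mean zero,
information identity, finite positive definite Fisher information, and third derivatives of the
log-density dominated by integrable functions. -/
structure LehmannConditions (μ : Measure 𝒳) (f : Param p → 𝒳 → ℝ) (ω : Set (Param p))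
    (θ₀ : Param p) : Prop where
  smooth : SmoothDensity μ f ω
  score_mean : ∀ j, Integrable (fun x => score f θ₀ x j) (law μ f θ₀) ∧
    ∫ x, score f θ₀ x j ∂(law μ f θ₀) = 0
  info_integrable : ∀ j k, Integrable (fun x => score f θ₀ x j * score f θ₀ x k) (law μ f θ₀)
  info_identity : ∀ j k,
    Integrable (fun x => iteratedFDeriv ℝ 2 (fun t => Real.log (f t x)) θ₀ ![dir j, dir k])
      (law μ f θ₀) ∧
    ∫ x, -iteratedFDeriv ℝ 2 (fun t => Real.log (f t x)) θ₀ ![dir j, dir k] ∂(law μ f θ₀) =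
      ∫ x, score f θ₀ x j * score f θ₀ x k ∂(law μ f θ₀)
  info_posDef : (Matrix.of fun j k =>
    ∫ x, score f θ₀ x j * score f θ₀ x k ∂(law μ f θ₀)).PosDef
  third_deriv : ThirdDerivBound μ f ω {θ₀} 0

/-- The Basu et al. conditions with tuning parameter `τ`, on the neighbourhood `ω` of `θ₀`, when
the true density is any `f θ'` with `θ'` in the set `N`. (With `N = {θ₀}` the continuity
requirement is void.) -/
structure BasuConditions (μ : Measure 𝒳) (f : Param p → 𝒳 → ℝ) (ω N : Set (Param p))
    (θ₀ : Param p) (τ : ℝ) : Prop where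
  smooth : SmoothDensity μ f ω
  diff_self : DiffUnderIntegral μ ω fun θ x => f θ x ^ (1 + τ)
  diff_true : ∀ θ' ∈ N, DiffUnderIntegral μ ω fun θ x => f θ x ^ τ * f θ' x
  J_integrable : ∀ θ' ∈ N, ∀ j k,
    Integrable (fun x => score f θ' x j * score f θ' x k * f θ' x ^ (1 + τ)) μ
  J_posDef : ∀ θ' ∈ N, (matJ μ f τ θ').PosDef
  J_continuous : ContinuousWithinAt (matJ μ f τ) N θ₀
  third_deriv : ThirdDerivBound μ f ω N τ

/-- The test statistic `T_γ = 2 n d_γ(f_θ̂, f_θ̃)`. -/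
def testStat (μ : Measure 𝒳) (f : Param p → 𝒳 → ℝ) (γ : ℝ)
    (est estR : ∀ n : ℕ, (Fin n → 𝒳) → Param p) (n : ℕ) (X : Fin n → 𝒳) : ℝ :=
  2 * (n : ℝ) * divergence μ γ (f (est n X)) (f (estR n X))

/-- The alternative `θ_n = θ₀ + n^(-1/2) d`. -/
def localAlt (θ₀ d : Param p) (n : ℕ) : Param p :=
  θ₀ + ((n : ℝ) ^ (-(1 / 2) : ℝ)) • d

end Model

/-- Convergence in law: `T n`, under the law `Q n`, converges weakly to the distribution `ν`. -/
def ConvergesInLaw {Ω : ℕ → Type*} [∀ n, MeasurableSpace (Ω n)] (Q : ∀ n, Measure (Ω n))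
    (T : ∀ n, Ω n → ℝ) (ν : Measure ℝ) : Prop :=
  (∀ n, AEMeasurable (T n) (Q n)) ∧
  ∀ φ : ℝ →ᵇ ℝ, Tendsto (fun n => ∫ y, φ (T n y) ∂(Q n)) atTop (𝓝 (∫ t, φ t ∂ν))

/-- The distribution of `∑ λ_i (Z_i + w_i)² + η` with `Z_i` independent standard normal. -/
def shiftedChiSq {k : ℕ} (lam w : Fin k → ℝ) (η : ℝ) : Measure ℝ :=
  (Measure.pi fun _ : Fin k => gaussianReal 0 1).map
    fun z => ∑ i, lam i * (z i + w i) ^ 2 + η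

end DPD

end

/-! Under θ₀ the statistic is asymptotically a quadratic form. Write U(θ) for the estimating
function. The bound on third derivatives gives U(θ) ≈ U(θ₀) - J(θ - θ₀) near θ₀, with an error that
is a small multiple of ‖θ - θ₀‖ (`GoodSample.norm_estFun_sub_le`). The unrestricted estimate is a
root of U, so θ̂ - θ₀ ≈ J⁻¹U(θ₀). The restricted estimate satisfies U = Gc and g = 0, so the pair
(θ̃ - θ₀, c) nearly solves the linear system bordered by G and Gᵀ, whose inverse has J⁻¹ - B as its
upper left block. Hence θ̂ - θ̃ ≈ B U(θ₀). All errors are relative to ‖U(θ₀)‖, so no rate of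
consistency has to be proved: the √n rate is inherited from U(θ₀), which is L²-bounded after
scaling. Twice the divergence of two densities near θ₀ is the A-form of the parameter difference up
to a small relative error (`exists_ball_abs_divergence_sub_le`), and together these give
`tendstoInMeasure_testStat_sub`.

The passage from θ₀ to θ_n is Le Cam's third lemma (`tendsto_integral_mul_exp`), so that nothing
about the estimators is needed under the alternatives. The log-likelihood ratio is asymptotically
the normalized score in direction d minus half its variance (`ae_tendsto_logRatio_sub`). A joint
central limit theorem for √n U(θ₀) and this score gives a Gaussian limit, and the limiting
likelihood ratio is a Cameron–Martin density: it translates the Gaussian by its covariance with the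
score coordinate (`multivariateGaussian_withDensity_exp`). For √n U(θ₀) that covariance is Jd, so
the limit of the statistic is the A-form of a Gaussian vector with mean BJd and covariance BKB.

It remains to identify this law. A trace argument shows S = S V Vᵀ
(`eq_mul_mul_transpose_of_eigenvectors`), so BKB = (SV)(SV)ᵀ and the vector may be taken as SVZ +
BJd with k standard normal coordinates. Since (SV)ᵀA(SV) is the diagonal matrix of the λ_i,
completing the square yields the weights, the shifts and η (`quadraticForm_add_eq`). -/

noncomputable section

namespace DPD

open scoped ENNReal

/-! ### Product measures and infinite random samples. -/

section ProductMeasures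

/-- A product of measures with densities has the product of the densities as its density. -/
theorem pi_withDensity {ι : Type*} [Fintype ι] {X : ι → Type*} [∀ i, MeasurableSpace (X i)]
    (ν : ∀ i, Measure (X i)) [∀ i, IsProbabilityMeasure (ν i)] {g : ∀ i, X i → ℝ≥0∞}
    (hg : ∀ i, Measurable (g i)) [∀ i, SigmaFinite ((ν i).withDensity (g i))] :
    Measure.pi (fun i => (ν i).withDensity (g i)) =
      (Measure.pi ν).withDensity fun x => ∏ i, g i (x i) := by
  refine Measure.pi_eq fun s hs => ?_
  rw [withDensity_apply _ (MeasurableSet.univ_pi hs),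
    ← lintegral_indicator (MeasurableSet.univ_pi hs)]
  -- On a box the indicator factorizes over coordinates, so the integral becomes the expectation of
  -- a product of independent variables.
  have h1 : (Set.univ.pi s).indicator (fun x => ∏ i, g i (x i)) =
      ∏ i, fun x : (∀ i, X i) => (s i).indicator (g i) (x i) := by
    ext x
    rw [Finset.prod_apply]
    by_cases hx : x ∈ Set.univ.pi s
    · rw [Set.indicator_of_mem hx]
      exact Finset.prod_congr rfl fun i _ => (Set.indicator_of_mem (hx i trivial) _).symm
    · rw [Set.indicator_of_notMem hx]
      simp only [Set.mem_pi, Set.mem_univ, true_imp_iff, not_forall] at hx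
      obtain ⟨i, hi⟩ := hx
      exact (Finset.prod_eq_zero (Finset.mem_univ i) (Set.indicator_of_notMem hi _)).symm
  have hm : ∀ i, Measurable ((s i).indicator (g i)) := fun i => (hg i).indicator (hs i)
  have h2 : ∀ i, ∫⁻ x, (s i).indicator (g i) (x i) ∂(Measure.pi ν) =
      (ν i).withDensity (g i) (s i) := by
    intro i
    rw [(measurePreserving_eval ν i).lintegral_comp (hm i), lintegral_indicator (hs i),
      withDensity_apply _ (hs i)]
  have hind : iIndepFun (fun i (x : ∀ i, X i) => (s i).indicator (g i) (x i)) (Measure.pi ν) :=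
    iIndepFun_pi fun i => (hm i).aemeasurable
  rw [h1]
  simp only [Finset.prod_apply]
  rw [lintegral_prod_eq_prod_lintegral_of_indepFun Finset.univ _ hind
    fun i => (hm i).comp (measurable_pi_apply i)]
  exact Finset.prod_congr rfl fun i _ => h2 i

variable {𝒳 : Type*} [MeasurableSpace 𝒳] (ν : Measure 𝒳) [IsProbabilityMeasure ν]

/-- The law of an infinite random sample. -/
abbrev seqLaw : Measure (ℕ → 𝒳) := Measure.infinitePi fun _ => ν

/-- The first `n` observations. -/
def firstObs (n : ℕ) (s : ℕ → 𝒳) : Fin n → 𝒳 := fun i => s i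

theorem measurable_firstObs (n : ℕ) : Measurable (firstObs (𝒳 := 𝒳) n) := by
  unfold firstObs; fun_prop

/-- Taking every finite sample as an initial segment of one infinite sample puts all statistics on a
single probability space, where the strong law and convergence in probability apply. This identity
carries the results back to the finite samples. -/
theorem map_firstObs (n : ℕ) :
    (seqLaw ν).map (firstObs n) = Measure.pi fun _ : Fin n => ν := by
  rw [← Measure.infinitePi_eq_pi]
  exact Measure.map_infinitePi_infinitePi_of_inj (P := fun _ : ℕ => ν) Fin.val_injective

theorem map_obs (i : ℕ) : (seqLaw ν).map (fun s => s i) = ν :=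
  Measure.infinitePi_map_eval _ i

variable {ν} {E : Type*} [MeasurableSpace E]

theorem aemeasurable_obs {ψ : 𝒳 → E} (hψ : AEMeasurable ψ ν) (i : ℕ) :
    AEMeasurable (fun s : ℕ → 𝒳 => ψ (s i)) (seqLaw ν) := by
  have : AEMeasurable ψ ((seqLaw ν).map fun s => s i) := by rwa [map_obs]
  exact this.comp_measurable (measurable_pi_apply i)

theorem iIndepFun_obs {ψ : 𝒳 → E} (hψ : AEMeasurable ψ ν) :
    iIndepFun (fun i (s : ℕ → 𝒳) => ψ (s i)) (seqLaw ν) := by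
  have h : iIndepFun (fun i (s : ℕ → 𝒳) => s i) (seqLaw ν) :=
    iIndepFun_infinitePi (P := fun _ : ℕ => ν) (X := fun _ x => x) fun _ => measurable_id
  exact h.comp₀ (fun _ => ψ) (fun i => (measurable_pi_apply i).aemeasurable)
    (fun i => by rwa [map_obs])

theorem identDistrib_obs {ψ : 𝒳 → E} (hψ : AEMeasurable ψ ν) (i : ℕ) :
    IdentDistrib (fun s : ℕ → 𝒳 => ψ (s i)) (fun s => ψ (s 0)) (seqLaw ν) (seqLaw ν) := by
  have h : IdentDistrib (fun s : ℕ → 𝒳 => s i) (fun s => s 0) (seqLaw ν) (seqLaw ν) :=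
    ⟨(measurable_pi_apply i).aemeasurable, (measurable_pi_apply 0).aemeasurable, by
      rw [map_obs, map_obs]⟩
  exact h.comp_of_aemeasurable (by rwa [map_obs])

theorem integral_obs {ψ : 𝒳 → ℝ} (hψ : AEStronglyMeasurable ψ ν) (i : ℕ) :
    ∫ s, ψ (s i) ∂(seqLaw ν) = ∫ x, ψ x ∂ν := by
  rw [← integral_map (φ := fun s : ℕ → 𝒳 => s i) (measurable_pi_apply i).aemeasurable
    (by rwa [map_obs]), map_obs]

theorem integrable_obs {ψ : 𝒳 → ℝ} (hψ : Integrable ψ ν) (i : ℕ) :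
    Integrable (fun s : ℕ → 𝒳 => ψ (s i)) (seqLaw ν) := by
  have : Integrable ψ ((seqLaw ν).map fun s => s i) := by rwa [map_obs]
  exact this.comp_measurable (measurable_pi_apply i)

theorem memLp_obs {ψ : 𝒳 → ℝ} (hψ : MemLp ψ 2 ν) (i : ℕ) :
    MemLp (fun s : ℕ → 𝒳 => ψ (s i)) 2 (seqLaw ν) := by
  have : MemLp ψ 2 ((seqLaw ν).map fun s => s i) := by rwa [map_obs]
  exact this.comp_of_map (measurable_pi_apply i).aemeasurable

theorem ae_obs {q : 𝒳 → Prop} (h : ∀ᵐ x ∂ν, q x) : ∀ᵐ s ∂(seqLaw ν), ∀ i, q (s i) := by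
  refine ae_all_iff.2 fun i => ?_
  have : ∀ᵐ x ∂((seqLaw ν).map fun s => s i), q x := by rwa [map_obs]
  exact ae_of_ae_map (measurable_pi_apply i).aemeasurable this

theorem tendsto_sampleMean {ψ : 𝒳 → ℝ} (hψ : Integrable ψ ν) :
    ∀ᵐ s ∂(seqLaw ν), Tendsto (fun n : ℕ => (n : ℝ)⁻¹ * ∑ i ∈ Finset.range n, ψ (s i)) atTop
      (𝓝 (∫ x, ψ x ∂ν)) := by
  have h := strong_law_ae (fun i (s : ℕ → 𝒳) => ψ (s i)) (integrable_obs hψ 0)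
    (fun i j hij => (iIndepFun_obs hψ.aemeasurable).indepFun hij)
    (identDistrib_obs hψ.aemeasurable)
  simpa only [integral_obs hψ.aestronglyMeasurable, smul_eq_mul] using h

/-- Variances of independent variables add. After division by n this is the uniform L² bound that
makes the normalized estimating function tight. -/
theorem variance_sum_obs {ψ : 𝒳 → ℝ} (hψ : MemLp ψ 2 ν) (h0 : ∫ x, ψ x ∂ν = 0) (n : ℕ) :
    Integrable (fun s : ℕ → 𝒳 => (∑ i ∈ Finset.range n, ψ (s i)) ^ 2) (seqLaw ν) ∧
    ∫ s, (∑ i ∈ Finset.range n, ψ (s i)) ^ 2 ∂(seqLaw ν) = n * ∫ x, ψ x ^ 2 ∂ν := by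
  have hm : MemLp (fun s : ℕ → 𝒳 => ∑ i ∈ Finset.range n, ψ (s i)) 2 (seqLaw ν) :=
    memLp_finsetSum _ fun i _ => memLp_obs hψ i
  refine ⟨hm.integrable_sq, ?_⟩
  have hs := IndepFun.variance_sum (μ := seqLaw ν) (X := fun i (s : ℕ → 𝒳) => ψ (s i))
    (s := Finset.range n) (fun i _ => memLp_obs hψ i)
    (fun i _ j _ hij => (iIndepFun_obs hψ.aestronglyMeasurable.aemeasurable).indepFun hij)
  have hv : ∀ i, variance (fun s : ℕ → 𝒳 => ψ (s i)) (seqLaw ν) = ∫ x, ψ x ^ 2 ∂ν := by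
    intro i
    rw [variance_of_integral_eq_zero (memLp_obs hψ i).aestronglyMeasurable.aemeasurable
      (by rw [integral_obs hψ.aestronglyMeasurable, h0])]
    exact integral_obs (ψ := fun x => ψ x ^ 2) (hψ.aestronglyMeasurable.pow 2) i
  have h1 : (∑ i ∈ Finset.range n, fun s : ℕ → 𝒳 => ψ (s i)) =
      fun s => ∑ i ∈ Finset.range n, ψ (s i) := by ext; simp
  rw [h1, variance_of_integral_eq_zero hm.aestronglyMeasurable.aemeasurable] at hs
  · simpa [hv] using hs
  · rw [integral_finsetSum _ fun i _ => (memLp_obs hψ i).integrable (by norm_num)]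
    simp [integral_obs hψ.aestronglyMeasurable, h0]

end ProductMeasures

/-! ### Multivariate central limit theorem. -/

section VectorCLT

variable {𝒳 : Type*} [MeasurableSpace 𝒳] {ν : Measure 𝒳} {ι : Type*} [Fintype ι]

/-- The normalized sum of the vectors `ψ (s i)`, `i < n`. -/
def normSum (ψ : ι → 𝒳 → ℝ) (n : ℕ) (s : ℕ → 𝒳) : EuclideanSpace ℝ ι :=
  WithLp.toLp 2 fun j => (√(n : ℝ))⁻¹ * ∑ i ∈ Finset.range n, ψ j (s i)

/-- The matrix of second moments. -/
def momentMatrix (ν : Measure 𝒳) (ψ : ι → 𝒳 → ℝ) : Matrix ι ι ℝ :=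
  Matrix.of fun j k => ∫ x, ψ j x * ψ k x ∂ν

theorem integral_sq_linearCombination {ψ : ι → 𝒳 → ℝ} (hψ : ∀ j, MemLp (ψ j) 2 ν) (t : ι → ℝ) :
    ∫ x, (∑ j, t j * ψ j x) ^ 2 ∂ν = t ⬝ᵥ momentMatrix ν ψ *ᵥ t := by
  have h : ∀ x, (∑ j, t j * ψ j x) ^ 2 = ∑ j, ∑ k, t j * (t k * (ψ j x * ψ k x)) := by
    intro x
    rw [sq, Finset.sum_mul_sum]
    exact Finset.sum_congr rfl fun j _ => Finset.sum_congr rfl fun k _ => by ring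
  have hi : ∀ j k, Integrable (fun x => ψ j x * ψ k x) ν := fun j k =>
    (hψ j).integrable_mul (hψ k)
  simp_rw [h]
  rw [integral_finsetSum _ fun j _ => integrable_finsetSum _ fun k _ =>
    ((hi j k).const_mul _).const_mul _]
  simp only [dotProduct, Matrix.mulVec, momentMatrix, Matrix.of_apply, Finset.mul_sum]
  refine Finset.sum_congr rfl fun j _ => ?_
  rw [integral_finsetSum _ fun k _ => ((hi j k).const_mul _).const_mul _]
  refine Finset.sum_congr rfl fun k _ => ?_
  rw [integral_const_mul, integral_const_mul]
  ring

theorem posSemidef_momentMatrix {ψ : ι → 𝒳 → ℝ} (hψ : ∀ j, MemLp (ψ j) 2 ν) :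
    (momentMatrix ν ψ).PosSemidef := by
  refine Matrix.PosSemidef.of_dotProduct_mulVec_nonneg ?_ fun t => ?_
  · ext j k
    simp [momentMatrix, mul_comm]
  · rw [star_trivial, ← integral_sq_linearCombination hψ]
    exact integral_nonneg fun x => sq_nonneg _

theorem memLp_linearCombination {ψ : ι → 𝒳 → ℝ} (hψ : ∀ j, MemLp (ψ j) 2 ν) (t : ι → ℝ) :
    MemLp (fun x => ∑ j, t j * ψ j x) 2 ν :=
  memLp_finsetSum _ fun j _ => (hψ j).const_mul (t j)

/-- Cramér–Wold through characteristic functions: the value at t for the vector is the value at 1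
for the scalar variable t · ψ, to which the one-dimensional theorem applies. The variance of t · ψ
is the quadratic form of the moment matrix, because the means vanish. -/
theorem tendstoInDistribution_normSum [IsProbabilityMeasure ν] [DecidableEq ι] {ψ : ι → 𝒳 → ℝ}
    (hψ : ∀ j, MemLp (ψ j) 2 ν) (h0 : ∀ j, ∫ x, ψ j x ∂ν = 0) :
    TendstoInDistribution (normSum ψ) atTop id (fun _ => seqLaw ν)
      (multivariateGaussian 0 (momentMatrix ν ψ)) where
  forall_aemeasurable n := by
    refine (WithLp.measurable_toLp 2 (ι → ℝ)).comp_aemeasurable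
      (aemeasurable_pi_lambda _ fun j => ?_)
    exact (Finset.aemeasurable_fun_sum _ fun i _ =>
      aemeasurable_obs (hψ j).aestronglyMeasurable.aemeasurable i).const_mul _
  tendsto := by
    refine ProbabilityMeasure.tendsto_iff_tendsto_charFun.2 fun t => ?_
    set Y : 𝒳 → ℝ := fun x => ∑ j, t j * ψ j x with hY
    have hYL : MemLp Y 2 ν := memLp_linearCombination hψ t
    have hY0 : ∫ x, Y x ∂ν = 0 := by
      rw [integral_finsetSum _ fun j _ => ((hψ j).integrable (by norm_num)).const_mul _]
      simp [integral_const_mul, h0]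
    have hE : ∫ s : ℕ → 𝒳, Y (s 0) ∂(seqLaw ν) = 0 := by
      rw [integral_obs hYL.aestronglyMeasurable, hY0]
    have hvar : variance (fun s : ℕ → 𝒳 => Y (s 0)) (seqLaw ν) =
        t ⬝ᵥ momentMatrix ν ψ *ᵥ t := by
      rw [variance_of_integral_eq_zero (memLp_obs hYL 0).aestronglyMeasurable.aemeasurable hE,
        ← integral_sq_linearCombination hψ]
      exact integral_obs (ψ := fun x => Y x ^ 2) (hYL.aestronglyMeasurable.pow 2) 0
    have hclt := tendstoInDistribution_inv_sqrt_mul_sum_sub (P := seqLaw ν)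
      (X := fun i (s : ℕ → 𝒳) => Y (s i))
      (P' := gaussianReal 0 (variance (fun s : ℕ → 𝒳 => Y (s 0)) (seqLaw ν)).toNNReal)
      (Y := id) ⟨aemeasurable_id, Measure.map_id⟩ (memLp_obs hYL 0)
      (iIndepFun_obs hYL.aestronglyMeasurable.aemeasurable)
      (identDistrib_obs hYL.aestronglyMeasurable.aemeasurable)
    have hc := ProbabilityMeasure.tendsto_iff_tendsto_charFun.1 hclt.tendsto 1
    have hpsd := posSemidef_momentMatrix hψ
    have hnn : 0 ≤ t ⬝ᵥ momentMatrix ν ψ *ᵥ t := by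
      simpa using hpsd.dotProduct_mulVec_nonneg (t : ι → ℝ)
    convert! hc using 2 with n
    · simp only [ProbabilityMeasure.coe_mk]
      rw [charFun_apply, charFun_apply, integral_map, integral_map]
      · refine integral_congr_ae (ae_of_all _ fun s => ?_)
        rw [hE]
        simp only [hY, normSum, PiLp.inner_apply]
        congr 2
        simp only [mul_zero, sub_zero, RCLike.inner_apply, conj_trivial, one_mul,
          Complex.ofReal_inj]
        rw [Finset.sum_comm, Finset.mul_sum]
        refine Finset.sum_congr rfl fun j _ => ?_
        rw [← Finset.mul_sum]; ring
      · exact hclt.forall_aemeasurable n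
      · exact Continuous.aestronglyMeasurable (by fun_prop)
      · refine (WithLp.measurable_toLp 2 (ι → ℝ)).comp_aemeasurable
          (aemeasurable_pi_lambda _ fun j => ?_)
        exact (Finset.aemeasurable_fun_sum _ fun i _ =>
          aemeasurable_obs (hψ j).aestronglyMeasurable.aemeasurable i).const_mul _
      · exact Continuous.aestronglyMeasurable (by fun_prop)
    · simp only [ProbabilityMeasure.coe_mk, Measure.map_id]
      rw [charFun_multivariateGaussian hpsd, charFun_gaussianReal, hvar]
      simp [Real.coe_toNNReal _ hnn]

end VectorCLT

/-! ### Convergence in probability and contiguity. -/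

section InProbability

variable {Ω : Type*} [MeasurableSpace Ω] {P : Measure Ω}

/-- The event `q n` has (inner) probability tending to one. -/
def Whp (P : Measure Ω) (q : ℕ → Ω → Prop) : Prop :=
  Tendsto (fun n => P.real {ω | ¬ q n ω}) atTop (𝓝 0)

/-- Only monotonicity of the outer measure is used, so the events need not be measurable; this
matters for events such as being a local minimizer. -/
theorem Whp.mono [IsProbabilityMeasure P] {q q' : ℕ → Ω → Prop} (h : Whp P q)
    (hq : ∀ᶠ n in atTop, ∀ ω, q n ω → q' n ω) : Whp P q' := by
  refine squeeze_zero' (.of_forall fun n => measureReal_nonneg) ?_ h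
  filter_upwards [hq] with n hn
  exact measureReal_mono fun ω hω h' => hω (hn ω h')

theorem Whp.and [IsProbabilityMeasure P] {q q' : ℕ → Ω → Prop} (h : Whp P q) (h' : Whp P q') :
    Whp P fun n ω => q n ω ∧ q' n ω := by
  have := h.add h'
  rw [add_zero] at this
  refine squeeze_zero (fun n => measureReal_nonneg) (fun n => ?_) this
  refine (measureReal_mono ?_).trans (measureReal_union_le _ _)
  intro ω hω
  simp only [Set.mem_ofPred_eq, not_and_or] at hω
  exact hω

theorem whp_of_tendsto {q : ℕ → Ω → Prop}
    (h : Tendsto (fun n => P {ω | ¬ q n ω}) atTop (𝓝 0)) : Whp P q :=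
  (ENNReal.tendsto_toReal ENNReal.zero_ne_top).comp h

theorem whp_of_ae {q : Ω → Prop} (h : ∀ᵐ ω ∂P, q ω) : Whp P fun _ => q := by
  have h0 : P.real {ω | ¬ q ω} = 0 := by
    rw [measureReal_def, ae_iff.1 h, ENNReal.toReal_zero]
  unfold Whp
  simp only [h0]
  exact tendsto_const_nhds

variable [IsProbabilityMeasure P]

theorem whp_of_tendsto_ae {X : ℕ → Ω → ℝ} {c ε : ℝ} (hX : ∀ n, AEMeasurable (X n) P)
    (h : ∀ᵐ ω ∂P, Tendsto (fun n => X n ω) atTop (𝓝 c)) (hε : 0 < ε) :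
    Whp P fun n ω => |X n ω - c| < ε := by
  have h1 : TendstoInMeasure P X atTop fun _ => c :=
    tendstoInMeasure_of_tendsto_ae (fun n => (hX n).aestronglyMeasurable) h
  rw [tendstoInMeasure_iff_measureReal_norm] at h1
  simpa [Whp, not_lt] using h1 ε hε

/-- A sequence bounded, with probability tending to one, by arbitrarily small multiples of an
`L¹`-bounded sequence tends to zero in probability. -/
theorem tendstoInMeasure_of_whp {R W : ℕ → Ω → ℝ} {C : ℝ} (hW0 : ∀ n ω, 0 ≤ W n ω)
    (hWi : ∀ n, Integrable (W n) P) (hWC : ∀ n, ∫ ω, W n ω ∂P ≤ C)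
    (h : ∀ δ : ℝ, 0 < δ → Whp P fun n ω => |R n ω| ≤ δ * W n ω) :
    TendstoInMeasure P R atTop 0 := by
  have hC : 0 ≤ C := (integral_nonneg (hW0 0)).trans (hWC 0)
  rw [tendstoInMeasure_iff_measureReal_norm]
  intro ε hε
  rw [Metric.tendsto_nhds]
  intro η hη
  -- This δ turns the Markov level (C + 1) / (η / 2) for W into the level ε for R; each of the two
  -- exceptional events then costs at most η / 2.
  have hδ : 0 < ε * (η / 2) / (C + 1) := by positivity
  have h1 := (h _ hδ).eventually (Iio_mem_nhds (half_pos hη))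
  filter_upwards [h1] with n hn
  rw [dist_zero_right, Real.norm_of_nonneg measureReal_nonneg]
  have hM := mul_meas_ge_le_integral_of_nonneg (ae_of_all P (hW0 n)) (hWi n)
    ((C + 1) / (η / 2))
  have hM2 : P.real {ω | (C + 1) / (η / 2) ≤ W n ω} ≤ η / 2 := by
    have h2 : (C + 1) / (η / 2) * P.real {ω | (C + 1) / (η / 2) ≤ W n ω} ≤ C + 1 := by
      linarith [hWC n]
    have h3 : 0 < C + 1 := by linarith
    rw [div_mul_eq_mul_div, div_le_iff₀ (half_pos hη)] at h2
    exact le_of_mul_le_mul_left h2 h3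
  calc P.real {ω | ε ≤ ‖R n ω - (0 : ℕ → Ω → ℝ) n ω‖}
      ≤ P.real ({ω | ¬ |R n ω| ≤ ε * (η / 2) / (C + 1) * W n ω} ∪
          {ω | (C + 1) / (η / 2) ≤ W n ω}) := by
        refine measureReal_mono fun ω hω => ?_
        by_contra hcon
        simp only [Set.mem_union, Set.mem_ofPred_eq, not_or, not_le] at hcon
        simp only [Set.mem_ofPred_eq, Pi.zero_apply, sub_zero, Real.norm_eq_abs] at hω
        have h4 : ε * (η / 2) / (C + 1) * W n ω < ε * (η / 2) / (C + 1) * ((C + 1) / (η / 2)) :=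
          mul_lt_mul_of_pos_left hcon.2 hδ
        have h5 : ε * (η / 2) / (C + 1) * ((C + 1) / (η / 2)) = ε := by
          have : C + 1 ≠ 0 := by linarith
          field_simp
        linarith [hcon.1]
    _ ≤ _ := measureReal_union_le _ _
    _ < η := by
        linarith

/-- Because exp L has total mass one, the truncation error is controlled by the integral of a
bounded continuous function of L. That integral passes to weak limits, which replaces a separate
proof of uniform integrability. -/
theorem abs_integral_sub_truncated_le (φ : ℝ →ᵇ ℝ) {t L : Ω → ℝ} (ht : AEMeasurable t P)
    (hL : Integrable (fun ω => Real.exp (L ω)) P) (hL1 : ∫ ω, Real.exp (L ω) ∂P = 1) (c : ℕ) :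
    |∫ ω, φ (t ω) * Real.exp (L ω) ∂P - ∫ ω, φ (t ω) * min (Real.exp (L ω)) c ∂P| ≤
      ‖φ‖ * (1 - ∫ ω, min (Real.exp (L ω)) c ∂P) := by
  have hmin : Integrable (fun ω => min (Real.exp (L ω)) (c : ℝ)) P :=
    hL.inf (integrable_const _)
  have hφ : AEStronglyMeasurable (fun ω => φ (t ω)) P :=
    (φ.continuous.measurable.comp_aemeasurable ht).aestronglyMeasurable
  have hb : ∀ᵐ ω ∂P, ‖φ (t ω)‖ ≤ ‖φ‖ := ae_of_all _ fun ω => φ.norm_coe_le_norm _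
  rw [← integral_sub (hL.bdd_mul hφ hb) (hmin.bdd_mul hφ hb), ← hL1, ← integral_sub hL hmin,
    ← integral_const_mul, ← Real.norm_eq_abs]
  refine (norm_integral_le_integral_norm _).trans (integral_mono_of_nonneg
    (ae_of_all _ fun ω => norm_nonneg _) ((hL.sub hmin).const_mul _) (ae_of_all _ fun ω => ?_))
  simp only
  rw [← mul_sub, norm_mul,
    Real.norm_of_nonneg (sub_nonneg.2 (min_le_left (Real.exp (L ω)) (c : ℝ)))]
  exact mul_le_mul_of_nonneg_right (φ.norm_coe_le_norm _)
    (sub_nonneg.2 (min_le_left _ _))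

/-- **Le Cam's third lemma** for statistics and log-likelihood ratios that are asymptotically
continuous functions of a weakly convergent sequence. -/
theorem tendsto_integral_mul_exp {E : Type*} [NormedAddCommGroup E]
    [MeasurableSpace E] [BorelSpace E] {N : Measure E}
    [IsProbabilityMeasure N] {W : ℕ → Ω → E}
    (hW : TendstoInDistribution W atTop id (fun _ => P) N) {q l : E → ℝ} (hq : Continuous q)
    (hl : Continuous l) {T Λ : ℕ → Ω → ℝ} (hT : ∀ n, AEMeasurable (T n) P)
    (hΛ : ∀ n, AEMeasurable (Λ n) P)
    (hTq : TendstoInMeasure P (fun n ω => T n ω - q (W n ω)) atTop 0)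
    (hΛl : TendstoInMeasure P (fun n ω => Λ n ω - l (W n ω)) atTop 0)
    (h1 : ∀ᶠ n in atTop, Integrable (fun ω => Real.exp (Λ n ω)) P ∧
      ∫ ω, Real.exp (Λ n ω) ∂P = 1)
    (hN : Integrable (fun z => Real.exp (l z)) N) (hN1 : ∫ z, Real.exp (l z) ∂N = 1)
    (φ : ℝ →ᵇ ℝ) :
    Tendsto (fun n => ∫ ω, φ (T n ω) * Real.exp (Λ n ω) ∂P) atTop
      (𝓝 (∫ z, φ (q z) * Real.exp (l z) ∂N)) := by
  -- Slutsky: the pair differs by o_P(1) from a continuous image of W.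
  have hpair : TendstoInDistribution (fun n ω => (T n ω, Λ n ω)) atTop
      (fun z => (q z, l z)) (fun _ => P) N := by
    refine tendstoInDistribution_of_tendstoInMeasure_sub (X := fun n ω => (q (W n ω), l (W n ω)))
      _ _ (hW.continuous_comp (g := fun z => (q z, l z)) (by fun_prop)) ?_
      fun n => (hT n).prodMk (hΛ n)
    rw [tendstoInMeasure_iff_measureReal_norm] at hTq hΛl ⊢
    intro ε hε
    have := (hTq ε hε).add (hΛl ε hε)
    rw [add_zero] at this
    refine squeeze_zero (fun n => measureReal_nonneg) (fun n => ?_) this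
    refine (measureReal_mono ?_).trans (measureReal_union_le _ _)
    intro ω hω
    simpa [Prod.norm_def, le_max_iff] using hω
  have hlim : ∀ (G : (ℝ × ℝ) →ᵇ ℝ), Tendsto (fun n => ∫ ω, G (T n ω, Λ n ω) ∂P) atTop
      (𝓝 (∫ z, G (q z, l z) ∂N)) := by
    intro G
    have := (ProbabilityMeasure.tendsto_iff_forall_integral_tendsto.1 hpair.tendsto) G
    simp only [ProbabilityMeasure.coe_mk] at this
    rw [integral_map hpair.aemeasurable_limit (by fun_prop)] at this
    refine this.congr fun n => ?_
    rw [integral_map (hpair.forall_aemeasurable n) (by fun_prop)]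
  have trunc : ∀ (ψ : ℝ →ᵇ ℝ) (c : ℕ),
      Tendsto (fun n => ∫ ω, ψ (T n ω) * min (Real.exp (Λ n ω)) c ∂P) atTop
        (𝓝 (∫ z, ψ (q z) * min (Real.exp (l z)) c ∂N)) := by
    intro ψ c
    refine hlim (BoundedContinuousFunction.ofNormedAddCommGroup
      (fun p : ℝ × ℝ => ψ p.1 * min (Real.exp p.2) c) (by fun_prop) (‖ψ‖ * c) fun p => ?_)
    rw [norm_mul]
    gcongr
    · exact ψ.norm_coe_le_norm _
    · rw [Real.norm_of_nonneg (le_min (Real.exp_pos _).le (Nat.cast_nonneg c))]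
      exact min_le_right _ _
  have hM : Tendsto (fun c : ℕ => ∫ z, min (Real.exp (l z)) c ∂N) atTop (𝓝 1) := by
    rw [← hN1]
    refine tendsto_integral_of_dominated_convergence (fun z => Real.exp (l z))
      (fun c => Continuous.aestronglyMeasurable (by fun_prop)) hN (fun c => ae_of_all _ fun z => ?_)
      (ae_of_all _ fun z => ?_)
    · rw [Real.norm_of_nonneg (le_min (Real.exp_pos _).le (Nat.cast_nonneg c))]
      exact min_le_left _ _
    · refine tendsto_const_nhds.congr' ?_
      filter_upwards [tendsto_natCast_atTop_atTop.eventually_ge_atTop (Real.exp (l z))] with c hc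
      exact (min_eq_left hc).symm
  rw [Metric.tendsto_nhds]
  intro ε hε
  have hM' : Tendsto (fun c : ℕ => ‖φ‖ * (1 - ∫ z, min (Real.exp (l z)) c ∂N)) atTop (𝓝 0) := by
    simpa using (hM.const_sub 1).const_mul ‖φ‖
  obtain ⟨c, hc⟩ := (hM'.eventually (Iio_mem_nhds (show (0 : ℝ) < ε / 4 by linarith))).exists
  -- The level c was chosen for the limit law; the test function 1 transfers the smallness of the
  -- truncation error to all large n.
  have hone := trunc (BoundedContinuousFunction.const ℝ 1) c
  simp only [BoundedContinuousFunction.const_apply, one_mul] at hone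
  have hMn : Tendsto (fun n => ‖φ‖ * (1 - ∫ ω, min (Real.exp (Λ n ω)) c ∂P)) atTop
      (𝓝 (‖φ‖ * (1 - ∫ z, min (Real.exp (l z)) c ∂N))) := (hone.const_sub 1).const_mul ‖φ‖
  filter_upwards [h1, hMn.eventually (Iio_mem_nhds hc),
    Metric.tendsto_nhds.1 (trunc φ c) (ε / 4) (by linarith)] with n hn1 hn2 hn3
  have b1 := abs_integral_sub_truncated_le φ (hT n) hn1.1 hn1.2 c
  have b2 := abs_integral_sub_truncated_le φ hq.measurable.aemeasurable hN hN1 c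
  rw [Real.dist_eq] at hn3 ⊢
  rw [abs_le] at b1 b2
  rw [abs_lt] at hn3 ⊢
  constructor <;> linarith [b1.1, b1.2, b2.1, b2.2, hn3.1, hn3.2]

end InProbability

/-! ### Eigenvectors and completing the square. -/

section SpectralDecomposition

theorem mulVec_dotProduct_eq {m n : Type*} [Fintype m] [Fintype n] (M : Matrix m n ℝ) (x : n → ℝ)
    (y : m → ℝ) : (M *ᵥ x) ⬝ᵥ y = x ⬝ᵥ Mᵀ *ᵥ y := by
  rw [dotProduct_comm, Matrix.dotProduct_mulVec, ← Matrix.mulVec_transpose, dotProduct_comm]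

/-- If `V` holds orthonormal eigenvectors of `Sᵀ A S` for all its positive eigenvalues, then the
range of `Sᵀ` is contained in the span of the columns of `V`. -/
theorem eq_mul_mul_transpose_of_eigenvectors {p m k : ℕ} {A : Matrix (Fin p) (Fin p) ℝ}
    (hA : A.PosDef) {S : Matrix (Fin p) (Fin m) ℝ} {lam : Fin k → ℝ}
    (hlam : (A * (S * Sᵀ)).charpoly.roots.filter (fun t => 0 < t) =
      (Finset.univ : Finset (Fin k)).val.map lam)
    {V : Matrix (Fin m) (Fin k) ℝ} (hV : Vᵀ * V = 1)
    (hSV : (Sᵀ * A * S) * V = V * Matrix.diagonal lam) : S = S * V * Vᵀ := by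
  have hAT : Aᵀ = A := hA.1
  obtain ⟨H, hH⟩ : ∃ H : Matrix (Fin m) (Fin m) ℝ, H = Sᵀ * A * S := ⟨_, rfl⟩
  rw [← hH] at hSV
  have hHT : Hᵀ = H := by
    simp only [hH, Matrix.transpose_mul, Matrix.transpose_transpose, hAT, Matrix.mul_assoc]
  have hHpsd : H.PosSemidef := by
    simpa [hH] using hA.posSemidef.conjTranspose_mul_mul_same S
  -- A S Sᵀ and H = Sᵀ A S have the same characteristic polynomial up to powers of X, so the same
  -- positive roots with multiplicity. The trace of the positive semidefinite H is the sum of its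
  -- positive eigenvalues.
  have htr : H.trace = ∑ i, lam i := by
    have hch := Matrix.charpoly_mul_comm' (A * S) Sᵀ
    rw [← Matrix.mul_assoc, ← hH, Matrix.mul_assoc A S] at hch
    have hroots := congrArg (fun P : Polynomial ℝ => P.roots.filter fun t => 0 < t) hch
    have hmonic : ∀ {n : ℕ} (M : Matrix (Fin n) (Fin n) ℝ) (j : ℕ),
        (Polynomial.X ^ j * M.charpoly : Polynomial ℝ) ≠ 0 := fun M j =>
      mul_ne_zero (pow_ne_zero _ Polynomial.X_ne_zero) M.charpoly_monic.ne_zero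
    simp only [Polynomial.roots_mul (hmonic _ _), Multiset.filter_add, Polynomial.roots_pow,
      Polynomial.roots_X, hlam] at hroots
    have hz : ∀ j : ℕ, Multiset.filter (fun t : ℝ => 0 < t) (j • {0}) = 0 := by
      intro j
      rw [Multiset.filter_eq_nil]
      intro a ha
      rw [Multiset.nsmul_singleton, Multiset.mem_replicate] at ha
      simp [ha.2]
    rw [hz, hz, zero_add, zero_add, hHpsd.1.roots_charpoly_eq_eigenvalues] at hroots
    have hsum := congrArg Multiset.sum hroots
    rw [Multiset.filter_map, show (Multiset.map lam Finset.univ.val).sum = ∑ i, lam i from rfl]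
      at hsum
    rw [hHpsd.1.trace_eq_sum_eigenvalues, hsum]
    change _ = ∑ i ∈ Finset.univ.filter _, _
    rw [Finset.sum_filter]
    refine Finset.sum_congr rfl fun i _ => ?_
    have := hHpsd.eigenvalues_nonneg i
    by_cases h0 : 0 < hHpsd.1.eigenvalues i
    · simp [h0]
    · have : hHpsd.1.eigenvalues i = 0 := le_antisymm (not_lt.1 h0) this
      simp [this]
  obtain ⟨Q, hQ⟩ : ∃ Q : Matrix (Fin m) (Fin m) ℝ, Q = 1 - V * Vᵀ := ⟨_, rfl⟩
  have hQT : Qᵀ = Q := by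
    simp [hQ, Matrix.transpose_mul]
  have hVH : Vᵀ * H = Matrix.diagonal lam * Vᵀ := by
    have := congrArg Matrix.transpose hSV
    simpa [Matrix.transpose_mul, hHT] using this
  have hQV : Q * V = 0 := by
    rw [hQ, Matrix.sub_mul, Matrix.mul_assoc, hV]; simp
  have hQHQ : Q * H * Q = H - V * Matrix.diagonal lam * Vᵀ := by
    have h1 : Q * H * V = 0 := by
      rw [Matrix.mul_assoc, hSV, ← Matrix.mul_assoc, hQV, Matrix.zero_mul]
    have h2 : Q * H * Q = Q * H := by
      nth_rw 2 [hQ]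
      rw [Matrix.mul_sub, Matrix.mul_one, ← Matrix.mul_assoc, h1, Matrix.zero_mul, sub_zero]
    rw [h2, hQ, Matrix.sub_mul, Matrix.one_mul, Matrix.mul_assoc V, hVH, Matrix.mul_assoc]
  have hpsd : (Q * H * Q).PosSemidef := by
    simpa [hQT] using hHpsd.conjTranspose_mul_mul_same Q
  -- The compression of H to the orthogonal complement of the columns of V is positive semidefinite,
  -- and V already accounts for the whole trace.
  have hzero : Q * H * Q = 0 := by
    rw [← hpsd.trace_eq_zero_iff, hQHQ, Matrix.trace_sub, Matrix.trace_mul_cycle V, hV,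
      Matrix.one_mul, htr, Matrix.trace_diagonal, sub_self]
  -- Q H Q is the Gram matrix of S Q for the form A, so definiteness of A forces every column of S Q
  -- to vanish.
  have hSQ : S * Q = 0 := by
    ext i j
    by_contra hne
    have hv : (S * Q) *ᵥ Pi.single j 1 ≠ 0 := by
      intro h
      apply hne
      have := congrFun h i
      simpa using this
    have hpos := hA.dotProduct_mulVec_pos hv
    have h0 : star ((S * Q) *ᵥ Pi.single j 1) ⬝ᵥ A *ᵥ ((S * Q) *ᵥ Pi.single j 1) =
        Pi.single j 1 ⬝ᵥ (Q * H * Q) *ᵥ Pi.single j 1 := by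
      have h3 : Q * H * Q = (S * Q)ᵀ * (A * (S * Q)) := by
        simp only [hH, Matrix.transpose_mul, hQT, Matrix.mul_assoc]
      rw [h3, star_trivial, mulVec_dotProduct_eq, Matrix.mulVec_mulVec, Matrix.mulVec_mulVec,
        Matrix.mul_assoc]
    rw [h0, hzero] at hpos
    simp at hpos
  rw [hQ, Matrix.mul_sub, Matrix.mul_one, sub_eq_zero] at hSQ
  rw [Matrix.mul_assoc]
  exact hSQ

/-- Completing the square: the quadratic form of `A` at `S V z + b`. -/
theorem quadraticForm_add_eq {p m k : ℕ} {A : Matrix (Fin p) (Fin p) ℝ} (hAT : Aᵀ = A)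
    {S : Matrix (Fin p) (Fin m) ℝ} {lam : Fin k → ℝ} (hpos : ∀ i, lam i ≠ 0)
    {V : Matrix (Fin m) (Fin k) ℝ} (hV : Vᵀ * V = 1)
    (hSV : (Sᵀ * A * S) * V = V * Matrix.diagonal lam) (b : Fin p → ℝ) {w : Fin k → ℝ}
    (hw : w = ((Matrix.diagonal lam)⁻¹ * Vᵀ * Sᵀ * A) *ᵥ b) (z : Fin k → ℝ) :
    ((S * V) *ᵥ z + b) ⬝ᵥ A *ᵥ ((S * V) *ᵥ z + b) =
      ∑ i, lam i * (z i + w i) ^ 2 + (b ⬝ᵥ A *ᵥ b - w ⬝ᵥ Matrix.diagonal lam *ᵥ w) := by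
  have hsymm : ∀ x y : Fin p → ℝ, x ⬝ᵥ A *ᵥ y = y ⬝ᵥ A *ᵥ x := by
    intro x y
    rw [Matrix.dotProduct_mulVec, ← Matrix.mulVec_transpose, hAT, dotProduct_comm]
  have hquad : (S * V)ᵀ * (A * (S * V)) = Matrix.diagonal lam := by
    have : (S * V)ᵀ * (A * (S * V)) = Vᵀ * ((Sᵀ * A * S) * V) := by
      simp only [Matrix.transpose_mul, Matrix.mul_assoc]
    rw [this, hSV, ← Matrix.mul_assoc, hV, Matrix.one_mul]
  have hlin : (S * V)ᵀ *ᵥ A *ᵥ b = Matrix.diagonal lam *ᵥ w := by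
    have hdet : IsUnit (Matrix.diagonal lam).det := by
      rw [Matrix.det_diagonal, isUnit_iff_ne_zero]
      exact Finset.prod_ne_zero_iff.2 fun i _ => hpos i
    rw [hw, Matrix.mulVec_mulVec, Matrix.mulVec_mulVec]
    simp only [Matrix.transpose_mul, Matrix.mul_assoc]
    rw [Matrix.mul_nonsing_inv_cancel_left _ _ hdet]
  have h1 : ((S * V) *ᵥ z) ⬝ᵥ A *ᵥ ((S * V) *ᵥ z) = z ⬝ᵥ Matrix.diagonal lam *ᵥ z := by
    rw [mulVec_dotProduct_eq, Matrix.mulVec_mulVec, Matrix.mulVec_mulVec, Matrix.mul_assoc, hquad]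
  have h2 : ((S * V) *ᵥ z) ⬝ᵥ A *ᵥ b = z ⬝ᵥ Matrix.diagonal lam *ᵥ w := by
    rw [mulVec_dotProduct_eq, hlin]
  rw [Matrix.mulVec_add, dotProduct_add, add_dotProduct, add_dotProduct, hsymm b, h1, h2]
  have h3 : ∑ i, lam i * (z i + w i) ^ 2 = z ⬝ᵥ Matrix.diagonal lam *ᵥ z +
      2 * (z ⬝ᵥ Matrix.diagonal lam *ᵥ w) + w ⬝ᵥ Matrix.diagonal lam *ᵥ w := by
    simp only [dotProduct, Matrix.mulVec_diagonal, Finset.mul_sum, ← Finset.sum_add_distrib]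
    exact Finset.sum_congr rfl fun i _ => by ring
  rw [h3]
  ring

end SpectralDecomposition

/-! ### Exponential tilting and linear images of Gaussian vectors. -/

section GaussianShift

open scoped MatrixOrder

/-- Completing the square: -x²/2 + ax - a²/2 = -(x - a)²/2. -/
theorem gaussianReal_withDensity_exp (a : ℝ) :
    (gaussianReal 0 1).withDensity (fun x => ENNReal.ofReal (Real.exp (a * x - a ^ 2 / 2))) =
      gaussianReal a 1 := by
  rw [gaussianReal_of_var_ne_zero _ one_ne_zero, gaussianReal_of_var_ne_zero _ one_ne_zero,
    ← withDensity_mul _ (measurable_gaussianPDF 0 1) (by fun_prop)]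
  congr 1
  ext x
  rw [Pi.mul_apply, gaussianPDF, gaussianPDF, ← ENNReal.ofReal_mul (gaussianPDFReal_nonneg _ _ _),
    gaussianPDFReal, gaussianPDFReal, mul_assoc, ← Real.exp_add]
  congr 3
  simp
  ring

variable {ι : Type*} [Fintype ι]

/-- The standard Gaussian vector. -/
abbrev stdPi (ι : Type*) [Fintype ι] : Measure (ι → ℝ) := Measure.pi fun _ : ι => gaussianReal 0 1

theorem stdPi_withDensity_exp (a : ι → ℝ) :
    (stdPi ι).withDensity (fun x => ENNReal.ofReal (Real.exp (a ⬝ᵥ x - a ⬝ᵥ a / 2))) =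
      (stdPi ι).map fun x => x + a := by
  have h1 : (stdPi ι).map (fun x => x + a) = Measure.pi fun i => gaussianReal (a i) 1 := by
    have : (stdPi ι).map (fun x i => x i + a i) =
        Measure.pi fun i => (gaussianReal 0 1).map fun t => t + a i :=
      Measure.pi_map_pi (μ := fun _ : ι => gaussianReal 0 1) (f := fun i t => t + a i)
        fun i => (measurable_id.add_const _).aemeasurable
    simp only [gaussianReal_map_add_const, zero_add] at this
    exact this
  rw [h1]
  have h2 : (fun i => gaussianReal (a i) 1) = fun i => (gaussianReal 0 1).withDensity
      fun x => ENNReal.ofReal (Real.exp (a i * x - a i ^ 2 / 2)) :=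
    funext fun i => (gaussianReal_withDensity_exp (a i)).symm
  have : ∀ i, SigmaFinite ((gaussianReal 0 1).withDensity
      fun x => ENNReal.ofReal (Real.exp (a i * x - a i ^ 2 / 2))) := fun i => by
    rw [gaussianReal_withDensity_exp]; infer_instance
  rw [h2, pi_withDensity (fun _ : ι => gaussianReal 0 1)
    (g := fun i x => ENNReal.ofReal (Real.exp (a i * x - a i ^ 2 / 2))) fun i => by fun_prop]
  congr 1
  ext x
  rw [← ENNReal.ofReal_prod_of_nonneg fun i _ => (Real.exp_pos _).le, ← Real.exp_sum]
  congr 2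
  simp only [dotProduct, Finset.sum_sub_distrib, Finset.sum_div]
  congr 1
  exact Finset.sum_congr rfl fun i _ => by ring

variable [DecidableEq ι]

/-- **Cameron–Martin shift** of a centred Gaussian vector, in a coordinate direction. -/
theorem multivariateGaussian_withDensity_exp {C : Matrix ι ι ℝ} (hC : C.PosSemidef) (o : ι) :
    (multivariateGaussian 0 C).withDensity
      (fun z => ENNReal.ofReal (Real.exp (z o - C o o / 2))) =
      (multivariateGaussian 0 C).map fun z => z + WithLp.toLp 2 (C.col o) := by
  -- Represent the Gaussian as R x with x standard. Then z_o = ⟨R e_o, x⟩, so the tilt translates x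
  -- by R e_o and therefore z by R R e_o = C e_o.
  set R := CFC.sqrt C with hR
  have hRR : R * R = C := CFC.sqrt_mul_sqrt_self _ hC.nonneg
  have hRT : Rᵀ = R := by
    have := (CFC.sqrt_nonneg C).isSelfAdjoint
    simpa [IsSelfAdjoint, Matrix.star_eq_conjTranspose] using this
  set τ : (ι → ℝ) → EuclideanSpace ℝ ι := fun x => WithLp.toLp 2 (R *ᵥ x) with hτ
  have hτm : Measurable τ := by fun_prop
  have hmap : multivariateGaussian 0 C = (stdPi ι).map τ := by
    rw [multivariateGaussian, ← map_pi_eq_stdGaussian, Measure.map_map (by fun_prop) (by fun_prop)]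
    congr 1
    ext x i
    rw [Function.comp_apply, zero_add, Matrix.toEuclideanCLM_toLp]
  have hoo : C o o = R.col o ⬝ᵥ R.col o := by
    rw [← hRR, Matrix.mul_apply]
    refine Finset.sum_congr rfl fun i _ => ?_
    rw [show R o i = R i o from congrFun (congrFun hRT i) o]
    rfl
  have hco : ∀ x, R.col o ⬝ᵥ x = τ x o := by
    intro x
    have : R.col o = R o := by
      ext i; conv_rhs => rw [← hRT]
      rfl
    rw [this]; rfl
  have hshift : ∀ x, τ (x + R.col o) = τ x + WithLp.toLp 2 (C.col o) := by
    intro x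
    ext i
    simp [hτ, Matrix.mulVec_add]
    rw [← hRR]; rfl
  rw [hmap]
  ext s hs
  rw [withDensity_apply _ hs, Measure.map_apply (by fun_prop) hs,
    Measure.map_apply hτm ((measurable_add_const _) hs),
    setLIntegral_map hs (by fun_prop) hτm]
  have hexp : (fun x => ENNReal.ofReal (Real.exp (R.col o ⬝ᵥ x - R.col o ⬝ᵥ R.col o / 2))) =
      fun x => ENNReal.ofReal (Real.exp (τ x o - C o o / 2)) := by
    ext x
    rw [hco x, hoo]
  have h2 : ∫⁻ x in τ ⁻¹' s, ENNReal.ofReal (Real.exp (τ x o - C o o / 2)) ∂(stdPi ι) =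
      stdPi ι ((fun x => x + R.col o) ⁻¹' (τ ⁻¹' s)) := by
    rw [← hexp, ← withDensity_apply _ (hτm hs), stdPi_withDensity_exp,
      Measure.map_apply (by fun_prop) (hτm hs)]
  rw [h2]
  refine congrArg _ (Set.ext fun x => ?_)
  rw [Set.mem_preimage, Set.mem_preimage, Set.mem_preimage, Set.mem_preimage, hshift]

theorem charFun_map_mulVec {p : ℕ} {D : Matrix ι ι ℝ} (hD : D.PosSemidef)
    (M : Matrix (Fin p) ι ℝ) (t : EuclideanSpace ℝ (Fin p)) :
    charFun ((multivariateGaussian 0 D).map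
      (fun z => (WithLp.toLp 2 (M *ᵥ z.ofLp) : EuclideanSpace ℝ (Fin p)))) t =
      Complex.exp (-((t.ofLp ⬝ᵥ (M * D * Mᵀ) *ᵥ t.ofLp : ℝ) : ℂ) / 2) := by
  have hc : Continuous fun z : EuclideanSpace ℝ ι =>
      (WithLp.toLp 2 (M *ᵥ z.ofLp) : EuclideanSpace ℝ (Fin p)) := by fun_prop
  have h2 : charFun ((multivariateGaussian 0 D).map
      (fun z => (WithLp.toLp 2 (M *ᵥ z.ofLp) : EuclideanSpace ℝ (Fin p)))) t =
      charFun (multivariateGaussian 0 D) (WithLp.toLp 2 (Mᵀ *ᵥ t.ofLp)) := by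
    rw [charFun_apply, charFun_apply, integral_map hc.aemeasurable
      (Continuous.aestronglyMeasurable (by fun_prop))]
    congr 1
    ext z
    congr 3
    rw [EuclideanSpace.inner_eq_star_dotProduct, EuclideanSpace.inner_eq_star_dotProduct]
    simp only [star_trivial]
    rw [dotProduct_comm, mulVec_dotProduct_eq, dotProduct_comm]
  rw [h2, charFun_multivariateGaussian hD]
  congr 1
  simp only [inner_zero_right, Complex.ofReal_zero, zero_mul, zero_sub]
  rw [mulVec_dotProduct_eq, Matrix.transpose_transpose, Matrix.mulVec_mulVec,
    Matrix.mulVec_mulVec, neg_div]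

/-- Two linear images of centred Gaussian vectors with the same covariance have the same law. -/
theorem map_multivariateGaussian_eq {p k : ℕ} {C : Matrix ι ι ℝ} (hC : C.PosSemidef)
    {L : Matrix (Fin p) ι ℝ} {R : Matrix (Fin p) (Fin k) ℝ} (h : L * C * Lᵀ = R * Rᵀ) :
    (multivariateGaussian 0 C).map (fun z => WithLp.toLp 2 (L *ᵥ z.ofLp)) =
      (stdPi (Fin k)).map fun x => (WithLp.toLp 2 (R *ᵥ x) : EuclideanSpace ℝ (Fin p)) := by
  have h1 : (stdPi (Fin k)).map (fun x => (WithLp.toLp 2 (R *ᵥ x) : EuclideanSpace ℝ (Fin p))) =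
      (multivariateGaussian 0 (1 : Matrix (Fin k) (Fin k) ℝ)).map
        fun z => WithLp.toLp 2 (R *ᵥ z.ofLp) := by
    rw [multivariateGaussian_zero_one, ← map_pi_eq_stdGaussian,
      Measure.map_map (by fun_prop) (by fun_prop)]
    rfl
  rw [h1]
  refine Measure.ext_of_charFun ?_
  ext t
  rw [charFun_map_mulVec hC, charFun_map_mulVec Matrix.PosSemidef.one, h, Matrix.mul_one]

end GaussianShift

set_option maxSynthPendingDepth 3

/-! ### Taylor expansions under three-fold differentiability. -/

section Taylor

variable {E : Type*} [NormedAddCommGroup E] [NormedSpace ℝ E]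

/-- `F` is three times differentiable at the points of `U`. -/
def D3 (F : E → ℝ) (U : Set E) : Prop :=
  ∀ θ ∈ U, DifferentiableAt ℝ F θ ∧ DifferentiableAt ℝ (fderiv ℝ F) θ ∧
    DifferentiableAt ℝ (fderiv ℝ (fderiv ℝ F)) θ

theorem d3_of_contDiffOn {F : E → ℝ} {U : Set E} (hU : IsOpen U) (hF : ContDiffOn ℝ 3 F U) :
    D3 F U := by
  intro θ hθ
  have h0 : ContDiffAt ℝ 3 F θ := hF.contDiffAt (hU.mem_nhds hθ)
  have h1 : ContDiffAt ℝ 2 (fderiv ℝ F) θ := h0.fderiv_right (by norm_num)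
  have h2 : ContDiffAt ℝ 1 (fderiv ℝ (fderiv ℝ F)) θ := h1.fderiv_right (by norm_num)
  exact ⟨h0.differentiableAt (by norm_num), h1.differentiableAt (by norm_num),
    h2.differentiableAt (by norm_num)⟩

theorem differentiableAt_of_iteratedFDeriv_zero {G : Type*} [NormedAddCommGroup G]
    [NormedSpace ℝ G] {H : E → G} {θ : E} (h : DifferentiableAt ℝ (iteratedFDeriv ℝ 0 H) θ) :
    DifferentiableAt ℝ H θ := by
  rw [iteratedFDeriv_zero_eq_comp] at h
  exact (LinearIsometryEquiv.comp_differentiableAt_iff _).1 h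

theorem differentiableAt_iteratedFDeriv_fderiv {G : Type*} [NormedAddCommGroup G]
    [NormedSpace ℝ G] {m : ℕ} {H : E → G} {θ : E}
    (h : DifferentiableAt ℝ (iteratedFDeriv ℝ (m + 1) H) θ) :
    DifferentiableAt ℝ (iteratedFDeriv ℝ m (fderiv ℝ H)) θ := by
  rw [show iteratedFDeriv ℝ (m + 1) H = (continuousMultilinearCurryRightEquiv' ℝ m E G).symm ∘
    iteratedFDeriv ℝ m (fderiv ℝ H) from funext fun x => iteratedFDeriv_succ_eq_comp_right] at h
  exact (LinearIsometryEquiv.comp_differentiableAt_iff _).1 h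

/-- The integrals of density powers are assumed three times differentiable, with no continuity of
the third derivative. The expansions below therefore use only `D3` and a bound on the third
derivative. -/
theorem d3_of_iteratedFDeriv {F : E → ℝ} {U : Set E} (hU : IsOpen U)
    (hF : ∀ m : ℕ, m < 3 → DifferentiableOn ℝ (iteratedFDeriv ℝ m F) U) : D3 F U := by
  intro θ hθ
  have hn := hU.mem_nhds hθ
  exact ⟨differentiableAt_of_iteratedFDeriv_zero ((hF 0 (by norm_num)).differentiableAt hn),
    differentiableAt_of_iteratedFDeriv_zero (differentiableAt_iteratedFDeriv_fderiv
      ((hF 1 (by norm_num)).differentiableAt hn)),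
    differentiableAt_of_iteratedFDeriv_zero (differentiableAt_iteratedFDeriv_fderiv
      (differentiableAt_iteratedFDeriv_fderiv ((hF 2 (by norm_num)).differentiableAt hn)))⟩

theorem iteratedFDeriv_three_apply (F : E → ℝ) (θ a b c : E) :
    iteratedFDeriv ℝ 3 F θ ![a, b, c] = fderiv ℝ (fderiv ℝ (fderiv ℝ F)) θ a b c := by
  rw [iteratedFDeriv_succ_apply_right, iteratedFDeriv_two_apply]
  rfl

theorem fderiv_sub_const_mul {I G : E → ℝ} {U : Set E} (hI : D3 I U) (hG : D3 G U)
    (c : ℝ) {θ : E} (hθ : θ ∈ U) :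
    fderiv ℝ (fun t => I t - c * G t) θ = fderiv ℝ I θ - c • fderiv ℝ G θ := by
  rw [fderiv_fun_sub (hI θ hθ).1 ((hG θ hθ).1.const_mul c), fderiv_const_mul (hG θ hθ).1]

theorem fderiv_fderiv_sub_const_mul {I G : E → ℝ} {U : Set E} (hU : IsOpen U) (hI : D3 I U)
    (hG : D3 G U) (c : ℝ) {θ : E} (hθ : θ ∈ U) :
    fderiv ℝ (fderiv ℝ fun t => I t - c * G t) θ =
      fderiv ℝ (fderiv ℝ I) θ - c • fderiv ℝ (fderiv ℝ G) θ := by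
  have h1 : fderiv ℝ (fun t => I t - c * G t) =ᶠ[𝓝 θ]
      fun t => fderiv ℝ I t - c • fderiv ℝ G t := by
    filter_upwards [hU.mem_nhds hθ] with t ht using fderiv_sub_const_mul hI hG c ht
  rw [h1.fderiv_eq]
  exact ((hI θ hθ).2.1.hasFDerivAt.sub ((hG θ hθ).2.1.hasFDerivAt.const_smul c)).fderiv

theorem D3.sub_const_mul {I G : E → ℝ} {U : Set E} (hU : IsOpen U) (hI : D3 I U) (hG : D3 G U)
    (c : ℝ) : D3 (fun t => I t - c * G t) U := by
  intro θ hθ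
  have h1 : fderiv ℝ (fun t => I t - c * G t) =ᶠ[𝓝 θ]
      fun t => fderiv ℝ I t - c • fderiv ℝ G t := by
    filter_upwards [hU.mem_nhds hθ] with t ht using fderiv_sub_const_mul hI hG c ht
  have h2 : fderiv ℝ (fderiv ℝ fun t => I t - c * G t) =ᶠ[𝓝 θ]
      fun t => fderiv ℝ (fderiv ℝ I) t - c • fderiv ℝ (fderiv ℝ G) t := by
    filter_upwards [hU.mem_nhds hθ] with t ht using fderiv_fderiv_sub_const_mul hU hI hG c ht
  exact ⟨(hI θ hθ).1.sub ((hG θ hθ).1.const_mul c),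
    h1.differentiableAt_iff.2 ((hI θ hθ).2.1.sub ((hG θ hθ).2.1.const_smul c)),
    h2.differentiableAt_iff.2 ((hI θ hθ).2.2.fun_sub ((hG θ hθ).2.2.fun_const_smul c))⟩

/-- First order expansion of the derivative, with a quadratic remainder. -/
theorem norm_fderiv_sub_le {F : E → ℝ} {U : Set E} (hc : Convex ℝ U) (hF : D3 F U)
    {C : ℝ} (hC : ∀ θ ∈ U, ‖fderiv ℝ (fderiv ℝ (fderiv ℝ F)) θ‖ ≤ C) {a b : E} (ha : a ∈ U)
    (hb : b ∈ U) :
    ‖fderiv ℝ F b - fderiv ℝ F a - fderiv ℝ (fderiv ℝ F) a (b - a)‖ ≤ C * ‖b - a‖ ^ 2 := by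
  have hC0 : 0 ≤ C := (norm_nonneg _).trans (hC a ha)
  have hseg : segment ℝ a b ⊆ U := hc.segment_subset ha hb
  -- The mean value inequality is used twice, here for the first derivative and below for the
  -- second. This costs the sharp factor 1/2, which is never needed.
  have h := (convex_segment a b).norm_image_sub_le_of_norm_hasFDerivWithin_le' (𝕜 := ℝ)
    (f := fderiv ℝ F) (f' := fderiv ℝ (fderiv ℝ F)) (φ := fderiv ℝ (fderiv ℝ F) a)
    (C := C * ‖b - a‖)
    (fun x hx => (hF x (hseg hx)).2.1.hasFDerivAt.hasFDerivWithinAt) (fun x hx => ?_)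
    (left_mem_segment ℝ a b) (right_mem_segment ℝ a b)
  · rw [sq, ← mul_assoc]; exact h
  · refine (hc.norm_image_sub_le_of_norm_hasFDerivWithin_le (𝕜 := ℝ)
      (f' := fderiv ℝ (fderiv ℝ (fderiv ℝ F)))
      (fun y hy => (hF y hy).2.2.hasFDerivAt.hasFDerivWithinAt) hC ha (hseg hx)).trans ?_
    gcongr
    exact norm_sub_le_of_mem_segment hx

/-- Second order Taylor expansion with a cubic remainder. -/
theorem abs_sub_taylor_le {F : E → ℝ} {U : Set E} (hU : IsOpen U) (hc : Convex ℝ U) (hF : D3 F U)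
    {C : ℝ} (hC : ∀ θ ∈ U, ‖fderiv ℝ (fderiv ℝ (fderiv ℝ F)) θ‖ ≤ C) {a b : E} (ha : a ∈ U)
    (hb : b ∈ U) :
    |F b - F a - fderiv ℝ F a (b - a) - 1 / 2 * fderiv ℝ (fderiv ℝ F) a (b - a) (b - a)| ≤
      C * ‖b - a‖ ^ 3 := by
  have hC0 : 0 ≤ C := (norm_nonneg _).trans (hC a ha)
  have hseg : segment ℝ a b ⊆ U := hc.segment_subset ha hb
  set H := fderiv ℝ (fderiv ℝ F) a with hH
  -- Symmetry is what makes H (x - a) the derivative of half the quadratic form.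
  have hsymm : ∀ u v, H u v = H v u := by
    refine second_derivative_symmetric_of_eventually_of_real (f := F) (f' := fderiv ℝ F) (x := a)
      ?_ (hF a ha).2.1.hasFDerivAt
    filter_upwards [hU.mem_nhds ha] with y hy using (hF y hy).1.hasFDerivAt
  have hquad : ∀ x, HasFDerivAt (fun y => 1 / 2 * H (y - a) (y - a)) (H (x - a)) x := by
    intro x
    have h1 : HasFDerivAt (fun y => y - a) (ContinuousLinearMap.id ℝ E) x :=
      (hasFDerivAt_id x).sub_const a
    have h2 := ((H.hasFDerivAt.comp x h1).clm_apply h1).const_mul (1 / 2)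
    refine h2.congr_fderiv ?_
    ext v
    have h4 := hsymm v x
    have h5 := hsymm v a
    simp
    linarith
  have h := (convex_segment a b).norm_image_sub_le_of_norm_hasFDerivWithin_le' (𝕜 := ℝ)
    (f := fun y => F y - 1 / 2 * H (y - a) (y - a))
    (f' := fun y => fderiv ℝ F y - H (y - a)) (φ := fderiv ℝ F a)
    (C := C * ‖b - a‖ ^ 2)
    (fun x hx => ((hF x (hseg hx)).1.hasFDerivAt.sub (hquad x)).hasFDerivWithinAt)
    (fun x hx => ?_)
    (left_mem_segment ℝ a b) (right_mem_segment ℝ a b)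
  · have e : F b - F a - fderiv ℝ F a (b - a) - 1 / 2 * H (b - a) (b - a) =
        F b - 1 / 2 * H (b - a) (b - a) - (F a - 1 / 2 * H (a - a) (a - a)) -
          fderiv ℝ F a (b - a) := by
      simp; ring
    rw [e, pow_succ, ← mul_assoc]
    exact h
  · have h3 := norm_fderiv_sub_le hc hF hC ha (hseg hx)
    rw [sub_right_comm]
    refine h3.trans ?_
    gcongr
    exact norm_sub_le_of_mem_segment hx

end Taylor

/-! ### Derivatives of logarithms and real powers. -/

section Powers

variable {E : Type*} [NormedAddCommGroup E] [NormedSpace ℝ E] {F : E → ℝ} {U : Set E}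

theorem d3_log (hU : IsOpen U) (hF : ContDiffOn ℝ 3 F U) (hpos : ∀ t ∈ U, 0 < F t) :
    D3 (fun t => Real.log (F t)) U :=
  d3_of_contDiffOn hU (hF.log fun t ht => (hpos t ht).ne')

theorem d3_rpow (hU : IsOpen U) (hF : ContDiffOn ℝ 3 F U) (hpos : ∀ t ∈ U, 0 < F t) (a : ℝ) :
    D3 (fun t => F t ^ a) U :=
  d3_of_contDiffOn hU (hF.rpow_const_of_ne fun t ht => (hpos t ht).ne')

theorem fderiv_eq_smul_fderiv_log (hU : IsOpen U) (hF : ContDiffOn ℝ 3 F U)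
    (hpos : ∀ t ∈ U, 0 < F t) {θ : E} (hθ : θ ∈ U) :
    fderiv ℝ F θ = F θ • fderiv ℝ (fun t => Real.log (F t)) θ := by
  rw [fderiv.log (d3_of_contDiffOn hU hF θ hθ).1 (hpos θ hθ).ne', smul_smul,
    mul_inv_cancel₀ (hpos θ hθ).ne', one_smul]

theorem fderiv_rpow_eq (hU : IsOpen U) (hF : ContDiffOn ℝ 3 F U)
    (hpos : ∀ t ∈ U, 0 < F t) (a : ℝ) {θ : E} (hθ : θ ∈ U) :
    fderiv ℝ (fun t => F t ^ a) θ =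
      (a * F θ ^ a) • fderiv ℝ (fun t => Real.log (F t)) θ := by
  have h := (d3_of_contDiffOn hU hF θ hθ).1.hasFDerivAt.rpow_const (p := a)
    (Or.inl (hpos θ hθ).ne')
  rw [h.fderiv, fderiv_eq_smul_fderiv_log hU hF hpos hθ, smul_smul]
  congr 1
  rw [mul_assoc, Real.rpow_sub_one (hpos θ hθ).ne', div_mul_cancel₀ _ (hpos θ hθ).ne']

theorem fderiv_fderiv_rpow_apply (hU : IsOpen U) (hF : ContDiffOn ℝ 3 F U)
    (hpos : ∀ t ∈ U, 0 < F t) (a : ℝ) {θ : E} (hθ : θ ∈ U) (u v : E) :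
    fderiv ℝ (fderiv ℝ fun t => F t ^ a) θ u v =
      a ^ 2 * F θ ^ a * (fderiv ℝ (fun t => Real.log (F t)) θ u *
        fderiv ℝ (fun t => Real.log (F t)) θ v) +
      a * F θ ^ a * fderiv ℝ (fderiv ℝ fun t => Real.log (F t)) θ u v := by
  have h1 : fderiv ℝ (fun t => F t ^ a) =ᶠ[𝓝 θ]
      fun t => (a * F t ^ a) • fderiv ℝ (fun t => Real.log (F t)) t := by
    filter_upwards [hU.mem_nhds hθ] with t ht using fderiv_rpow_eq hU hF hpos a ht
  have h2 := ((d3_rpow hU hF hpos a θ hθ).1.hasFDerivAt.const_mul a).smul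
    (d3_log hU hF hpos θ hθ).2.1.hasFDerivAt
  have h3 : fderiv ℝ (fun t => (a * F t ^ a) • fderiv ℝ (fun t => Real.log (F t)) t) θ = _ :=
    h2.fderiv
  rw [h1.fderiv_eq, h3, fderiv_rpow_eq hU hF hpos a hθ]
  simp
  ring

end Powers

/-! ### Linear, bilinear and trilinear maps in coordinates. -/

section Coordinates

variable {p : ℕ} {F : Type*} [NormedAddCommGroup F] [NormedSpace ℝ F]

theorem eq_sum_dir (v : Param p) : v = ∑ j, v j • dir j := by
  ext i
  simp [dir, Finset.sum_apply, Pi.single_apply]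

theorem clm_apply_eq_sum (L : Param p →L[ℝ] F) (v : Param p) : L v = ∑ j, v j • L (dir j) := by
  conv_lhs => rw [eq_sum_dir v]
  simp

theorem norm_clm_le_sum (L : Param p →L[ℝ] F) : ‖L‖ ≤ ∑ j, ‖L (dir j)‖ := by
  refine L.opNorm_le_bound (Finset.sum_nonneg fun j _ => norm_nonneg _) fun v => ?_
  rw [clm_apply_eq_sum, Finset.sum_mul]
  refine (norm_sum_le _ _).trans (Finset.sum_le_sum fun j _ => ?_)
  rw [norm_smul, mul_comm]
  gcongr
  exact PiLp.norm_apply_le v j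

theorem norm_trilinear_le (T : Param p →L[ℝ] Param p →L[ℝ] Param p →L[ℝ] ℝ)
    {M : Fin p → Fin p → Fin p → ℝ} (hM : ∀ j k l, |T (dir j) (dir k) (dir l)| ≤ M j k l) :
    ‖T‖ ≤ ∑ j, ∑ k, ∑ l, M j k l := by
  refine (norm_clm_le_sum T).trans (Finset.sum_le_sum fun j _ => ?_)
  refine (norm_clm_le_sum _).trans (Finset.sum_le_sum fun k _ => ?_)
  exact (norm_clm_le_sum _).trans (Finset.sum_le_sum fun l _ => hM j k l)

theorem bilinear_eq_sum (T : Param p →L[ℝ] Param p →L[ℝ] ℝ) (u v : Param p) :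
    T u v = ∑ j, ∑ k, u j * v k * T (dir j) (dir k) := by
  rw [clm_apply_eq_sum T u, sum_apply]
  refine Finset.sum_congr rfl fun j _ => ?_
  rw [smul_apply, clm_apply_eq_sum (T (dir j)) v, Finset.smul_sum]
  exact Finset.sum_congr rfl fun k _ => by simp [mul_assoc]

end Coordinates

/-! ### Densities that may vanish identically. -/

section Nice

variable {E : Type*} [NormedAddCommGroup E] [NormedSpace ℝ E]

/-- A smooth nonnegative function that is either positive or zero throughout `U`. -/
def Nice (F : E → ℝ) (U : Set E) : Prop :=
  ContDiffOn ℝ 3 F U ∧ ((∀ t ∈ U, 0 < F t) ∨ ∀ t ∈ U, F t = 0)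

variable {F : E → ℝ} {U : Set E}

/-- Handles points outside the common support: there log F is constantly log 0 = 0 and F ^ a is
constantly 0 ^ a (which is 1 for a = 0), so the derivative formulas remain true with all derivatives
zero. -/
theorem d3_congr_const (hU : IsOpen U) {G : E → ℝ} {c : ℝ} (h : ∀ t ∈ U, G t = c) : D3 G U :=
  d3_of_contDiffOn hU ((contDiffOn_const (c := c)).congr h)

theorem fderiv_eq_zero_of_const (hU : IsOpen U) {G : E → ℝ} {c : ℝ} (h : ∀ t ∈ U, G t = c) {θ : E}
    (hθ : θ ∈ U) : fderiv ℝ G θ = 0 := by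
  have : G =ᶠ[𝓝 θ] fun _ => c := by
    filter_upwards [hU.mem_nhds hθ] with t ht using h t ht
  rw [this.fderiv_eq]; simp

theorem fderiv_fderiv_eq_zero_of_const (hU : IsOpen U) {G : E → ℝ} {c : ℝ}
    (h : ∀ t ∈ U, G t = c) {θ : E} (hθ : θ ∈ U) : fderiv ℝ (fderiv ℝ G) θ = 0 := by
  have : fderiv ℝ G =ᶠ[𝓝 θ] fun _ => 0 := by
    filter_upwards [hU.mem_nhds hθ] with t ht using fderiv_eq_zero_of_const hU h ht
  rw [this.fderiv_eq]; simp

theorem log_eq_zero_of_eq_zero {E : Type*} {F : E → ℝ} {U : Set E} (h0 : ∀ t ∈ U, F t = 0) :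
    ∀ t ∈ U, Real.log (F t) = 0 := fun t ht => by rw [h0 t ht, Real.log_zero]

theorem Nice.d3_log (hU : IsOpen U) (h : Nice F U) : D3 (fun t => Real.log (F t)) U := by
  rcases h.2 with hp | h0
  · exact DPD.d3_log hU h.1 hp
  · exact d3_congr_const hU (log_eq_zero_of_eq_zero h0)

theorem Nice.d3_rpow (hU : IsOpen U) (h : Nice F U) (a : ℝ) : D3 (fun t => F t ^ a) U := by
  rcases h.2 with hp | h0
  · exact DPD.d3_rpow hU h.1 hp a
  · exact d3_congr_const hU (c := 0 ^ a) fun t ht => by rw [h0 t ht]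

theorem Nice.fderiv_eq (hU : IsOpen U) (h : Nice F U) {θ : E} (hθ : θ ∈ U) :
    fderiv ℝ F θ = F θ • fderiv ℝ (fun t => Real.log (F t)) θ := by
  rcases h.2 with hp | h0
  · exact fderiv_eq_smul_fderiv_log hU h.1 hp hθ
  · rw [fderiv_eq_zero_of_const hU h0 hθ, h0 θ hθ, zero_smul]

theorem Nice.fderiv_rpow (hU : IsOpen U) (h : Nice F U) (a : ℝ) {θ : E} (hθ : θ ∈ U) :
    fderiv ℝ (fun t => F t ^ a) θ = (a * F θ ^ a) • fderiv ℝ (fun t => Real.log (F t)) θ := by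
  rcases h.2 with hp | h0
  · exact fderiv_rpow_eq hU h.1 hp a hθ
  · rw [fderiv_eq_zero_of_const hU (log_eq_zero_of_eq_zero h0) hθ, smul_zero,
      fderiv_eq_zero_of_const hU (c := 0 ^ a) (fun t ht => by rw [h0 t ht]) hθ]

theorem Nice.fderiv_fderiv_rpow (hU : IsOpen U) (h : Nice F U) (a : ℝ) {θ : E} (hθ : θ ∈ U)
    (u v : E) :
    fderiv ℝ (fderiv ℝ fun t => F t ^ a) θ u v =
      a ^ 2 * F θ ^ a * (fderiv ℝ (fun t => Real.log (F t)) θ u *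
        fderiv ℝ (fun t => Real.log (F t)) θ v) +
      a * F θ ^ a * fderiv ℝ (fderiv ℝ fun t => Real.log (F t)) θ u v := by
  rcases h.2 with hp | h0
  · exact fderiv_fderiv_rpow_apply hU h.1 hp a hθ u v
  · rw [fderiv_eq_zero_of_const hU (log_eq_zero_of_eq_zero h0) hθ,
      fderiv_fderiv_eq_zero_of_const hU (log_eq_zero_of_eq_zero h0) hθ,
      fderiv_fderiv_eq_zero_of_const hU (c := 0 ^ a) (fun t ht => by rw [h0 t ht]) hθ]
    simp

end Nice

/-! ### Integration against the law of one observation. -/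

section Law

variable {𝒳 : Type*} [MeasurableSpace 𝒳] {μ : Measure 𝒳} {p : ℕ} {f : Param p → 𝒳 → ℝ}
  {Θ : Set (Param p)}

theorem IsModel.measurable_density (h : IsModel μ f Θ) (θ : Param p) : Measurable (f θ) :=
  h.measurable.comp measurable_prodMk_left

theorem IsModel.pos_or_zero (h : IsModel μ f Θ) (x : 𝒳) :
    (∀ t ∈ Θ, 0 < f t x) ∨ ∀ t ∈ Θ, f t x = 0 := by
  by_cases hx : ∃ t ∈ Θ, 0 < f t x
  · obtain ⟨t, ht, hpos⟩ := hx
    exact Or.inl fun t' ht' => (Set.ext_iff.1 (h.common_support t ht t' ht') x).1 hpos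
  · push Not at hx
    exact Or.inr fun t ht => le_antisymm (hx t ht) (h.nonneg t ht x)

theorem IsModel.integrable_law_iff (h : IsModel μ f Θ) {θ : Param p} (hθ : θ ∈ Θ) {q : 𝒳 → ℝ} :
    Integrable q (law μ f θ) ↔ Integrable (fun x => f θ x * q x) μ := by
  rw [law, integrable_withDensity_iff_integrable_smul' (h.measurable_density θ).ennreal_ofReal
    (ae_of_all _ fun x => ENNReal.ofReal_lt_top)]
  simp only [ENNReal.toReal_ofReal (h.nonneg θ hθ _), smul_eq_mul]

theorem IsModel.integral_law (h : IsModel μ f Θ) {θ : Param p} (hθ : θ ∈ Θ) (q : 𝒳 → ℝ) :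
    ∫ x, q x ∂(law μ f θ) = ∫ x, f θ x * q x ∂μ := by
  rw [law, integral_withDensity_eq_integral_toReal_smul (h.measurable_density θ).ennreal_ofReal
    (ae_of_all _ fun x => ENNReal.ofReal_lt_top)]
  simp only [ENNReal.toReal_ofReal (h.nonneg θ hθ _), smul_eq_mul]

theorem IsModel.isProbabilityMeasure_law (h : IsModel μ f Θ) {θ : Param p} (hθ : θ ∈ Θ) :
    IsProbabilityMeasure (law μ f θ) := by
  constructor
  rw [law, withDensity_apply _ MeasurableSet.univ, Measure.restrict_univ,
    ← ofReal_integral_eq_lintegral_ofReal (h.integrable θ hθ) (ae_of_all _ (h.nonneg θ hθ)),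
    h.integral_eq_one θ hθ, ENNReal.ofReal_one]

end Law

/-! ### Gradient and Hessian of one term of the objective. -/

section Objective

variable {𝒳 : Type*} [MeasurableSpace 𝒳] {μ : Measure 𝒳} {p : ℕ} {f : Param p → 𝒳 → ℝ}
  {Θ ω N : Set (Param p)} {θ₀ : Param p} {τ : ℝ}

theorem IsModel.ae_nice (h : IsModel μ f Θ) (hωΘ : ω ⊆ Θ) (hs : SmoothDensity μ f ω) :
    ∀ᵐ x ∂μ, Nice (fun t => f t x) ω := by
  filter_upwards [hs] with x hx
  refine ⟨hx, (h.pos_or_zero x).imp (fun h' t ht => h' t (hωΘ ht)) fun h' t ht => h' t (hωΘ ht)⟩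

/-- The operator norm of a trilinear form is at most the sum of its absolute entries, so the
entrywise envelopes add up to a single one. -/
theorem ThirdDerivBound.exists_norm_le (h : ThirdDerivBound μ f ω N τ) :
    ∃ (M : 𝒳 → ℝ) (m : ℝ),
      (∀ᵐ x ∂μ, ∀ θ ∈ ω,
        ‖fderiv ℝ (fderiv ℝ (fderiv ℝ fun t => objTerm μ f τ t x)) θ‖ ≤ M x) ∧
      ∀ θ' ∈ N, Integrable M (law μ f θ') ∧ ∫ x, M x ∂(law μ f θ') ≤ m := by
  obtain ⟨M, m, hM, hm⟩ := h
  refine ⟨fun x => ∑ j, ∑ k, ∑ l, M j k l x, ∑ j, ∑ k, ∑ l, m j k l, ?_, fun θ' hθ' => ⟨?_, ?_⟩⟩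
  · filter_upwards [hM] with x hx θ hθ
    refine norm_trilinear_le _ fun j k l => ?_
    rw [← iteratedFDeriv_three_apply]
    exact hx θ hθ j k l
  · exact integrable_finsetSum _ fun j _ => integrable_finsetSum _ fun k _ =>
      integrable_finsetSum _ fun l _ => (hm θ' hθ' j k l).1
  · rw [integral_finsetSum _ fun j _ => integrable_finsetSum _ fun k _ =>
      integrable_finsetSum _ fun l _ => (hm θ' hθ' j k l).1]
    refine Finset.sum_le_sum fun j _ => ?_
    rw [integral_finsetSum _ fun k _ =>
      integrable_finsetSum _ fun l _ => (hm θ' hθ' j k l).1]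
    refine Finset.sum_le_sum fun k _ => ?_
    rw [integral_finsetSum _ fun l _ => (hm θ' hθ' j k l).1]
    exact Finset.sum_le_sum fun l _ => (hm θ' hθ' j k l).2

variable (μ f τ) in
/-- The integral `∫ f_θ^(1+τ)` as a function of the parameter. -/
def powInt (θ : Param p) : ℝ := ∫ x, f θ x ^ (1 + τ) ∂μ

theorem objTerm_zero (x : 𝒳) :
    (fun t => objTerm μ f 0 t x) = fun t => 0 - 1 * Real.log (f t x) := by
  ext t; simp [objTerm]

theorem objTerm_of_ne_zero (hτ : τ ≠ 0) (x : 𝒳) :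
    (fun t => objTerm μ f τ t x) = fun t => powInt μ f τ t - (1 + 1 / τ) * f t x ^ τ := by
  ext t; simp [objTerm, hτ, powInt]

/-- For τ = 0 the integral is the total mass. Its derivatives vanish, which lets the likelihood case
share the formulas of the case τ > 0. -/
theorem powInt_zero (hmodel : IsModel μ f Θ) (hωΘ : ω ⊆ Θ) {θ : Param p} (hθ : θ ∈ ω) :
    powInt μ f 0 θ = 1 := by
  simp only [powInt, add_zero, Real.rpow_one]
  exact hmodel.integral_eq_one θ (hωΘ hθ)

theorem DiffUnderIntegral.first {φ : Param p → 𝒳 → ℝ} (h : DiffUnderIntegral μ ω φ)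
    {θ : Param p} (hθ : θ ∈ ω) (j : Fin p) :
    Integrable (fun x => fderiv ℝ (fun t => φ t x) θ (dir j)) μ ∧
      fderiv ℝ (fun t => ∫ x, φ t x ∂μ) θ (dir j) =
        ∫ x, fderiv ℝ (fun t => φ t x) θ (dir j) ∂μ := by
  simpa using h.2 1 (by norm_num) (fun _ => j) θ hθ

theorem DiffUnderIntegral.second {φ : Param p → 𝒳 → ℝ} (h : DiffUnderIntegral μ ω φ)
    {θ : Param p} (hθ : θ ∈ ω) (j k : Fin p) :
    Integrable (fun x => fderiv ℝ (fderiv ℝ fun t => φ t x) θ (dir j) (dir k)) μ ∧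
      fderiv ℝ (fderiv ℝ fun t => ∫ x, φ t x ∂μ) θ (dir j) (dir k) =
        ∫ x, fderiv ℝ (fderiv ℝ fun t => φ t x) θ (dir j) (dir k) ∂μ := by
  simpa [iteratedFDeriv_two_apply] using h.2 2 (by norm_num) ![j, k] θ hθ

theorem DiffUnderIntegral.integrable {φ : Param p → 𝒳 → ℝ} (h : DiffUnderIntegral μ ω φ)
    {θ : Param p} (hθ : θ ∈ ω) : Integrable (φ θ) μ := by
  simpa using (h.2 0 (by norm_num) (fun i => i.elim0) θ hθ).1

theorem d3_powInt (hω : IsOpen ω) (h : DiffUnderIntegral μ ω fun θ x => f θ x ^ (1 + τ)) :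
    D3 (powInt μ f τ) ω :=
  d3_of_iteratedFDeriv hω h.1

theorem d3_objTerm (hω : IsOpen ω) (h : DiffUnderIntegral μ ω fun θ x => f θ x ^ (1 + τ))
    {x : 𝒳} (hx : Nice (fun t => f t x) ω) : D3 (fun t => objTerm μ f τ t x) ω := by
  by_cases hτ : τ = 0
  · subst hτ
    rw [objTerm_zero]
    exact (d3_congr_const hω (c := (0 : ℝ)) fun _ _ => rfl).sub_const_mul hω (hx.d3_log hω) 1
  · rw [objTerm_of_ne_zero hτ]
    exact (d3_powInt hω h).sub_const_mul hω (hx.d3_rpow hω τ) _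

theorem fderiv_objTerm (hmodel : IsModel μ f Θ) (hω : IsOpen ω) (hωΘ : ω ⊆ Θ)
    (h : DiffUnderIntegral μ ω fun θ x => f θ x ^ (1 + τ))
    {x : 𝒳} (hx : Nice (fun t => f t x) ω) {θ : Param p} (hθ : θ ∈ ω) :
    fderiv ℝ (fun t => objTerm μ f τ t x) θ = fderiv ℝ (powInt μ f τ) θ -
      ((1 + τ) * f θ x ^ τ) • fderiv ℝ (fun t => Real.log (f t x)) θ := by
  by_cases hτ : τ = 0
  · subst hτ
    rw [objTerm_zero, fderiv_sub_const_mul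
      (d3_congr_const hω (c := (0 : ℝ)) fun _ _ => rfl) (hx.d3_log hω) 1 hθ,
      fderiv_eq_zero_of_const hω (fun t ht => powInt_zero hmodel hωΘ ht) hθ]
    simp
  · rw [objTerm_of_ne_zero hτ, fderiv_sub_const_mul (d3_powInt hω h) (hx.d3_rpow hω τ) _ hθ,
      hx.fderiv_rpow hω τ hθ, smul_smul]
    congr 2
    field_simp
    ring

theorem fderiv_fderiv_objTerm (hmodel : IsModel μ f Θ) (hω : IsOpen ω) (hωΘ : ω ⊆ Θ)
    (h : DiffUnderIntegral μ ω fun θ x => f θ x ^ (1 + τ))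
    {x : 𝒳} (hx : Nice (fun t => f t x) ω) {θ : Param p} (hθ : θ ∈ ω) (u v : Param p) :
    fderiv ℝ (fderiv ℝ fun t => objTerm μ f τ t x) θ u v =
      fderiv ℝ (fderiv ℝ (powInt μ f τ)) θ u v -
      (1 + τ) * f θ x ^ τ * (τ * (fderiv ℝ (fun t => Real.log (f t x)) θ u *
        fderiv ℝ (fun t => Real.log (f t x)) θ v) +
        fderiv ℝ (fderiv ℝ fun t => Real.log (f t x)) θ u v) := by
  by_cases hτ : τ = 0
  · subst hτ
    rw [objTerm_zero, fderiv_fderiv_sub_const_mul hω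
      (d3_congr_const hω (c := (0 : ℝ)) fun _ _ => rfl) (hx.d3_log hω) 1 hθ,
      fderiv_fderiv_eq_zero_of_const hω (fun t ht => powInt_zero hmodel hωΘ ht) hθ,
      fderiv_fderiv_eq_zero_of_const hω (c := (0 : ℝ)) (fun _ _ => rfl) hθ]
    simp
  · rw [objTerm_of_ne_zero hτ, fderiv_fderiv_sub_const_mul hω (d3_powInt hω h)
      (hx.d3_rpow hω τ) _ hθ, sub_apply, sub_apply, smul_apply, smul_apply,
      hx.fderiv_fderiv_rpow hω τ hθ, smul_eq_mul]
    field_simp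
    ring

/-- The score equation: `ξ` is, up to a factor, the gradient of `∫ f^(1+τ)`. -/
theorem fderiv_powInt (hω : IsOpen ω) (hτ : 0 ≤ τ)
    (h : DiffUnderIntegral μ ω fun θ x => f θ x ^ (1 + τ))
    (hn : ∀ᵐ x ∂μ, Nice (fun t => f t x) ω) {θ : Param p} (hθ : θ ∈ ω) (j : Fin p) :
    Integrable (fun x => score f θ x j * f θ x ^ (1 + τ)) μ ∧
      fderiv ℝ (powInt μ f τ) θ (dir j) = (1 + τ) * vecXi μ f τ θ j := by
  obtain ⟨h1, h2⟩ := h.first hθ j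
  have hae : (fun x => fderiv ℝ (fun t => f t x ^ (1 + τ)) θ (dir j)) =ᵐ[μ]
      fun x => (1 + τ) * (score f θ x j * f θ x ^ (1 + τ)) := by
    filter_upwards [hn] with x hx
    rw [hx.fderiv_rpow hω (1 + τ) hθ, smul_apply, smul_eq_mul, score]
    ring
  have h0 : (1 + τ) ≠ 0 := by linarith
  refine ⟨(integrable_const_mul_iff (isUnit_iff_ne_zero.2 h0) _).1 (h1.congr hae), ?_⟩
  rw [show powInt μ f τ = fun t => ∫ x, f t x ^ (1 + τ) ∂μ from rfl, h2,
    integral_congr_ae hae, integral_const_mul, vecXi]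

theorem fderiv_objTerm_dir (hmodel : IsModel μ f Θ) (hω : IsOpen ω) (hωΘ : ω ⊆ Θ) (hτ : 0 ≤ τ)
    (h : DiffUnderIntegral μ ω fun θ x => f θ x ^ (1 + τ))
    (hn : ∀ᵐ x ∂μ, Nice (fun t => f t x) ω)
    {x : 𝒳} (hx : Nice (fun t => f t x) ω) {θ : Param p} (hθ : θ ∈ ω) (j : Fin p) :
    fderiv ℝ (fun t => objTerm μ f τ t x) θ (dir j) =
      -(1 + τ) * (score f θ x j * f θ x ^ τ - vecXi μ f τ θ j) := by
  rw [fderiv_objTerm hmodel hω hωΘ h hx hθ, sub_apply,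
    (fderiv_powInt hω hτ h hn hθ j).2, smul_apply, smul_eq_mul, score]
  ring

/-- The expected Hessian of the objective at the true parameter. -/
theorem integral_hessian_objTerm (hmodel : IsModel μ f Θ) (hω : IsOpen ω) (hωΘ : ω ⊆ Θ)
    (hτ : 0 ≤ τ) (h : DiffUnderIntegral μ ω fun θ x => f θ x ^ (1 + τ))
    (hn : ∀ᵐ x ∂μ, Nice (fun t => f t x) ω) {θ : Param p} (hθ : θ ∈ ω)
    (hJ : ∀ j k, Integrable (fun x => score f θ x j * score f θ x k * f θ x ^ (1 + τ)) μ)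
    (j k : Fin p) :
    Integrable (fun x => fderiv ℝ (fderiv ℝ fun t => objTerm μ f τ t x) θ (dir j) (dir k))
      (law μ f θ) ∧
    ∫ x, fderiv ℝ (fderiv ℝ fun t => objTerm μ f τ t x) θ (dir j) (dir k) ∂(law μ f θ) =
      (1 + τ) * matJ μ f τ θ j k := by
  have hθΘ := hωΘ hθ
  obtain ⟨h1, h2⟩ := h.second hθ j k
  set c := fderiv ℝ (fderiv ℝ (powInt μ f τ)) θ (dir j) (dir k) with hc
  -- The second derivative of log f is eliminated in favour of that of f^(1+τ). Since (1+τ)² -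
  -- τ(1+τ) = 1+τ, one term of J type is left, and the two Hessians of `powInt` cancel on
  -- integration.
  have hae : (fun x => f θ x *
      fderiv ℝ (fderiv ℝ fun t => objTerm μ f τ t x) θ (dir j) (dir k)) =ᵐ[μ]
      fun x => c * f θ x + ((1 + τ) * (score f θ x j * score f θ x k * f θ x ^ (1 + τ)) -
        fderiv ℝ (fderiv ℝ fun t => f t x ^ (1 + τ)) θ (dir j) (dir k)) := by
    filter_upwards [hn] with x hx
    rw [fderiv_fderiv_objTerm hmodel hω hωΘ h hx hθ, hx.fderiv_fderiv_rpow hω (1 + τ) hθ]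
    have hpow : f θ x ^ (1 + τ) = f θ x * f θ x ^ τ := by
      rcases (hmodel.nonneg θ hθΘ x).lt_or_eq with hp | h0
      · rw [Real.rpow_add hp, Real.rpow_one]
      · rw [← h0, Real.zero_rpow (by linarith), zero_mul]
    rw [hpow]
    simp only [score]
    ring
  have hi1 : Integrable (fun x => c * f θ x) μ := (hmodel.integrable θ hθΘ).const_mul c
  have hi2 := (hJ j k).const_mul (1 + τ)
  have hi3 : Integrable (fun x => (1 + τ) * (score f θ x j * score f θ x k * f θ x ^ (1 + τ)) -
      fderiv ℝ (fderiv ℝ fun t => f t x ^ (1 + τ)) θ (dir j) (dir k)) μ := hi2.sub h1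
  rw [hmodel.integrable_law_iff hθΘ, hmodel.integral_law hθΘ]
  refine ⟨(hi1.add hi3).congr hae.symm, ?_⟩
  rw [integral_congr_ae hae, integral_add hi1 hi3, integral_sub hi2 h1, ← h2,
    integral_const_mul, integral_const_mul, hmodel.integral_eq_one θ hθΘ]
  simp only [matJ, Matrix.of_apply]
  rw [show (fun t => ∫ x, f t x ^ (1 + τ) ∂μ) = powInt μ f τ from rfl, ← hc]
  ring

/-- Since f · f^τ = f^(1+τ), the centring ξ is by definition the mean of u f^τ under f;
integrability comes from differentiating `powInt` under the integral. -/
theorem integral_gradient_objTerm (hmodel : IsModel μ f Θ) (hω : IsOpen ω) (hωΘ : ω ⊆ Θ)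
    (hτ : 0 ≤ τ) (h : DiffUnderIntegral μ ω fun θ x => f θ x ^ (1 + τ))
    (hn : ∀ᵐ x ∂μ, Nice (fun t => f t x) ω) {θ : Param p} (hθ : θ ∈ ω) (j : Fin p) :
    Integrable (fun x => score f θ x j * f θ x ^ τ - vecXi μ f τ θ j) (law μ f θ) ∧
    ∫ x, (score f θ x j * f θ x ^ τ - vecXi μ f τ θ j) ∂(law μ f θ) = 0 := by
  have hθΘ := hωΘ hθ
  obtain ⟨h1, h2⟩ := fderiv_powInt hω hτ h hn hθ j
  have hae : (fun x => f θ x * (score f θ x j * f θ x ^ τ - vecXi μ f τ θ j)) =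
      fun x => score f θ x j * f θ x ^ (1 + τ) - vecXi μ f τ θ j * f θ x := by
    ext x
    have hpow : f θ x ^ (1 + τ) = f θ x * f θ x ^ τ := by
      rcases (hmodel.nonneg θ hθΘ x).lt_or_eq with hp | h0
      · rw [Real.rpow_add hp, Real.rpow_one]
      · rw [← h0, Real.zero_rpow (by linarith), zero_mul]
    rw [hpow]; ring
  have hi := (hmodel.integrable θ hθΘ).const_mul (vecXi μ f τ θ j)
  rw [hmodel.integrable_law_iff hθΘ, hmodel.integral_law hθΘ, hae]
  refine ⟨h1.sub hi, ?_⟩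
  rw [integral_sub h1 hi, integral_const_mul, hmodel.integral_eq_one θ hθΘ, mul_one]
  exact sub_self _

end Objective

/-! ### Local quadratic expansion of the divergence. -/

section Divergence

variable {𝒳 : Type*} [MeasurableSpace 𝒳] {μ : Measure 𝒳} {p : ℕ} {f : Param p → 𝒳 → ℝ}
  {Θ ω N : Set (Param p)} {θ₀ : Param p} {τ : ℝ}

theorem measurable_objTerm (hmodel : IsModel μ f Θ) (θ : Param p) :
    Measurable (objTerm μ f τ θ) := by
  have := hmodel.measurable_density θ
  by_cases hτ : τ = 0
  · have h : objTerm μ f τ θ = fun x => -Real.log (f θ x) := by ext x; simp [objTerm, hτ]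
    rw [h]; fun_prop
  · have h : objTerm μ f τ θ = fun x => powInt μ f τ θ - (1 + 1 / τ) * f θ x ^ τ := by
      ext x; simp [objTerm, hτ, powInt]
    rw [h]; fun_prop

theorem fderiv_apply_eq_dot (L : Param p →L[ℝ] ℝ) (v : Param p) :
    L v = ∑ j, v j * L (dir j) := by
  rw [clm_apply_eq_sum]; rfl

/-- The divergence is the expected difference of the objective. -/
theorem divergence_eq_integral (hmodel : IsModel μ f Θ) (hωΘ : ω ⊆ Θ) (hτ : 0 ≤ τ)
    (hself : DiffUnderIntegral μ ω fun θ x => f θ x ^ (1 + τ)) {s t : Param p}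
    (htrue : DiffUnderIntegral μ ω fun θ x => f θ x ^ τ * f s x) (hs : s ∈ ω) (ht : t ∈ ω) :
    divergence μ τ (f s) (f t) =
      ∫ x, (objTerm μ f τ t x - objTerm μ f τ s x) ∂(law μ f s) := by
  rw [hmodel.integral_law (hωΘ hs)]
  by_cases h0 : τ = 0
  · rw [divergence, if_pos h0]
    refine integral_congr_ae (ae_of_all _ fun x => ?_)
    simp only [objTerm, if_pos h0]
    -- Off the common support the factor `f s x` kills both integrands; on it the logarithm of the
    -- quotient splits.
    rcases hmodel.pos_or_zero x with hp | hz
    · rw [Real.log_div (hp s (hωΘ hs)).ne' (hp t (hωΘ ht)).ne']; ring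
    · rw [hz s (hωΘ hs)]; ring
  · have hpos : 0 < τ := lt_of_le_of_ne hτ (Ne.symm h0)
    have hit := hself.integrable ht
    have his := hself.integrable hs
    have hts := (htrue.integrable ht).const_mul (1 + 1 / τ)
    have hsc := his.const_mul (1 / τ)
    have hfs := (hmodel.integrable s (hωΘ hs)).const_mul (powInt μ f τ t - powInt μ f τ s)
    rw [divergence, if_neg h0]
    have e1 : ∫ x, (f t x ^ (1 + τ) - (1 + 1 / τ) * (f t x ^ τ * f s x) +
        1 / τ * f s x ^ (1 + τ)) ∂μ = powInt μ f τ t -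
          (1 + 1 / τ) * ∫ x, f t x ^ τ * f s x ∂μ + 1 / τ * powInt μ f τ s := by
      have h1 : Integrable (fun x => f t x ^ (1 + τ) - (1 + 1 / τ) * (f t x ^ τ * f s x)) μ :=
        hit.sub hts
      rw [integral_add h1 hsc, integral_sub hit hts, integral_const_mul, integral_const_mul]
      rfl
    have e2 : (fun x => f s x * (objTerm μ f τ t x - objTerm μ f τ s x)) =
        fun x => (powInt μ f τ t - powInt μ f τ s) * f s x -
          ((1 + 1 / τ) * (f t x ^ τ * f s x) - (1 + 1 / τ) * f s x ^ (1 + τ)) := by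
      ext x
      have hpow : f s x ^ (1 + τ) = f s x * f s x ^ τ := by
        rcases (hmodel.nonneg s (hωΘ hs) x).lt_or_eq with hp | h0
        · rw [Real.rpow_add hp, Real.rpow_one]
        · rw [← h0, Real.zero_rpow (by linarith), zero_mul]
      rw [hpow]
      simp only [objTerm, if_neg h0, powInt]
      ring
    have h2 := his.const_mul (1 + 1 / τ)
    have h3 : Integrable (fun x => (1 + 1 / τ) * (f t x ^ τ * f s x) -
      (1 + 1 / τ) * f s x ^ (1 + τ)) μ := hts.sub h2
    rw [e1, e2, integral_sub hfs h3, integral_sub hts h2, integral_const_mul,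
      integral_const_mul, integral_const_mul, hmodel.integral_eq_one s (hωΘ hs),
      show ∫ x, f s x ^ (1 + τ) ∂μ = powInt μ f τ s from rfl]
    ring

/-- Second order expansion of the divergence, uniform in both parameters. -/
theorem abs_divergence_sub_le (hmodel : IsModel μ f Θ) (hω : IsOpen ω) (hωΘ : ω ⊆ Θ)
    (hτ : 0 ≤ τ) (hB : BasuConditions μ f ω ω θ₀ τ) {U : Set (Param p)} (hU : IsOpen U)
    (hUc : Convex ℝ U) (hUω : U ⊆ ω) :
    ∃ C : ℝ, ∀ s ∈ U, ∀ t ∈ U, |2 * divergence μ τ (f s) (f t) -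
      (t - s).ofLp ⬝ᵥ ((1 + τ) • matJ μ f τ s) *ᵥ (t - s).ofLp| ≤ C * ‖t - s‖ ^ 3 := by
  obtain ⟨M, m, hM, hm⟩ := hB.third_deriv.exists_norm_le
  -- The expansion is taken under the law of s itself, where the gradient has mean zero and the
  -- Hessian has mean (1+τ)J(s). The envelope's mean is at most m for every s in ω, so the constant
  -- is uniform; the 2 comes from doubling the divergence.
  refine ⟨2 * m, fun s hs t ht => ?_⟩
  have hsω := hUω hs
  have htω := hUω ht
  have hsΘ := hωΘ hsω
  set h := t - s with hh
  set ν := law μ f s with hν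
  have hprob : IsProbabilityMeasure ν := hmodel.isProbabilityMeasure_law hsΘ
  have hn := hmodel.ae_nice hωΘ hB.smooth
  have hself := hB.diff_self
  rw [divergence_eq_integral hmodel hωΘ hτ hself (hB.diff_true s hsω) hsω htω]
  have hhess := fun j k => integral_hessian_objTerm hmodel hω hωΘ hτ hself hn hsω
    (hB.J_integrable s hsω) j k
  have hgrad := fun j => integral_gradient_objTerm hmodel hω hωΘ hτ hself hn hsω j
  obtain ⟨hMi, hMm⟩ := hm s hsω
  -- the linear and quadratic terms of the expansion
  set l : 𝒳 → ℝ := fun x => ∑ j, h j * (-(1 + τ) * (score f s x j * f s x ^ τ - vecXi μ f τ s j))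
    with hl
  set q : 𝒳 → ℝ := fun x => ∑ j, ∑ k, h j * h k *
    fderiv ℝ (fderiv ℝ fun t => objTerm μ f τ t x) s (dir j) (dir k) with hq
  have hli : Integrable l ν :=
    integrable_finsetSum _ fun j _ => (((hgrad j).1).const_mul _).const_mul _
  have hl0 : ∫ x, l x ∂ν = 0 := by
    rw [hl, integral_finsetSum _ fun j _ => (((hgrad j).1).const_mul _).const_mul _]
    refine Finset.sum_eq_zero fun j _ => ?_
    rw [integral_const_mul, integral_const_mul, (hgrad j).2, mul_zero, mul_zero]
  have hqi : Integrable q ν :=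
    integrable_finsetSum _ fun j _ => integrable_finsetSum _ fun k _ => ((hhess j k).1).const_mul _
  have hq0 : ∫ x, q x ∂ν = h.ofLp ⬝ᵥ ((1 + τ) • matJ μ f τ s) *ᵥ h.ofLp := by
    rw [hq, integral_finsetSum _ fun j _ =>
      integrable_finsetSum _ fun k _ => ((hhess j k).1).const_mul _]
    simp only [dotProduct, Matrix.mulVec, Finset.mul_sum]
    refine Finset.sum_congr rfl fun j _ => ?_
    rw [integral_finsetSum _ fun k _ => ((hhess j k).1).const_mul _]
    refine Finset.sum_congr rfl fun k _ => ?_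
    rw [integral_const_mul, (hhess j k).2, Matrix.smul_apply, smul_eq_mul]
    ring
  have hR : ∀ᵐ x ∂ν, ‖objTerm μ f τ t x - objTerm μ f τ s x - l x - 1 / 2 * q x‖ ≤
      M x * ‖h‖ ^ 3 := by
    refine (withDensity_absolutelyContinuous _ _).ae_le ?_
    filter_upwards [hn, hM] with x hx hMx
    have hT := abs_sub_taylor_le hU hUc (fun θ hθ => d3_objTerm hω hself hx θ (hUω hθ))
      (fun θ hθ => hMx θ (hUω hθ)) hs ht
    have e1 : l x = fderiv ℝ (fun t => objTerm μ f τ t x) s (t - s) := by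
      rw [fderiv_apply_eq_dot]
      simp only [hl, fderiv_objTerm_dir hmodel hω hωΘ hτ hself hn hx hsω]
      rfl
    have e2 : q x = fderiv ℝ (fderiv ℝ fun t => objTerm μ f τ t x) s (t - s) (t - s) := by
      rw [bilinear_eq_sum]
    rw [e1, e2, Real.norm_eq_abs]
    exact hT
  have hRm : AEStronglyMeasurable
      (fun x => objTerm μ f τ t x - objTerm μ f τ s x - l x - 1 / 2 * q x) ν :=
    ((((measurable_objTerm hmodel t).sub (measurable_objTerm hmodel s)).aestronglyMeasurable).sub
      hli.aestronglyMeasurable).sub (hqi.const_mul (1 / 2)).aestronglyMeasurable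
  have hRi : Integrable (fun x => objTerm μ f τ t x - objTerm μ f τ s x - l x - 1 / 2 * q x) ν :=
    (hMi.mul_const (‖h‖ ^ 3)).mono' hRm hR
  have hlq : Integrable (fun x => l x + 1 / 2 * q x) ν := hli.add (hqi.const_mul _)
  have hsplit : ∫ x, (objTerm μ f τ t x - objTerm μ f τ s x) ∂ν =
      ∫ x, (objTerm μ f τ t x - objTerm μ f τ s x - l x - 1 / 2 * q x) ∂ν +
        1 / 2 * (h.ofLp ⬝ᵥ ((1 + τ) • matJ μ f τ s) *ᵥ h.ofLp) := by
    rw [← hq0, ← integral_const_mul, ← zero_add (∫ x, 1 / 2 * q x ∂ν), ← hl0,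
      ← integral_add hli (hqi.const_mul _), ← integral_add hRi hlq]
    refine integral_congr_ae (ae_of_all _ fun x => ?_)
    ring
  have hbound : |∫ x, (objTerm μ f τ t x - objTerm μ f τ s x - l x - 1 / 2 * q x) ∂ν| ≤
      m * ‖h‖ ^ 3 := by
    rw [← Real.norm_eq_abs]
    refine (norm_integral_le_of_norm_le (hMi.mul_const (‖h‖ ^ 3)) hR).trans ?_
    rw [integral_mul_const]
    gcongr
  rw [hsplit]
  rw [abs_le] at hbound ⊢
  constructor <;> linarith [hbound.1, hbound.2]

/-- Substitute ∂f = f u, which holds at almost every x, also where f vanishes. This makes A positive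
definite and links it to the expansion of the divergence. -/
theorem matA_eq (hmodel : IsModel μ f Θ) (hω : IsOpen ω) (hωΘ : ω ⊆ Θ) (hτ : 0 ≤ τ)
    (hs : SmoothDensity μ f ω) {θ : Param p} (hθ : θ ∈ ω) :
    matA μ f τ θ = (1 + τ) • matJ μ f τ θ := by
  ext i j
  simp only [matA, matJ, Matrix.of_apply, Matrix.smul_apply, smul_eq_mul]
  congr 1
  refine integral_congr_ae ?_
  filter_upwards [hmodel.ae_nice hωΘ hs] with x hx
  rw [hx.fderiv_eq hω hθ, smul_apply, smul_apply, smul_eq_mul, smul_eq_mul]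
  have hpow : f θ x ^ (τ - 1) * f θ x * f θ x = f θ x ^ (1 + τ) := by
    rcases (hmodel.nonneg θ (hωΘ hθ) x).lt_or_eq with hp | h0
    · rw [Real.rpow_sub_one hp.ne', div_mul_cancel₀ _ hp.ne', add_comm, Real.rpow_add_one hp.ne']
    · rw [← h0, mul_zero, Real.zero_rpow (by linarith)]
  rw [← hpow]
  simp only [score]
  ring

theorem abs_dotProduct_mulVec_le {m n : Type*} [Fintype m] [Fintype n] (M : Matrix m n ℝ)
    (u : m → ℝ) (v : n → ℝ) {b c e : ℝ} (hM : ∀ i j, |M i j| ≤ e) (hu : ∀ i, |u i| ≤ b)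
    (hv : ∀ j, |v j| ≤ c) (hb : 0 ≤ b) (he : 0 ≤ e) :
    |u ⬝ᵥ M *ᵥ v| ≤ Fintype.card m * Fintype.card n * (b * e * c) := by
  simp only [dotProduct, Matrix.mulVec, Finset.mul_sum]
  refine (Finset.abs_sum_le_sum_abs _ _).trans ?_
  refine (Finset.sum_le_sum fun i _ => Finset.abs_sum_le_sum_abs _ _).trans ?_
  refine (Finset.sum_le_sum fun i _ => Finset.sum_le_sum fun j _ => ?_).trans
    (b := ∑ _i : m, ∑ _j : n, b * e * c) ?_
  · rw [abs_mul, abs_mul, mul_assoc]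
    exact mul_le_mul (hu i) (mul_le_mul (hM i j) (hv j) (abs_nonneg _) he)
      (by positivity) hb
  · simp [mul_assoc]

/-- Near `θ₀`, twice the divergence is the quadratic form of `A` up to a small relative error. -/
theorem exists_ball_abs_divergence_sub_le (hmodel : IsModel μ f Θ) (hω : IsOpen ω) (hωΘ : ω ⊆ Θ)
    (hτ : 0 ≤ τ) (hB : BasuConditions μ f ω ω θ₀ τ) (hθ : θ₀ ∈ ω) {ε : ℝ} (hε : 0 < ε) :
    ∃ ρ > 0, ∀ s ∈ Metric.ball θ₀ ρ, ∀ t ∈ Metric.ball θ₀ ρ,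
      |2 * divergence μ τ (f s) (f t) -
        (s - t).ofLp ⬝ᵥ matA μ f τ θ₀ *ᵥ (s - t).ofLp| ≤ ε * ‖s - t‖ ^ 2 := by
  obtain ⟨r, hr, hrω⟩ := Metric.isOpen_iff.1 hω θ₀ hθ
  obtain ⟨C, hC⟩ := abs_divergence_sub_le hmodel hω hωΘ hτ hB Metric.isOpen_ball
    (convex_ball θ₀ r) hrω
  have hp : (0 : ℝ) ≤ p := Nat.cast_nonneg p
  -- Half of ε pays for replacing J(s) by J(θ₀), through p² entries each off by (1+τ)e; the other
  -- half pays for the cubic remainder. The added 1 keeps the denominator positive when p = 0.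
  set e := ε / (2 * (p * p * (1 + τ) + 1)) with he
  have he0 : 0 < e := by positivity
  have hJ : ∀ᶠ s in 𝓝 θ₀, ∀ j k, |matJ μ f τ s j k - matJ μ f τ θ₀ j k| ≤ e := by
    have hc := hB.J_continuous.continuousAt (hω.mem_nhds hθ)
    refine eventually_all.2 fun j => eventually_all.2 fun k => ?_
    have h1 : Tendsto (fun s => matJ μ f τ s j k) (𝓝 θ₀) (𝓝 (matJ μ f τ θ₀ j k)) :=
      ((continuous_apply k).tendsto _).comp (((continuous_apply j).tendsto _).comp hc)
    filter_upwards [Metric.tendsto_nhds.1 h1 e he0] with s hs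
    exact (Real.dist_eq _ _ ▸ hs).le
  obtain ⟨ρ₁, hρ₁, hJ⟩ := Metric.eventually_nhds_iff_ball.1 hJ
  refine ⟨min (min r ρ₁) (ε / (4 * (|C| + 1))), by positivity, fun s hs t ht => ?_⟩
  rw [Metric.mem_ball, lt_min_iff, lt_min_iff] at hs ht
  have h1 := hC s hs.1.1 t ht.1.1
  have hst : ‖t - s‖ ≤ ε / (2 * (|C| + 1)) := by
    rw [← dist_eq_norm]
    refine (dist_triangle_right t s θ₀).trans ?_
    have : ε / (2 * (|C| + 1)) = ε / (4 * (|C| + 1)) + ε / (4 * (|C| + 1)) := by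
      field_simp; ring
    linarith [hs.2, ht.2]
  have h2 : C * ‖t - s‖ ^ 3 ≤ ε / 2 * ‖t - s‖ ^ 2 := by
    have h3 : C * ‖t - s‖ ≤ ε / 2 := by
      refine (mul_le_mul (le_trans (le_abs_self C) (le_add_of_nonneg_right zero_le_one)) hst
        (norm_nonneg _) (by positivity)).trans ?_
      apply le_of_eq
      have : |C| + 1 ≠ 0 := by positivity
      field_simp
    calc C * ‖t - s‖ ^ 3 = C * ‖t - s‖ * ‖t - s‖ ^ 2 := by ring
      _ ≤ _ := mul_le_mul_of_nonneg_right h3 (sq_nonneg _)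
  have h4 : |(t - s).ofLp ⬝ᵥ ((1 + τ) • matJ μ f τ s - (1 + τ) • matJ μ f τ θ₀) *ᵥ (t - s).ofLp| ≤
      ε / 2 * ‖t - s‖ ^ 2 := by
    refine (abs_dotProduct_mulVec_le _ _ _ (b := ‖t - s‖) (c := ‖t - s‖) (e := (1 + τ) * e)
      (fun j k => ?_) (fun j => PiLp.norm_apply_le (t - s) j) (fun j => PiLp.norm_apply_le (t - s) j)
      (norm_nonneg _) (by positivity)).trans ?_
    · rw [← smul_sub, Matrix.smul_apply, Matrix.sub_apply, smul_eq_mul, abs_mul,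
        abs_of_nonneg (by linarith : (0 : ℝ) ≤ 1 + τ)]
      gcongr
      exact hJ s hs.1.2 j k
    · rw [Fintype.card_fin]
      have h5 : (p : ℝ) * p * (1 + τ) * e ≤ ε / 2 := by
        rw [he, mul_div_assoc', div_le_div_iff₀ (by positivity) (by positivity)]
        nlinarith [mul_nonneg (mul_nonneg hp hp) (by linarith : (0 : ℝ) ≤ 1 + τ)]
      calc (p : ℝ) * p * (‖t - s‖ * ((1 + τ) * e) * ‖t - s‖) =
          p * p * (1 + τ) * e * ‖t - s‖ ^ 2 := by ring
        _ ≤ _ := mul_le_mul_of_nonneg_right h5 (sq_nonneg _)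
  rw [matA_eq hmodel hω hωΘ hτ hB.smooth hθ]
  rw [Matrix.sub_mulVec, dotProduct_sub] at h4
  have h6 : (s - t).ofLp = -(t - s).ofLp := by rw [← WithLp.ofLp_neg, neg_sub]
  rw [h6, Matrix.mulVec_neg, neg_dotProduct_neg, norm_sub_rev s t]
  rw [abs_le] at h1 h4 ⊢
  constructor <;> linarith [h1.1, h1.2, h4.1, h4.2]

end Divergence

/-! ### Perturbed linear systems and the bordered matrix. -/

section Perturbation

/-- An approximate solution of a linear system is close to the exact one. -/
theorem exists_norm_sub_mulVec_le {ι : Type*} [Fintype ι] [DecidableEq ι] {R L : Matrix ι ι ℝ}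
    (hRL : R * L = 1) :
    ∃ C > 0, ∀ ε : ℝ, 0 ≤ ε → C * ε ≤ 1 → ∀ y z : ι → ℝ, ‖z - L *ᵥ y‖ ≤ ε * ‖y‖ →
      ‖y - R *ᵥ z‖ ≤ C * ε * ‖z‖ ∧ ‖y‖ ≤ C * ‖z‖ := by
  set T := LinearMap.toContinuousLinearMap (Matrix.mulVecLin R) with hT
  have hTa : ∀ v, R *ᵥ v = T v := fun v => rfl
  set c := ‖T‖
  have hc : 0 ≤ c := norm_nonneg T
  -- The summand 2c gives cε ≤ 1/2, which absorbs ‖y‖ and yields ‖y‖ ≤ 2c‖z‖; the summand 2c² then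
  -- bounds the error cε‖y‖ relative to ‖z‖.
  refine ⟨2 * c ^ 2 + 2 * c + 1, by positivity, fun ε hε hCε y z h => ?_⟩
  have h1 : ‖y - R *ᵥ z‖ ≤ c * (ε * ‖y‖) := by
    have e : y - R *ᵥ z = -T (z - L *ᵥ y) := by
      rw [← hTa, Matrix.mulVec_sub, Matrix.mulVec_mulVec, hRL, Matrix.one_mulVec, neg_sub]
    rw [e, norm_neg]
    exact (T.le_opNorm _).trans (mul_le_mul_of_nonneg_left h hc)
  have h2 : ‖R *ᵥ z‖ ≤ c * ‖z‖ := T.le_opNorm z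
  have h3 : ‖y‖ ≤ ‖y - R *ᵥ z‖ + ‖R *ᵥ z‖ := by
    simpa using norm_add_le (y - R *ᵥ z) (R *ᵥ z)
  have h4 : c * ε ≤ 1 / 2 := by nlinarith [mul_nonneg (sq_nonneg c) hε]
  have h5 : ‖y‖ ≤ 2 * c * ‖z‖ := by nlinarith [norm_nonneg y]
  refine ⟨h1.trans ?_, h5.trans ?_⟩
  · calc c * (ε * ‖y‖) ≤ c * (ε * (2 * c * ‖z‖)) := by gcongr
      _ = 2 * c ^ 2 * ε * ‖z‖ := by ring
      _ ≤ _ := by gcongr; linarith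
  · gcongr
    nlinarith [sq_nonneg c]

/-- The projection matrix `J⁻¹ G (Gᵀ J⁻¹ G)⁻¹ Gᵀ J⁻¹` occurs in the inverse of the bordered
matrix. -/
theorem fromBlocks_mul_fromBlocks_eq_one {p r : ℕ} {J : Matrix (Fin p) (Fin p) ℝ}
    {G : Matrix (Fin p) (Fin r) ℝ} (hJ : IsUnit J.det)
    (hN : IsUnit (Gᵀ * J⁻¹ * G).det) :
    Matrix.fromBlocks (J⁻¹ - J⁻¹ * G * (Gᵀ * J⁻¹ * G)⁻¹ * Gᵀ * J⁻¹)
      (J⁻¹ * G * (Gᵀ * J⁻¹ * G)⁻¹) ((Gᵀ * J⁻¹ * G)⁻¹ * Gᵀ * J⁻¹) (-(Gᵀ * J⁻¹ * G)⁻¹) *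
      Matrix.fromBlocks J G Gᵀ 0 = 1 := by
  have h1 : J⁻¹ * J = 1 := Matrix.nonsing_inv_mul _ hJ
  have h2 : (Gᵀ * J⁻¹ * G)⁻¹ * (Gᵀ * J⁻¹ * G) = 1 := Matrix.nonsing_inv_mul _ hN
  rw [Matrix.fromBlocks_multiply, ← Matrix.fromBlocks_one]
  congr 1
  · rw [Matrix.sub_mul, Matrix.mul_assoc _ J⁻¹ J, h1, Matrix.mul_one]
    abel
  · have : J⁻¹ * G * (Gᵀ * J⁻¹ * G)⁻¹ * Gᵀ * J⁻¹ * G =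
        J⁻¹ * G * ((Gᵀ * J⁻¹ * G)⁻¹ * (Gᵀ * J⁻¹ * G)) := by simp only [Matrix.mul_assoc]
    rw [Matrix.sub_mul, this, h2, Matrix.mul_one, Matrix.mul_zero, add_zero, sub_self]
  · rw [Matrix.mul_assoc _ J⁻¹ J, h1, Matrix.mul_one, Matrix.neg_mul, add_neg_cancel]
  · rw [Matrix.mul_zero, add_zero, ← h2]
    simp only [Matrix.mul_assoc]

theorem mulVec_injective_of_rank_eq {p r : ℕ} {G : Matrix (Fin p) (Fin r) ℝ} (h : G.rank = r) :
    Function.Injective G.mulVec := by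
  have h1 := LinearMap.finrank_range_add_finrank_ker G.mulVecLin
  rw [show Module.finrank ℝ G.mulVecLin.range = r from h, Module.finrank_fin_fun] at h1
  have h2 : G.mulVecLin.ker = ⊥ := Submodule.finrank_eq_zero.1 (by omega)
  exact LinearMap.ker_eq_bot.1 h2

/-- Full column rank makes G injective, so the congruence of the positive definite J⁻¹ by G stays
positive definite. -/
theorem isUnit_det_transpose_mul_inv_mul {p r : ℕ} {J : Matrix (Fin p) (Fin p) ℝ}
    {G : Matrix (Fin p) (Fin r) ℝ} (hJ : J.PosDef) (hG : G.rank = r) :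
    IsUnit (Gᵀ * J⁻¹ * G).det := by
  have h := hJ.inv.conjTranspose_mul_mul_same (mulVec_injective_of_rank_eq hG)
  rw [Matrix.conjTranspose_eq_transpose_of_trivial] at h
  exact (Matrix.isUnit_iff_isUnit_det _).1 h.isUnit

theorem norm_le_mul_norm_ofLp {p : ℕ} (v : Param p) : ‖v‖ ≤ p * ‖v.ofLp‖ := by
  conv_lhs => rw [eq_sum_dir v]
  refine (norm_sum_le _ _).trans ((Finset.sum_le_sum (g := fun _ => ‖v.ofLp‖) fun j _ => ?_).trans
    (by simp))
  rw [norm_smul, dir, PiLp.norm_single, norm_one, mul_one]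
  exact norm_le_pi_norm v.ofLp j

end Perturbation

/-! ### Estimating equations and their linearization. -/

section Estimators

variable {𝒳 : Type*} [MeasurableSpace 𝒳] {μ : Measure 𝒳} {p r : ℕ} {f : Param p → 𝒳 → ℝ}
  {Θ ω : Set (Param p)} {θ₀ : Param p} {β : ℝ} {n : ℕ}

/-- A sample at which the objective function is smooth, with averages of the third derivative
bound and of the Hessian under control. -/
structure GoodSample (μ : Measure 𝒳) (f : Param p → 𝒳 → ℝ) (ω : Set (Param p)) (θ₀ : Param p)
    (β : ℝ) (M : 𝒳 → ℝ) (b δ : ℝ) (X : Fin n → 𝒳) : Prop where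
  nice : ∀ i, Nice (fun t => f t (X i)) ω
  third_le : ∀ i, ∀ θ ∈ ω,
    ‖fderiv ℝ (fderiv ℝ (fderiv ℝ fun t => objTerm μ f β t (X i))) θ‖ ≤ M (X i)
  mean_le : (n : ℝ)⁻¹ * ∑ i, M (X i) ≤ b
  hessian : ∀ j k, |(n : ℝ)⁻¹ * ∑ i,
    fderiv ℝ (fderiv ℝ fun t => objTerm μ f β t (X i)) θ₀ (dir j) (dir k) -
      (1 + β) * matJ μ f β θ₀ j k| ≤ δ

theorem hasFDerivAt_objective (hω : IsOpen ω)
    (h : DiffUnderIntegral μ ω fun θ x => f θ x ^ (1 + β)) {X : Fin n → 𝒳}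
    (hX : ∀ i, Nice (fun t => f t (X i)) ω) {θ : Param p} (hθ : θ ∈ ω) :
    HasFDerivAt (objective μ f β X)
      ((n : ℝ)⁻¹ • ∑ i, fderiv ℝ (fun t => objTerm μ f β t (X i)) θ) θ := by
  have h1 : HasFDerivAt (fun t => ∑ i, objTerm μ f β t (X i))
      (∑ i, fderiv ℝ (fun t => objTerm μ f β t (X i)) θ) θ :=
    HasFDerivAt.fun_sum fun i _ => (d3_objTerm hω h (hX i) θ hθ).1.hasFDerivAt
  have h2 := h1.const_mul (1 / (n : ℝ))
  rw [one_div] at h2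
  have e : objective μ f β X = fun t => (n : ℝ)⁻¹ * ∑ i, objTerm μ f β t (X i) := by
    ext t; simp [objective]
  rw [e]
  exact h2

/-- The Lagrange multiplier rule requires strict differentiability, which follows from continuity of
the gradient at the point. -/
theorem hasStrictFDerivAt_objective (hω : IsOpen ω)
    (h : DiffUnderIntegral μ ω fun θ x => f θ x ^ (1 + β)) {X : Fin n → 𝒳}
    (hX : ∀ i, Nice (fun t => f t (X i)) ω) {θ : Param p} (hθ : θ ∈ ω) :
    HasStrictFDerivAt (objective μ f β X)
      ((n : ℝ)⁻¹ • ∑ i, fderiv ℝ (fun t => objTerm μ f β t (X i)) θ) θ := by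
  refine hasStrictFDerivAt_of_hasFDerivAt_of_continuousAt
    (f' := fun t => (n : ℝ)⁻¹ • ∑ i, fderiv ℝ (fun t => objTerm μ f β t (X i)) t) ?_ ?_
  · filter_upwards [hω.mem_nhds hθ] with t ht using hasFDerivAt_objective hω h hX ht
  · exact (tendsto_finsetSum _ fun i _ =>
      (d3_objTerm hω h (hX i) θ hθ).2.1.continuousAt).const_smul _

/-- The estimating function is a multiple of the gradient of the objective function. -/
theorem estFun_eq (hmodel : IsModel μ f Θ) (hω : IsOpen ω) (hωΘ : ω ⊆ Θ) (hβ : 0 ≤ β)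
    (h : DiffUnderIntegral μ ω fun θ x => f θ x ^ (1 + β))
    (hn : ∀ᵐ x ∂μ, Nice (fun t => f t x) ω) (hn0 : n ≠ 0) {X : Fin n → 𝒳}
    (hX : ∀ i, Nice (fun t => f t (X i)) ω) {θ : Param p} (hθ : θ ∈ ω) (j : Fin p) :
    (n : ℝ)⁻¹ * ∑ i, fderiv ℝ (fun t => objTerm μ f β t (X i)) θ (dir j) =
      -(1 + β) * estFun μ f β X θ j := by
  simp only [fderiv_objTerm_dir hmodel hω hωΘ hβ h hn (hX _) hθ, ← Finset.mul_sum,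
    Finset.sum_sub_distrib, Finset.sum_const, Finset.card_univ, Fintype.card_fin, estFun,
    nsmul_eq_mul]
  have : (n : ℝ) ≠ 0 := Nat.cast_ne_zero.2 hn0
  field_simp

/-- Θ is open, so a local minimizer over Θ is a critical point. Both kinds of estimator thus satisfy
the same equation. -/
theorem estFun_eq_zero_of_isMDPDE (hmodel : IsModel μ f Θ) (hω : IsOpen ω) (hωΘ : ω ⊆ Θ)
    (hβ : 0 ≤ β) (h : DiffUnderIntegral μ ω fun θ x => f θ x ^ (1 + β))
    (hn : ∀ᵐ x ∂μ, Nice (fun t => f t x) ω) (hn0 : n ≠ 0) {X : Fin n → 𝒳}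
    (hX : ∀ i, Nice (fun t => f t (X i)) ω) {θ : Param p} (hθ : θ ∈ ω)
    (hest : IsMDPDE μ f Θ β X θ) : estFun μ f β X θ = 0 := by
  rcases hest.2 with hmin | h0
  · have h1 := (hmin.isLocalMin (hmodel.isOpen.mem_nhds hest.1)).hasFDerivAt_eq_zero
      (hasFDerivAt_objective hω h hX hθ)
    ext j
    have h2 := estFun_eq hmodel hω hωΘ hβ h hn hn0 hX hθ j
    have h3 := DFunLike.congr_fun h1 (dir j)
    rw [smul_apply, sum_apply, smul_eq_mul, h2] at h3
    have : (1 + β) ≠ 0 := by linarith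
    exact (mul_eq_zero.1 h3).resolve_left (neg_ne_zero.2 this)
  · exact h0

theorem clm_dir_eq {g : Param p → EuclideanSpace ℝ (Fin r)} {θ : Param p} (c : Fin r → ℝ)
    (j : Fin p) : ∑ i, c i * fderiv ℝ g θ (dir j) i = (matG g θ *ᵥ c) j := by
  simp only [Matrix.mulVec, dotProduct, matG, Matrix.of_apply]
  exact Finset.sum_congr rfl fun i _ => mul_comm _ _

/-- The Lagrange multiplier rule for the restricted estimator. -/
theorem exists_estFun_eq_of_isRMDPDE (hmodel : IsModel μ f Θ) (hω : IsOpen ω) (hωΘ : ω ⊆ Θ)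
    (hβ : 0 ≤ β) (h : DiffUnderIntegral μ ω fun θ x => f θ x ^ (1 + β))
    (hn : ∀ᵐ x ∂μ, Nice (fun t => f t x) ω) (hn0 : n ≠ 0) {X : Fin n → 𝒳}
    (hX : ∀ i, Nice (fun t => f t (X i)) ω) {g : Param p → EuclideanSpace ℝ (Fin r)}
    (hg : ContDiffOn ℝ 1 g Θ) {θ : Param p} (hθ : θ ∈ ω)
    (hG : (matG g θ).rank = r) (hest : IsRMDPDE μ f Θ g β X θ) :
    ∃ c : Fin r → ℝ, estFun μ f β X θ = matG g θ *ᵥ c := by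
  rcases hest.2 with hmin | h0
  swap
  · exact h0
  have hΘ : Θ ∈ 𝓝 θ := hmodel.isOpen.mem_nhds hest.1.1
  have hgs : HasStrictFDerivAt g (fderiv ℝ g θ) θ :=
    (hg.contDiffAt hΘ).hasStrictFDerivAt (by norm_num)
  have hset : {x | g x = g θ} = {x | g x = 0} := by rw [hest.1.2]
  have hext : IsLocalExtrOn (objective μ f β X) {x | g x = g θ} θ := by
    refine Or.inl ?_
    rw [hset]
    have e : nullSet Θ g = Θ ∩ {x | g x = 0} := rfl
    -- Openness of Θ makes membership in it irrelevant locally, leaving a pure equality constraint.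
    have h1 : 𝓝[nullSet Θ g] θ = 𝓝[{x | g x = 0}] θ := by
      rw [e, Set.inter_comm, nhdsWithin_inter_of_mem' (mem_nhdsWithin_of_mem_nhds hΘ)]
    have h2 := hmin
    rw [IsLocalMinOn, h1] at h2
    exact h2
  obtain ⟨Λ, Λ₀, hne, heq⟩ := hext.exists_linear_map_of_hasStrictFDerivAt hgs
    (hasStrictFDerivAt_objective hω h hX hθ)
  -- coordinates of the multiplier
  set e : Fin r → ℝ := fun i => Λ (EuclideanSpace.single i 1) with he
  have hΛ : ∀ v, Λ v = ∑ i, e i * v i := by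
    intro v
    conv_lhs => rw [show v = ∑ i, v i • EuclideanSpace.single i (1 : ℝ) from by
      ext i; simp [Finset.sum_apply, Pi.single_apply]]
    simp [he, mul_comm]
  have hdir : ∀ j, (matG g θ *ᵥ e) j = Λ₀ * (1 + β) * estFun μ f β X θ j := by
    intro j
    have h1 := heq (dir j)
    rw [hΛ, clm_dir_eq, smul_apply, sum_apply, smul_eq_mul, smul_eq_mul,
      estFun_eq hmodel hω hωΘ hβ h hn hn0 hX hθ j] at h1
    linarith
  have hβ1 : 1 + β ≠ 0 := by linarith
  -- The abnormal case would give G e = 0, hence e = 0 by the rank condition, contradicting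
  -- nontriviality of the multiplier pair.
  have hΛ₀ : Λ₀ ≠ 0 := by
    rintro rfl
    apply hne
    have h1 : matG g θ *ᵥ e = matG g θ *ᵥ 0 := by
      ext j; rw [hdir]; simp
    have h2 := mulVec_injective_of_rank_eq hG h1
    refine Prod.ext ?_ rfl
    ext v
    rw [hΛ, h2]
    simp
  refine ⟨(Λ₀ * (1 + β))⁻¹ • e, ?_⟩
  rw [Matrix.mulVec_smul]
  ext j
  rw [Pi.smul_apply, hdir, smul_eq_mul]
  field_simp

/-- Linearization of the estimating function at `θ₀`. -/
theorem GoodSample.norm_estFun_sub_le (hmodel : IsModel μ f Θ) (hω : IsOpen ω) (hωΘ : ω ⊆ Θ)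
    (hβ : 0 ≤ β) (h : DiffUnderIntegral μ ω fun θ x => f θ x ^ (1 + β))
    (hn : ∀ᵐ x ∂μ, Nice (fun t => f t x) ω) (hn0 : n ≠ 0) {X : Fin n → 𝒳} {M : 𝒳 → ℝ} {b δ : ℝ}
    (hX : GoodSample μ f ω θ₀ β M b δ X) {U : Set (Param p)} (hU : Convex ℝ U) (hUω : U ⊆ ω)
    (hθ₀ : θ₀ ∈ U) {θ : Param p} (hθ : θ ∈ U) :
    ‖estFun μ f β X θ₀ - matJ μ f β θ₀ *ᵥ (θ - θ₀).ofLp - estFun μ f β X θ‖ ≤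
      p * (p * δ + b * ‖θ - θ₀‖) * ‖(θ - θ₀).ofLp‖ := by
  set y := θ - θ₀ with hy
  have hnpos : (0 : ℝ) ≤ (n : ℝ)⁻¹ := by positivity
  have hb0 : 0 ≤ b := le_trans (mul_nonneg hnpos (Finset.sum_nonneg fun i _ =>
    (norm_nonneg _).trans (hX.third_le i θ₀ (hUω hθ₀)))) hX.mean_le
  -- Nonnegativity of δ is read off from an entry of the Hessian condition, so dimension zero is
  -- treated apart.
  by_cases hp : IsEmpty (Fin p)
  · rw [Subsingleton.elim (estFun μ f β X θ₀ - matJ μ f β θ₀ *ᵥ y.ofLp - estFun μ f β X θ) 0,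
      Subsingleton.elim y.ofLp 0]
    simp
  have hp1 : (1 : ℝ) ≤ p := by
    rcases p with _ | p
    · exact absurd (inferInstanceAs (IsEmpty (Fin 0))) hp
    · simp
  have j0 : Fin p := (not_isEmpty_iff.1 hp).some
  have hδ : 0 ≤ δ := (abs_nonneg _).trans (hX.hessian j0 j0)
  have hsymm : ∀ j k, matJ μ f β θ₀ j k = matJ μ f β θ₀ k j := fun j k => by
    simp only [matJ, Matrix.of_apply, mul_comm (score f θ₀ _ j)]
  have key : ∀ j, |estFun μ f β X θ₀ j - (matJ μ f β θ₀ *ᵥ y.ofLp) j - estFun μ f β X θ j| ≤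
      (p * δ + b * ‖y‖) * ‖y‖ := by
    intro j
    set H : Fin p → Fin p → ℝ := fun j k => (n : ℝ)⁻¹ * ∑ i,
      fderiv ℝ (fderiv ℝ fun t => objTerm μ f β t (X i)) θ₀ (dir j) (dir k) with hH
    have h1 : |(n : ℝ)⁻¹ * ∑ i, fderiv ℝ (fun t => objTerm μ f β t (X i)) θ (dir j) -
        (n : ℝ)⁻¹ * ∑ i, fderiv ℝ (fun t => objTerm μ f β t (X i)) θ₀ (dir j) -
        ∑ k, y k * H k j| ≤ b * ‖y‖ ^ 2 := by
      have e : ∑ k, y k * H k j = (n : ℝ)⁻¹ * ∑ i,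
          fderiv ℝ (fderiv ℝ fun t => objTerm μ f β t (X i)) θ₀ y (dir j) := by
        have : ∀ i, fderiv ℝ (fderiv ℝ fun t => objTerm μ f β t (X i)) θ₀ y (dir j) =
            ∑ k, y k * fderiv ℝ (fderiv ℝ fun t => objTerm μ f β t (X i)) θ₀ (dir k) (dir j) := by
          intro i
          rw [clm_apply_eq_sum (fderiv ℝ (fderiv ℝ fun t => objTerm μ f β t (X i)) θ₀) y, sum_apply]
          rfl
        simp only [this, hH]
        rw [Finset.sum_comm, Finset.mul_sum]
        refine Finset.sum_congr rfl fun k _ => ?_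
        rw [← Finset.mul_sum]; ring
      rw [e, ← mul_sub, ← mul_sub, ← Finset.sum_sub_distrib, ← Finset.sum_sub_distrib, abs_mul,
        abs_of_nonneg hnpos]
      calc _ ≤ (n : ℝ)⁻¹ * ∑ i, M (X i) * ‖y‖ ^ 2 := by
            gcongr
            refine (Finset.abs_sum_le_sum_abs _ _).trans (Finset.sum_le_sum fun i _ => ?_)
            have h2 := norm_fderiv_sub_le hU
              (fun t ht => d3_objTerm hω h (hX.nice i) t (hUω ht))
              (fun t ht => hX.third_le i t (hUω ht)) hθ₀ hθ
            have h3 := ((fderiv ℝ (fun t => objTerm μ f β t (X i)) θ -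
              fderiv ℝ (fun t => objTerm μ f β t (X i)) θ₀ -
              fderiv ℝ (fderiv ℝ fun t => objTerm μ f β t (X i)) θ₀ (θ - θ₀)).le_opNorm
                (dir j)).trans (mul_le_mul_of_nonneg_right h2 (norm_nonneg _))
            rw [dir, PiLp.norm_single, norm_one, mul_one] at h3
            exact h3
        _ = (n : ℝ)⁻¹ * (∑ i, M (X i)) * ‖y‖ ^ 2 := by rw [← Finset.sum_mul]; ring
        _ ≤ _ := mul_le_mul_of_nonneg_right hX.mean_le (sq_nonneg _)
    rw [estFun_eq hmodel hω hωΘ hβ h hn hn0 hX.nice (hUω hθ) j,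
      estFun_eq hmodel hω hωΘ hβ h hn hn0 hX.nice (hUω hθ₀) j] at h1
    have h4 : |∑ k, y k * H k j - (1 + β) * (matJ μ f β θ₀ *ᵥ y.ofLp) j| ≤ p * δ * ‖y‖ := by
      have e : (1 + β) * (matJ μ f β θ₀ *ᵥ y.ofLp) j =
          ∑ k, y k * ((1 + β) * matJ μ f β θ₀ k j) := by
        simp only [Matrix.mulVec, dotProduct, Finset.mul_sum]
        refine Finset.sum_congr rfl fun k _ => ?_
        rw [hsymm j k]; ring
      rw [e, ← Finset.sum_sub_distrib]
      refine (Finset.abs_sum_le_sum_abs _ _).trans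
        ((Finset.sum_le_sum (g := fun _ => δ * ‖y‖) fun k _ => ?_).trans (by simp [mul_assoc]))
      rw [← mul_sub, abs_mul, mul_comm]
      exact mul_le_mul (hX.hessian k j) (PiLp.norm_apply_le y k) (abs_nonneg _) hδ
    set u := estFun μ f β X θ₀ j - (matJ μ f β θ₀ *ᵥ y.ofLp) j - estFun μ f β X θ j with hu
    -- The gradient is -(1+β) times the estimating function; as 1+β ≥ 1, the factor can afterwards
    -- be dropped.
    have h5 : |(1 + β) * u| ≤ (p * δ + b * ‖y‖) * ‖y‖ := by
      rw [abs_le] at h1 h4 ⊢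
      rw [hu]
      constructor <;> nlinarith [h1.1, h1.2, h4.1, h4.2]
    rw [abs_mul, abs_of_nonneg (by linarith : (0 : ℝ) ≤ 1 + β)] at h5
    nlinarith [abs_nonneg u]
  refine (pi_norm_le_iff_of_nonneg (by positivity)).2 fun j => ?_
  refine (key j).trans ?_
  calc (p * δ + b * ‖y‖) * ‖y‖ ≤ (p * δ + b * ‖y‖) * (p * ‖y.ofLp‖) := by
        gcongr
        exact norm_le_mul_norm_ofLp y
    _ = _ := by ring

end Estimators

/-! ### Perturbation of quadratic forms. -/

section Perturbation

theorem norm_mulVec_le_of_abs_le {m n : ℕ} {M : Matrix (Fin m) (Fin n) ℝ} {e : ℝ} (he : 0 ≤ e)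
    (hM : ∀ i j, |M i j| ≤ e) (v : Fin n → ℝ) : ‖M *ᵥ v‖ ≤ n * e * ‖v‖ := by
  refine (pi_norm_le_iff_of_nonneg (by positivity)).2 fun i => ?_
  simp only [Matrix.mulVec, dotProduct]
  refine (norm_sum_le _ _).trans
    ((Finset.sum_le_sum (g := fun _ => e * ‖v‖) fun j _ => ?_).trans (by simp [mul_assoc]))
  rw [norm_mul]
  exact mul_le_mul (hM i j) (norm_le_pi_norm v j) (norm_nonneg _) he

theorem exists_abs_entry_le {m n : ℕ} (M : Matrix (Fin m) (Fin n) ℝ) :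
    ∃ e : ℝ, 0 ≤ e ∧ ∀ i j, |M i j| ≤ e := by
  refine ⟨∑ i, ∑ j, |M i j|, by positivity, fun i j => ?_⟩
  exact (Finset.single_le_sum (f := fun j => |M i j|) (fun _ _ => abs_nonneg _)
    (Finset.mem_univ j)).trans (Finset.single_le_sum (f := fun i => ∑ j, |M i j|)
      (fun _ _ => Finset.sum_nonneg fun _ _ => abs_nonneg _) (Finset.mem_univ i))

/-- A quadratic form at approximately `B z` is approximately its value at `B z`. -/
theorem exists_abs_quadraticForm_sub_le {p : ℕ} (A B : Matrix (Fin p) (Fin p) ℝ) :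
    ∃ D > 0, ∀ e : ℝ, 0 ≤ e → e ≤ 1 → ∀ v z : Fin p → ℝ, ‖v - B *ᵥ z‖ ≤ e * ‖z‖ →
      |v ⬝ᵥ A *ᵥ v - (B *ᵥ z) ⬝ᵥ A *ᵥ (B *ᵥ z)| ≤ D * e * ‖z‖ ^ 2 ∧ ‖v‖ ^ 2 ≤ D * ‖z‖ ^ 2 := by
  obtain ⟨a, ha0, ha⟩ := exists_abs_entry_le A
  obtain ⟨b, hb0, hb⟩ := exists_abs_entry_le B
  set c := (p : ℝ) * b with hc
  have hc0 : 0 ≤ c := by positivity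
  -- The first summand serves the difference of the forms, the second the bound on ‖v‖².
  refine ⟨p * p * a * (2 * c + 1) + (c + 1) ^ 2, by positivity, fun e he he1 v z h => ?_⟩
  have h1 : ‖B *ᵥ z‖ ≤ c * ‖z‖ := norm_mulVec_le_of_abs_le hb0 hb z
  have h2 : ‖v‖ ≤ (c + 1) * ‖z‖ := by
    have h3 : ‖v‖ ≤ ‖v - B *ᵥ z‖ + ‖B *ᵥ z‖ := by simpa using norm_add_le (v - B *ᵥ z) (B *ᵥ z)
    nlinarith [norm_nonneg z]
  constructor
  · have e1 : v ⬝ᵥ A *ᵥ v - (B *ᵥ z) ⬝ᵥ A *ᵥ (B *ᵥ z) =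
        (v - B *ᵥ z) ⬝ᵥ A *ᵥ v + (B *ᵥ z) ⬝ᵥ A *ᵥ (v - B *ᵥ z) := by
      rw [Matrix.mulVec_sub, sub_dotProduct, dotProduct_sub]; ring
    have h4 := abs_dotProduct_mulVec_le A (v - B *ᵥ z) v
      (b := ‖v - B *ᵥ z‖) (c := ‖v‖) ha (fun i => norm_le_pi_norm (v - B *ᵥ z) i)
      (fun i => norm_le_pi_norm v i) (norm_nonneg _) ha0
    have h5 := abs_dotProduct_mulVec_le A (B *ᵥ z) (v - B *ᵥ z)
      (b := ‖B *ᵥ z‖) (c := ‖v - B *ᵥ z‖) ha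
      (fun i => norm_le_pi_norm (B *ᵥ z) i) (fun i => norm_le_pi_norm (v - B *ᵥ z) i) (norm_nonneg _) ha0
    rw [Fintype.card_fin] at h4 h5
    rw [e1]
    refine (abs_add_le _ _).trans ((add_le_add h4 h5).trans ?_)
    calc (p : ℝ) * p * (‖v - B *ᵥ z‖ * a * ‖v‖) + p * p * (‖B *ᵥ z‖ * a * ‖v - B *ᵥ z‖) ≤
        p * p * ((e * ‖z‖) * a * ((c + 1) * ‖z‖)) + p * p * ((c * ‖z‖) * a * (e * ‖z‖)) := by
          gcongr
      _ = p * p * a * (2 * c + 1) * e * ‖z‖ ^ 2 := by ring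
      _ ≤ _ := by
        gcongr
        linarith [sq_nonneg (c + 1)]
  · calc ‖v‖ ^ 2 ≤ ((c + 1) * ‖z‖) ^ 2 := by gcongr
      _ = (c + 1) ^ 2 * ‖z‖ ^ 2 := by ring
      _ ≤ _ := by
        gcongr
        have : 0 ≤ (p : ℝ) * p * a * (2 * c + 1) := by positivity
        linarith

end Perturbation

/-! ### The divergence between the two estimates at a good sample. -/

section Estimators

variable {𝒳 : Type*} [MeasurableSpace 𝒳] {μ : Measure 𝒳} {p r : ℕ} {f : Param p → 𝒳 → ℝ}
  {Θ ω : Set (Param p)} {θ₀ : Param p} {β γ : ℝ}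

theorem sumElim_norm_le {m n : ℕ} (y : Fin m → ℝ) (c : Fin n → ℝ) {b : ℝ} (hb : 0 ≤ b)
    (hy : ‖y‖ ≤ b) (hc : ‖c‖ ≤ b) : ‖Sum.elim y c‖ ≤ b :=
  (pi_norm_le_iff_of_nonneg hb).2 fun i => i.rec
    (fun i => (norm_le_pi_norm y i).trans hy) fun i => (norm_le_pi_norm c i).trans hc

theorem norm_le_norm_sumElim_left {m n : ℕ} (y : Fin m → ℝ) (c : Fin n → ℝ) :
    ‖y‖ ≤ ‖Sum.elim y c‖ :=
  (pi_norm_le_iff_of_nonneg (norm_nonneg _)).2 fun i => norm_le_pi_norm (Sum.elim y c) (Sum.inl i)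

theorem norm_le_norm_sumElim_right {m n : ℕ} (y : Fin m → ℝ) (c : Fin n → ℝ) :
    ‖c‖ ≤ ‖Sum.elim y c‖ :=
  (pi_norm_le_iff_of_nonneg (norm_nonneg _)).2 fun i => norm_le_pi_norm (Sum.elim y c) (Sum.inr i)

theorem transpose_matG_mulVec (g : Param p → EuclideanSpace ℝ (Fin r)) (θ v : Param p)
    (i : Fin r) : ((matG g θ)ᵀ *ᵥ v.ofLp) i = fderiv ℝ g θ v i := by
  rw [clm_apply_eq_sum]
  simp [Matrix.mulVec, dotProduct, matG, mul_comm]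

/-- Regularity of the constraint near `θ₀`. -/
theorem eventually_constraint (hmodel : IsModel μ f Θ) {g : Param p → EuclideanSpace ℝ (Fin r)}
    (hg : ContDiffOn ℝ 1 g Θ) (hθ₀ : θ₀ ∈ nullSet Θ g) {ε : ℝ} (hε : 0 < ε) :
    ∀ᶠ t in 𝓝 θ₀, (∀ j i, |(matG g t - matG g θ₀) j i| ≤ ε) ∧
      (g t = 0 → ‖(matG g θ₀)ᵀ *ᵥ (t - θ₀).ofLp‖ ≤ ε * ‖t - θ₀‖) := by
  have hgc : ContDiffAt ℝ 1 g θ₀ := hg.contDiffAt (hmodel.isOpen.mem_nhds hθ₀.1)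
  refine Filter.Eventually.and ?_ ?_
  · have hc : ContinuousAt (fderiv ℝ g) θ₀ :=
      (hgc.fderiv_right (m := 0) (by norm_num)).continuousAt
    refine eventually_all.2 fun j => eventually_all.2 fun i => ?_
    have h1 : ContinuousAt (fun t => fderiv ℝ g t (dir j) i) θ₀ := by
      have h2 : ContinuousAt (fun t => fderiv ℝ g t (dir j)) θ₀ := hc.clm_apply continuousAt_const
      exact ((EuclideanSpace.proj (𝕜 := ℝ) i).continuous.continuousAt).comp h2
    filter_upwards [Metric.tendsto_nhds.1 h1 ε hε] with t ht
    exact (Real.dist_eq _ _ ▸ ht).le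
  -- If g vanishes at t as well as at θ₀, the first order remainder is exactly minus the linear
  -- term, so Gᵀ(t - θ₀) is itself small.
  · have h1 := (hgc.differentiableAt (by norm_num)).hasFDerivAt.isLittleO.bound hε
    filter_upwards [h1] with t ht hgt
    rw [hgt, hθ₀.2, sub_zero, zero_sub, norm_neg] at ht
    refine le_trans ?_ ht
    refine (pi_norm_le_iff_of_nonneg (norm_nonneg _)).2 fun i => ?_
    rw [transpose_matG_mulVec]
    exact PiLp.norm_apply_le _ i

/-- At a good sample, the divergence between the two estimates is approximately a quadratic form
in the estimating function at `θ₀`. -/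
theorem exists_abs_divergence_estimates_sub_le (hmodel : IsModel μ f Θ) (hω : IsOpen ω)
    (hωΘ : ω ⊆ Θ) (hβ : 0 ≤ β) (hγ : 0 ≤ γ) (hBβ : BasuConditions μ f ω {θ₀} θ₀ β)
    (hBγ : BasuConditions μ f ω ω θ₀ γ) {g : Param p → EuclideanSpace ℝ (Fin r)}
    (hg : ContDiffOn ℝ 1 g Θ) (hG : ∀ θ ∈ Θ, (matG g θ).rank = r) (hθ₀ : θ₀ ∈ nullSet Θ g)
    (hθω : θ₀ ∈ ω) (M : 𝒳 → ℝ) (b : ℝ) {δ : ℝ} (hδ : 0 < δ) :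
    ∃ e > 0, ∃ ρ > 0, ∀ n : ℕ, n ≠ 0 → ∀ X : Fin n → 𝒳, GoodSample μ f ω θ₀ β M b e X →
      ∀ s ∈ Metric.ball θ₀ ρ, ∀ t ∈ Metric.ball θ₀ ρ, IsMDPDE μ f Θ β X s →
        IsRMDPDE μ f Θ g β X t →
      |2 * divergence μ γ (f s) (f t) - (matB μ f g β θ₀ *ᵥ estFun μ f β X θ₀) ⬝ᵥ
        matA μ f γ θ₀ *ᵥ (matB μ f g β θ₀ *ᵥ estFun μ f β X θ₀)| ≤
        δ * ‖estFun μ f β X θ₀‖ ^ 2 := by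
  set J := matJ μ f β θ₀ with hJ
  set G := matG g θ₀ with hGdef
  set B := matB μ f g β θ₀ with hB
  set A := matA μ f γ θ₀ with hA
  have hJpos : J.PosDef := hBβ.J_posDef θ₀ rfl
  have hJdet : IsUnit J.det := (Matrix.isUnit_iff_isUnit_det _).1 hJpos.isUnit
  have hNdet : IsUnit (Gᵀ * J⁻¹ * G).det :=
    isUnit_det_transpose_mul_inv_mul hJpos (hG θ₀ hθ₀.1)
  have hself := hBβ.diff_self
  have hn := hmodel.ae_nice hωΘ hBβ.smooth
  obtain ⟨C₁, hC₁, H₁⟩ := exists_norm_sub_mulVec_le (Matrix.nonsing_inv_mul J hJdet)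
  obtain ⟨C₂, hC₂, H₂⟩ := exists_norm_sub_mulVec_le (fromBlocks_mul_fromBlocks_eq_one hJdet hNdet)
  obtain ⟨D, hD, HD⟩ := exists_abs_quadraticForm_sub_le A B
  -- the tolerance for the linear systems
  set ε := min (1 / (C₁ + C₂)) (δ / (2 * D * (C₁ + C₂))) with hε
  have hε0 : 0 < ε := by positivity
  have hε1 : (C₁ + C₂) * ε ≤ 1 := by
    have := min_le_left (1 / (C₁ + C₂)) (δ / (2 * D * (C₁ + C₂)))
    calc (C₁ + C₂) * ε ≤ (C₁ + C₂) * (1 / (C₁ + C₂)) := by gcongr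
      _ = 1 := by field_simp
  have hε2 : D * ((C₁ + C₂) * ε) ≤ δ / 2 := by
    have := min_le_right (1 / (C₁ + C₂)) (δ / (2 * D * (C₁ + C₂)))
    calc D * ((C₁ + C₂) * ε) ≤ D * ((C₁ + C₂) * (δ / (2 * D * (C₁ + C₂)))) := by gcongr
      _ = δ / 2 := by field_simp
  -- A common bound, at least 1, for the dimension factors that arise in comparing norms.
  set q : ℝ := p + r + 1 with hq
  have hp0 : (0 : ℝ) ≤ p := Nat.cast_nonneg p
  have hr0 : (0 : ℝ) ≤ r := Nat.cast_nonneg r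
  have hq1 : 1 ≤ q := by rw [hq]; linarith
  obtain ⟨ρ₁, hρ₁, Hd⟩ := exists_ball_abs_divergence_sub_le hmodel hω hωΘ hγ hBγ hθω
    (ε := δ / (2 * D * q ^ 2)) (by positivity)
  obtain ⟨ρ₂, hρ₂, Hc⟩ := Metric.eventually_nhds_iff_ball.1
    (eventually_constraint hmodel hg hθ₀ (ε := ε / (2 * q)) (by positivity))
  obtain ⟨ρ₃, hρ₃, Hω⟩ := Metric.isOpen_iff.1 hω θ₀ hθω
  -- The Hessian tolerance and the last radius each contribute ε/4 to the linearization error p(p e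
  -- + b‖θ - θ₀‖), so `lin` holds with ε/2.
  refine ⟨ε / (4 * q ^ 2), by positivity,
    min (min ρ₁ ρ₂) (min ρ₃ (ε / (4 * q * (|b| + 1)))), by positivity, ?_⟩
  intro n hn0 X hX s hs t ht hsE htE
  simp only [Metric.mem_ball, lt_min_iff] at hs ht
  set z := estFun μ f β X θ₀ with hz
  have lin : ∀ θ, dist θ θ₀ < ρ₃ → dist θ θ₀ < ε / (4 * q * (|b| + 1)) →
      ‖z - J *ᵥ (θ - θ₀).ofLp - estFun μ f β X θ‖ ≤ ε / 2 * ‖(θ - θ₀).ofLp‖ := by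
    intro θ hθ₃ hθb
    refine (hX.norm_estFun_sub_le hmodel hω hωΘ hβ hself hn hn0 (convex_ball θ₀ ρ₃) Hω
      (Metric.mem_ball_self hρ₃) hθ₃).trans ?_
    gcongr
    rw [dist_eq_norm] at hθb
    have hpq : (p : ℝ) ≤ q := by rw [hq]; linarith
    calc (p : ℝ) * (p * (ε / (4 * q ^ 2)) + b * ‖θ - θ₀‖) ≤
        q * (q * (ε / (4 * q ^ 2)) + (|b| + 1) * (ε / (4 * q * (|b| + 1)))) := by
          have : b ≤ |b| + 1 := by linarith [le_abs_self b]
          have h0 : (0 : ℝ) ≤ p * (ε / (4 * q ^ 2)) := by positivity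
          have h1 : b * ‖θ - θ₀‖ ≤ (|b| + 1) * (ε / (4 * q * (|b| + 1))) :=
            mul_le_mul this hθb.le (norm_nonneg _) (by positivity)
          have h2 : (p : ℝ) * (ε / (4 * q ^ 2)) ≤ q * (ε / (4 * q ^ 2)) := by gcongr
          have h3 : 0 ≤ q * (ε / (4 * q ^ 2)) + (|b| + 1) * (ε / (4 * q * (|b| + 1))) := by
            positivity
          exact (mul_le_mul_of_nonneg_left (add_le_add h2 h1) hp0).trans
            (mul_le_mul_of_nonneg_right hpq h3)
      _ = ε / 2 := by
        have : |b| + 1 ≠ 0 := by positivity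
        field_simp
        ring
  -- the unrestricted estimate
  have hs0 := estFun_eq_zero_of_isMDPDE hmodel hω hωΘ hβ hself hn hn0 hX.nice
    (Hω hs.2.1) hsE
  have hs1 : ‖(s - θ₀).ofLp - J⁻¹ *ᵥ z‖ ≤ C₁ * ε * ‖z‖ := by
    refine (H₁ ε hε0.le (by nlinarith) _ z ?_).1
    have := lin s hs.2.1 hs.2.2
    rw [hs0, sub_zero] at this
    exact this.trans (by gcongr; linarith)
  -- the restricted estimate
  obtain ⟨c, hc⟩ := exists_estFun_eq_of_isRMDPDE hmodel hω hωΘ hβ hself hn hn0 hX.nice hg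
    (Hω ht.2.1) (hG t htE.1.1) htE
  have ht1 : ‖(t - θ₀).ofLp - (J⁻¹ - B) *ᵥ z‖ ≤ C₂ * ε * ‖z‖ := by
    set y := (t - θ₀).ofLp with hy
    -- Nothing is known in advance about the size of the multiplier c. Treating it as part of the
    -- unknown lets the error (G(t) - G)c be absorbed by the perturbation lemma.
    have h0 := (H₂ ε hε0.le (by nlinarith) (Sum.elim y c) (Sum.elim z 0) ?_).1
    · rw [Matrix.fromBlocks_mulVec] at h0
      have h1 := norm_le_pi_norm (Sum.elim y c - Sum.elim ((J⁻¹ - B) *ᵥ z +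
        (J⁻¹ * G * (Gᵀ * J⁻¹ * G)⁻¹) *ᵥ 0) (((Gᵀ * J⁻¹ * G)⁻¹ * Gᵀ * J⁻¹) *ᵥ z +
          (-(Gᵀ * J⁻¹ * G)⁻¹) *ᵥ 0))
      have h2 : ‖Sum.elim z (0 : Fin r → ℝ)‖ ≤ ‖z‖ :=
        sumElim_norm_le z 0 (norm_nonneg _) le_rfl (by simp)
      refine (pi_norm_le_iff_of_nonneg (by positivity)).2 fun i => ?_
      refine le_trans ?_ ((h1 (Sum.inl i)).trans (h0.trans (by gcongr)))
      simp
    · rw [Matrix.fromBlocks_mulVec]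
      obtain ⟨hc1, hc2⟩ := Hc t ht.1.2
      have hyc := norm_le_norm_sumElim_left y c
      have hcc := norm_le_norm_sumElim_right y c
      have e : Sum.elim z 0 - Sum.elim (J *ᵥ (Sum.elim y c ∘ Sum.inl) + G *ᵥ (Sum.elim y c ∘ Sum.inr))
          (Gᵀ *ᵥ (Sum.elim y c ∘ Sum.inl) + (0 : Matrix (Fin r) (Fin r) ℝ) *ᵥ
            (Sum.elim y c ∘ Sum.inr)) =
          Sum.elim ((z - J *ᵥ y - estFun μ f β X t) + (matG g t - G) *ᵥ c) (-(Gᵀ *ᵥ y)) := by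
        rw [hc, Matrix.sub_mulVec]
        ext i
        rcases i with i | i
        · simp; ring
        · simp
      rw [e]
      refine sumElim_norm_le _ _ (by positivity) ?_ ?_
      · refine (norm_add_le _ _).trans ((add_le_add (lin t ht.2.1 ht.2.2)
          (norm_mulVec_le_of_abs_le (by positivity) hc1 c)).trans ?_)
        have h3 : (r : ℝ) * (ε / (2 * q)) ≤ ε / 2 := by
          rw [mul_div_assoc', div_le_div_iff₀ (by positivity) (by norm_num)]
          have : (r : ℝ) ≤ q := by rw [hq]; linarith
          nlinarith
        calc ε / 2 * ‖y‖ + r * (ε / (2 * q)) * ‖c‖ ≤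
            ε / 2 * ‖Sum.elim y c‖ + ε / 2 * ‖Sum.elim y c‖ := by gcongr
          _ = _ := by ring
      · rw [norm_neg]
        refine (hc2 htE.1.2).trans ?_
        have h3 : ε / (2 * q) * p ≤ ε := by
          rw [div_mul_eq_mul_div, div_le_iff₀ (by positivity)]
          have : (p : ℝ) ≤ q := by rw [hq]; linarith
          nlinarith
        calc ε / (2 * q) * ‖t - θ₀‖ ≤ ε / (2 * q) * (p * ‖y‖) := by
              gcongr; exact norm_le_mul_norm_ofLp _
          _ = ε / (2 * q) * p * ‖y‖ := by ring
          _ ≤ ε * ‖Sum.elim y c‖ := by gcongr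
  -- the difference of the estimates
  have hst : ‖(s - t).ofLp - B *ᵥ z‖ ≤ (C₁ + C₂) * ε * ‖z‖ := by
    have e : (s - t).ofLp - B *ᵥ z = ((s - θ₀).ofLp - J⁻¹ *ᵥ z) -
        ((t - θ₀).ofLp - (J⁻¹ - B) *ᵥ z) := by
      rw [Matrix.sub_mulVec]
      ext i
      simp only [Pi.sub_apply, PiLp.sub_apply]
      ring
    rw [e]
    refine (norm_sub_le _ _).trans ((add_le_add hs1 ht1).trans (le_of_eq ?_))
    ring
  obtain ⟨hq1', hq2'⟩ := HD ((C₁ + C₂) * ε) (by positivity) hε1 _ z hst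
  have hd := Hd s hs.1.1 t ht.1.1
  have h5 : δ / (2 * D * q ^ 2) * ‖s - t‖ ^ 2 ≤ δ / 2 * ‖z‖ ^ 2 := by
    calc δ / (2 * D * q ^ 2) * ‖s - t‖ ^ 2 ≤ δ / (2 * D * q ^ 2) * (q * ‖(s - t).ofLp‖) ^ 2 := by
          gcongr
          refine (norm_le_mul_norm_ofLp _).trans ?_
          gcongr
          rw [hq]; linarith
      _ = δ / (2 * D) * ‖(s - t).ofLp‖ ^ 2 := by field_simp
      _ ≤ δ / (2 * D) * (D * ‖z‖ ^ 2) := by gcongr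
      _ = _ := by field_simp
  have h6 : D * ((C₁ + C₂) * ε) * ‖z‖ ^ 2 ≤ δ / 2 * ‖z‖ ^ 2 := by gcongr
  have h7 : δ * ‖z‖ ^ 2 = δ / 2 * ‖z‖ ^ 2 + δ / 2 * ‖z‖ ^ 2 := by ring
  have hd' := hd.trans h5
  have hq' := hq1'.trans h6
  rw [h7]
  rw [abs_le] at hd' hq' ⊢
  constructor <;> linarith [hd'.1, hd'.2, hq'.1, hq'.2]

end Estimators

/-! ### Moments of the estimating function and the directional score. -/

section ObservationVector

variable {𝒳 : Type*} [MeasurableSpace 𝒳] {μ : Measure 𝒳} {p : ℕ} {f : Param p → 𝒳 → ℝ}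
  {Θ ω : Set (Param p)} {θ₀ : Param p} {β : ℝ}

/-- The contribution of one observation to the estimating function at `θ₀`, together with the
directional score in the direction `d`. -/
def obsVec (μ : Measure 𝒳) (f : Param p → 𝒳 → ℝ) (β : ℝ) (θ₀ d : Param p) :
    Option (Fin p) → 𝒳 → ℝ
  | some j => fun x => score f θ₀ x j * f θ₀ x ^ β - vecXi μ f β θ₀ j
  | none => fun x => ∑ j, d j * score f θ₀ x j

theorem IsModel.mul_rpow (hmodel : IsModel μ f Θ) (hβ : 0 ≤ β) {θ : Param p} (hθ : θ ∈ Θ)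
    (x : 𝒳) : f θ x ^ (1 + β) = f θ x * f θ x ^ β := by
  rcases (hmodel.nonneg θ hθ x).lt_or_eq with hp | h0
  · rw [Real.rpow_add hp, Real.rpow_one]
  · rw [← h0, Real.zero_rpow (by linarith), zero_mul]

theorem IsModel.mul_rpow_sq (hmodel : IsModel μ f Θ) (hβ : 0 ≤ β) {θ : Param p} (hθ : θ ∈ Θ)
    (x : 𝒳) : f θ x ^ (1 + 2 * β) = f θ x * (f θ x ^ β * f θ x ^ β) := by
  rcases (hmodel.nonneg θ hθ x).lt_or_eq with hp | h0
  · rw [Real.rpow_add hp, Real.rpow_one, two_mul, Real.rpow_add hp]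
  · rw [← h0, Real.zero_rpow (by linarith), zero_mul]

theorem memLp_score (hL : LehmannConditions μ f ω θ₀) (j : Fin p) :
    MemLp (fun x => score f θ₀ x j) 2 (law μ f θ₀) := by
  refine (memLp_two_iff_integrable_sq (hL.score_mean j).1.aestronglyMeasurable).2 ?_
  simpa only [sq] using hL.info_integrable j j

theorem memLp_score_mul_rpow (hmodel : IsModel μ f Θ) (hω : IsOpen ω) (hωΘ : ω ⊆ Θ) (hθω : θ₀ ∈ ω)
    (hβ : 0 ≤ β) (hBβ : BasuConditions μ f ω {θ₀} θ₀ β)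
    (hK : ∀ j k, Integrable (fun x =>
      score f θ₀ x j * score f θ₀ x k * f θ₀ x ^ (1 + 2 * β)) μ) (j : Fin p) :
    MemLp (fun x => score f θ₀ x j * f θ₀ x ^ β) 2 (law μ f θ₀) := by
  have hprob := hmodel.isProbabilityMeasure_law (hωΘ hθω)
  have h1 := (integral_gradient_objTerm hmodel hω hωΘ hβ hBβ.diff_self
    (hmodel.ae_nice hωΘ hBβ.smooth) hθω j).1
  -- Measurability of this product is recovered from the integrability of its centred version.
  have h2 : AEStronglyMeasurable (fun x => score f θ₀ x j * f θ₀ x ^ β) (law μ f θ₀) := by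
    have := (h1.add (integrable_const (vecXi μ f β θ₀ j))).aestronglyMeasurable
    refine this.congr (ae_of_all _ fun x => ?_)
    simp
  refine (memLp_two_iff_integrable_sq h2).2 ((hmodel.integrable_law_iff (hωΘ hθω)).2 ?_)
  refine (hK j j).congr (ae_of_all _ fun x => ?_)
  simp only [hmodel.mul_rpow_sq hβ (hωΘ hθω) x]
  ring

theorem integral_score_mul_rpow (hmodel : IsModel μ f Θ) (hωΘ : ω ⊆ Θ) (hθω : θ₀ ∈ ω)
    (hβ : 0 ≤ β) (j : Fin p) :
    ∫ x, score f θ₀ x j * f θ₀ x ^ β ∂(law μ f θ₀) = vecXi μ f β θ₀ j := by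
  rw [hmodel.integral_law (hωΘ hθω), vecXi]
  refine integral_congr_ae (ae_of_all _ fun x => ?_)
  simp only [hmodel.mul_rpow hβ (hωΘ hθω) x]
  ring

theorem memLp_obsVec (hmodel : IsModel μ f Θ) (hω : IsOpen ω) (hωΘ : ω ⊆ Θ) (hθω : θ₀ ∈ ω)
    (hβ : 0 ≤ β) (hL : LehmannConditions μ f ω θ₀) (hBβ : BasuConditions μ f ω {θ₀} θ₀ β)
    (hK : ∀ j k, Integrable (fun x =>
      score f θ₀ x j * score f θ₀ x k * f θ₀ x ^ (1 + 2 * β)) μ) (d : Param p)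
    (o : Option (Fin p)) : MemLp (obsVec μ f β θ₀ d o) 2 (law μ f θ₀) := by
  have hprob := hmodel.isProbabilityMeasure_law (hωΘ hθω)
  cases o with
  | none => exact memLp_finsetSum _ fun j _ => (memLp_score hL j).const_mul _
  | some j => exact (memLp_score_mul_rpow hmodel hω hωΘ hθω hβ hBβ hK j).sub (memLp_const _)

theorem integral_obsVec (hmodel : IsModel μ f Θ) (hω : IsOpen ω) (hωΘ : ω ⊆ Θ) (hθω : θ₀ ∈ ω)
    (hβ : 0 ≤ β) (hL : LehmannConditions μ f ω θ₀) (hBβ : BasuConditions μ f ω {θ₀} θ₀ β)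
    (d : Param p) (o : Option (Fin p)) : ∫ x, obsVec μ f β θ₀ d o x ∂(law μ f θ₀) = 0 := by
  cases o with
  | none =>
    simp only [obsVec]
    rw [integral_finsetSum _ fun j _ => (hL.score_mean j).1.const_mul _]
    simp [integral_const_mul, (hL.score_mean _).2]
  | some j =>
    exact (integral_gradient_objTerm hmodel hω hωΘ hβ hBβ.diff_self
      (hmodel.ae_nice hωΘ hBβ.smooth) hθω j).2

theorem momentMatrix_some_some (hmodel : IsModel μ f Θ) (hω : IsOpen ω) (hωΘ : ω ⊆ Θ)
    (hθω : θ₀ ∈ ω) (hβ : 0 ≤ β) (hBβ : BasuConditions μ f ω {θ₀} θ₀ β)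
    (hK : ∀ j k, Integrable (fun x =>
      score f θ₀ x j * score f θ₀ x k * f θ₀ x ^ (1 + 2 * β)) μ) (d : Param p) (j k : Fin p) :
    momentMatrix (law μ f θ₀) (obsVec μ f β θ₀ d) (some j) (some k) = matK μ f β θ₀ j k := by
  have hprob := hmodel.isProbabilityMeasure_law (hωΘ hθω)
  have hm := memLp_score_mul_rpow hmodel hω hωΘ hθω hβ hBβ hK
  have hi := fun j => (hm j).integrable (by norm_num)
  have hξ := fun j => integral_score_mul_rpow (μ := μ) (ω := ω) hmodel hωΘ hθω hβ j
  have hprod : Integrable (fun x => score f θ₀ x j * f θ₀ x ^ β * (score f θ₀ x k * f θ₀ x ^ β))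
    (law μ f θ₀) := (hm j).integrable_mul (hm k)
  have hprod' : ∫ x, score f θ₀ x j * f θ₀ x ^ β * (score f θ₀ x k * f θ₀ x ^ β) ∂(law μ f θ₀) =
      ∫ x, score f θ₀ x j * score f θ₀ x k * f θ₀ x ^ (1 + 2 * β) ∂μ := by
    rw [hmodel.integral_law (hωΘ hθω)]
    refine integral_congr_ae (ae_of_all _ fun x => ?_)
    simp only [hmodel.mul_rpow_sq hβ (hωΘ hθω) x]
    ring
  simp only [momentMatrix, matK, obsVec, Matrix.of_apply]
  have e : (fun x => (score f θ₀ x j * f θ₀ x ^ β - vecXi μ f β θ₀ j) *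
      (score f θ₀ x k * f θ₀ x ^ β - vecXi μ f β θ₀ k)) = fun x =>
      (score f θ₀ x j * f θ₀ x ^ β * (score f θ₀ x k * f θ₀ x ^ β) -
        vecXi μ f β θ₀ k * (score f θ₀ x j * f θ₀ x ^ β)) -
        (vecXi μ f β θ₀ j * (score f θ₀ x k * f θ₀ x ^ β) -
          vecXi μ f β θ₀ j * vecXi μ f β θ₀ k) := by
    ext x; ring
  have h1 : Integrable (fun x => score f θ₀ x j * f θ₀ x ^ β * (score f θ₀ x k * f θ₀ x ^ β) -
      vecXi μ f β θ₀ k * (score f θ₀ x j * f θ₀ x ^ β)) (law μ f θ₀) :=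
    hprod.sub ((hi j).const_mul _)
  have h2 : Integrable (fun x => vecXi μ f β θ₀ j * (score f θ₀ x k * f θ₀ x ^ β) -
      vecXi μ f β θ₀ j * vecXi μ f β θ₀ k) (law μ f θ₀) :=
    ((hi k).const_mul _).sub (integrable_const _)
  rw [e, integral_sub h1 h2, integral_sub hprod ((hi j).const_mul _),
    integral_sub ((hi k).const_mul _) (integrable_const _), integral_const_mul,
    integral_const_mul, hξ, hξ, hprod', integral_const, probReal_univ]
  simp only [smul_eq_mul, one_mul]
  ring

/-- This covariance is the drift of the estimating function under the local alternatives and the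
origin of the vector BJd in the limit. The centring ξ drops out because the score has mean zero. -/
theorem momentMatrix_some_none (hmodel : IsModel μ f Θ) (hω : IsOpen ω) (hωΘ : ω ⊆ Θ)
    (hθω : θ₀ ∈ ω) (hβ : 0 ≤ β) (hL : LehmannConditions μ f ω θ₀)
    (hBβ : BasuConditions μ f ω {θ₀} θ₀ β)
    (hK : ∀ j k, Integrable (fun x =>
      score f θ₀ x j * score f θ₀ x k * f θ₀ x ^ (1 + 2 * β)) μ) (d : Param p) (j : Fin p) :
    momentMatrix (law μ f θ₀) (obsVec μ f β θ₀ d) (some j) none =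
      (matJ μ f β θ₀ *ᵥ d.ofLp) j := by
  have hprob := hmodel.isProbabilityMeasure_law (hωΘ hθω)
  have hm := memLp_score_mul_rpow hmodel hω hωΘ hθω hβ hBβ hK j
  have hs := memLp_score hL
  have hprod : ∀ k, Integrable (fun x => score f θ₀ x j * f θ₀ x ^ β * score f θ₀ x k)
    (law μ f θ₀) := fun k => hm.integrable_mul (hs k)
  have hprod' : ∀ k, ∫ x, score f θ₀ x j * f θ₀ x ^ β * score f θ₀ x k ∂(law μ f θ₀) =
      matJ μ f β θ₀ j k := by
    intro k
    rw [hmodel.integral_law (hωΘ hθω), matJ, Matrix.of_apply]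
    refine integral_congr_ae (ae_of_all _ fun x => ?_)
    simp only [hmodel.mul_rpow hβ (hωΘ hθω) x]
    ring
  simp only [momentMatrix, obsVec, Matrix.of_apply]
  have e : (fun x => (score f θ₀ x j * f θ₀ x ^ β - vecXi μ f β θ₀ j) *
      ∑ k, d k * score f θ₀ x k) = fun x => ∑ k, (d k * (score f θ₀ x j * f θ₀ x ^ β *
        score f θ₀ x k) - d k * vecXi μ f β θ₀ j * score f θ₀ x k) := by
    ext x
    rw [Finset.mul_sum]
    exact Finset.sum_congr rfl fun k _ => by ring
  have h1 : ∀ k, Integrable (fun x => d k * (score f θ₀ x j * f θ₀ x ^ β *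
        score f θ₀ x k) - d k * vecXi μ f β θ₀ j * score f θ₀ x k) (law μ f θ₀) := fun k =>
    ((hprod k).const_mul _).sub ((hL.score_mean k).1.const_mul _)
  rw [e, integral_finsetSum _ fun k _ => h1 k, Matrix.mulVec, dotProduct]
  refine Finset.sum_congr rfl fun k _ => ?_
  rw [integral_sub ((hprod k).const_mul _) ((hL.score_mean k).1.const_mul _), integral_const_mul,
    integral_const_mul, hprod', (hL.score_mean k).2]
  ring

/-- The second order information identity in the direction `d`. -/
theorem momentMatrix_none_none (hL : LehmannConditions μ f ω θ₀) (d : Param p) :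
    Integrable (fun x => fderiv ℝ (fderiv ℝ fun t => Real.log (f t x)) θ₀ d d) (law μ f θ₀) ∧
    ∫ x, fderiv ℝ (fderiv ℝ fun t => Real.log (f t x)) θ₀ d d ∂(law μ f θ₀) =
      -momentMatrix (law μ f θ₀) (obsVec μ f β θ₀ d) none none := by
  have hi : ∀ j k, Integrable (fun x =>
      fderiv ℝ (fderiv ℝ fun t => Real.log (f t x)) θ₀ (dir j) (dir k)) (law μ f θ₀) := by
    intro j k
    simpa [iteratedFDeriv_two_apply] using (hL.info_identity j k).1
  have hI : ∀ j k, ∫ x, fderiv ℝ (fderiv ℝ fun t => Real.log (f t x)) θ₀ (dir j) (dir k)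
      ∂(law μ f θ₀) = -∫ x, score f θ₀ x j * score f θ₀ x k ∂(law μ f θ₀) := by
    intro j k
    rw [← (hL.info_identity j k).2, integral_neg, neg_neg]
    simp [iteratedFDeriv_two_apply]
  have e : (fun x => fderiv ℝ (fderiv ℝ fun t => Real.log (f t x)) θ₀ d d) = fun x =>
      ∑ j, ∑ k, d j * d k *
        fderiv ℝ (fderiv ℝ fun t => Real.log (f t x)) θ₀ (dir j) (dir k) := by
    ext x; rw [bilinear_eq_sum]
  rw [e]
  refine ⟨integrable_finsetSum _ fun j _ => integrable_finsetSum _ fun k _ =>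
    (hi j k).const_mul _, ?_⟩
  have e2 : (fun x => (∑ j, d j * score f θ₀ x j) * ∑ j, d j * score f θ₀ x j) = fun x =>
      ∑ j, ∑ k, d j * d k * (score f θ₀ x j * score f θ₀ x k) := by
    ext x
    rw [Finset.sum_mul_sum]
    exact Finset.sum_congr rfl fun j _ => Finset.sum_congr rfl fun k _ => by ring
  simp only [momentMatrix, obsVec, Matrix.of_apply]
  rw [e2, integral_finsetSum _ fun j _ => integrable_finsetSum _ fun k _ => (hi j k).const_mul _,
    integral_finsetSum _ fun j _ => integrable_finsetSum _ fun k _ =>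
      (hL.info_integrable j k).const_mul _, ← Finset.sum_neg_distrib]
  refine Finset.sum_congr rfl fun j _ => ?_
  rw [integral_finsetSum _ fun k _ => (hi j k).const_mul _,
    integral_finsetSum _ fun k _ => (hL.info_integrable j k).const_mul _, ← Finset.sum_neg_distrib]
  refine Finset.sum_congr rfl fun k _ => ?_
  rw [integral_const_mul, integral_const_mul, hI, mul_neg]

end ObservationVector

/-! ### Events of probability tending to one. -/

section Events

variable {𝒳 : Type*} [MeasurableSpace 𝒳] {μ : Measure 𝒳} {p r : ℕ} {f : Param p → 𝒳 → ℝ}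
  {Θ ω : Set (Param p)} {θ₀ : Param p} {β : ℝ}

theorem Whp.forall {Ω ι : Type*} [Fintype ι] [MeasurableSpace Ω] {P : Measure Ω}
    [IsProbabilityMeasure P] {q : ι → ℕ → Ω → Prop} (h : ∀ i, Whp P (q i)) :
    Whp P fun n ω => ∀ i, q i n ω := by
  have h1 := tendsto_finsetSum (Finset.univ : Finset ι) fun i _ => h i
  rw [Finset.sum_const_zero] at h1
  refine squeeze_zero (fun n => measureReal_nonneg) (fun n => ?_) h1
  have : {ω | ¬ ∀ i, q i n ω} = ⋃ i, {ω | ¬ q i n ω} := by ext ω; simp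
  rw [this]
  exact measureReal_iUnion_fintype_le _

theorem sum_firstObs {𝒳 : Type*} (n : ℕ) (s : ℕ → 𝒳) (q : 𝒳 → ℝ) :
    ∑ i, q (firstObs n s i) = ∑ i ∈ Finset.range n, q (s i) :=
  (Finset.sum_range fun i => q (s i)).symm

/-- Events of probability tending to one under the laws of the samples. -/
theorem whp_of_tendsto_pi {ν : Measure 𝒳} [IsProbabilityMeasure ν]
    {E : ∀ n : ℕ, (Fin n → 𝒳) → Prop}
    (h : Tendsto (fun n => (Measure.pi fun _ : Fin n => ν) {X | ¬ E n X}) atTop (𝓝 0)) :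
    Whp (seqLaw ν) fun n s => E n (firstObs n s) := by
  refine whp_of_tendsto (tendsto_of_tendsto_of_tendsto_of_le_of_le tendsto_const_nhds h
    (fun n => zero_le) fun n => ?_)
  simp only
  rw [← map_firstObs ν n]
  -- For sets that may fail to be measurable, the measure of a preimage is at most the image
  -- measure, which is the direction required.
  exact Measure.le_map_apply (measurable_firstObs n).aemeasurable _

/-- The strong law, applied to the envelope M and to the finitely many Hessian entries. The level b
is the mean of M plus one and does not depend on the tolerance e, so e may be chosen after b. -/
theorem whp_goodSample (hmodel : IsModel μ f Θ) (hω : IsOpen ω) (hωΘ : ω ⊆ Θ)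
    (hβ : 0 ≤ β) (hBβ : BasuConditions μ f ω {θ₀} θ₀ β) (hθω : θ₀ ∈ ω)
    [IsProbabilityMeasure (law μ f θ₀)] :
    ∃ (M : 𝒳 → ℝ) (b : ℝ), ∀ e > 0, Whp (seqLaw (law μ f θ₀)) fun n s =>
      GoodSample μ f ω θ₀ β M b e (firstObs n s) := by
  obtain ⟨M, m, hM, hm⟩ := hBβ.third_deriv.exists_norm_le
  obtain ⟨hMi, -⟩ := hm θ₀ rfl
  have hac : law μ f θ₀ ≪ μ := withDensity_absolutelyContinuous _ _
  have hn := hmodel.ae_nice hωΘ hBβ.smooth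
  have hmean : ∀ {ψ : 𝒳 → ℝ}, Integrable ψ (law μ f θ₀) → ∀ e > 0,
      Whp (seqLaw (law μ f θ₀)) fun n s =>
        |(n : ℝ)⁻¹ * ∑ i ∈ Finset.range n, ψ (s i) - ∫ x, ψ x ∂(law μ f θ₀)| < e := by
    intro ψ hψ e he
    refine whp_of_tendsto_ae (fun n => ?_) (tendsto_sampleMean hψ) he
    exact (Finset.aemeasurable_fun_sum _ fun i _ => aemeasurable_obs hψ.aemeasurable i).const_mul _
  refine ⟨M, ∫ x, M x ∂(law μ f θ₀) + 1, fun e he => ?_⟩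
  have h1 := whp_of_ae (ae_obs (hac.ae_le hn))
  have h2 := whp_of_ae (ae_obs (hac.ae_le hM))
  have h3 := hmean hMi 1 one_pos
  have hH := fun j k => integral_hessian_objTerm hmodel hω hωΘ hβ hBβ.diff_self hn hθω
    (hBβ.J_integrable θ₀ rfl) j k
  have h4 := Whp.forall fun j => Whp.forall fun k => hmean (hH j k).1 e he
  refine (((h1.and h2).and h3).and h4).mono (.of_forall fun n s ⟨⟨⟨h1, h2⟩, h3⟩, h4⟩ => ?_)
  refine ⟨fun i => h1 i, fun i => h2 i, ?_, fun j k => ?_⟩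
  · rw [sum_firstObs]
    linarith [(abs_lt.1 h3).2]
  · rw [sum_firstObs n s fun x =>
      fderiv ℝ (fderiv ℝ fun t => objTerm μ f β t x) θ₀ (dir j) (dir k), ← (hH j k).2]
    exact (h4 j k).le

theorem normSum_obsVec_some {d : Param p} {n : ℕ} (hn : n ≠ 0) (s : ℕ → 𝒳) (j : Fin p) :
    normSum (obsVec μ f β θ₀ d) n s (some j) = √n * estFun μ f β (firstObs n s) θ₀ j := by
  have h0 : (0 : ℝ) < n := Nat.cast_pos.2 (Nat.pos_of_ne_zero hn)
  simp only [normSum, obsVec, estFun, Finset.sum_sub_distrib, Finset.sum_const, Finset.card_range,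
    nsmul_eq_mul]
  rw [sum_firstObs n s fun x => score f θ₀ x j * f θ₀ x ^ β]
  have h1 : √(n : ℝ) ≠ 0 := (Real.sqrt_pos.2 h0).ne'
  have h2 : (n : ℝ) = √n * √n := (Real.mul_self_sqrt h0.le).symm
  have h3 : √(n : ℝ) * (1 / (n : ℝ)) = (√(n : ℝ))⁻¹ := by
    rw [inv_eq_one_div, mul_one_div, div_eq_div_iff h0.ne' h1, one_mul, ← h2]
  have h4 : (√(n : ℝ))⁻¹ * n = √n := by
    rw [inv_mul_eq_div, div_eq_iff h1, ← h2]
  rw [mul_sub, mul_sub, ← mul_assoc (√(n : ℝ)), h3, ← mul_assoc _ (n : ℝ), h4]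

end Events

/-! ### Exponential densities. -/

section ExponentialDensity

variable {Ω : Type*} [MeasurableSpace Ω] {P : Measure Ω} {l : Ω → ℝ}

theorem integral_withDensity_exp (hl : Measurable l) (q : Ω → ℝ) :
    ∫ ω, q ω ∂(P.withDensity fun ω => ENNReal.ofReal (Real.exp (l ω))) =
      ∫ ω, q ω * Real.exp (l ω) ∂P := by
  rw [integral_withDensity_eq_integral_toReal_smul (by fun_prop)
    (ae_of_all _ fun x => ENNReal.ofReal_lt_top)]
  simp only [ENNReal.toReal_ofReal (Real.exp_pos _).le, smul_eq_mul, mul_comm]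

/-- The integral is the total mass 1 of the tilted measure; being nonzero, it forces integrability.
-/
theorem integral_exp_eq_one (hl : Measurable l)
    [IsProbabilityMeasure (P.withDensity fun ω => ENNReal.ofReal (Real.exp (l ω)))] :
    Integrable (fun ω => Real.exp (l ω)) P ∧ ∫ ω, Real.exp (l ω) ∂P = 1 := by
  have h := integral_withDensity_exp (P := P) hl fun _ => 1
  simp only [integral_const, probReal_univ, one_mul, smul_eq_mul] at h
  exact ⟨Integrable.of_integral_ne_zero (by rw [← h]; exact one_ne_zero), h.symm⟩

end ExponentialDensity

/-! ### Likelihood ratios and local asymptotic normality. -/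

section LikelihoodRatio

variable {𝒳 : Type*} [MeasurableSpace 𝒳] {μ : Measure 𝒳} {p : ℕ} {f : Param p → 𝒳 → ℝ}
  {Θ ω : Set (Param p)} {θ₀ : Param p} {β : ℝ}

/-- The log-likelihood ratio of the first `n` observations. -/
def logRatio (f : Param p → 𝒳 → ℝ) (θ₀ θ : Param p) (n : ℕ) (s : ℕ → 𝒳) : ℝ :=
  ∑ i ∈ Finset.range n, (Real.log (f θ (s i)) - Real.log (f θ₀ (s i)))

theorem measurable_logRatio (hmodel : IsModel μ f Θ) (θ₀ θ : Param p) (n : ℕ) :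
    Measurable (logRatio f θ₀ θ n) := by
  have h1 := hmodel.measurable_density θ
  have h2 := hmodel.measurable_density θ₀
  unfold logRatio
  fun_prop

/-- The common support makes the laws mutually absolutely continuous. Off the support the
exponential is 1, harmlessly, since both densities vanish there. -/
theorem law_eq_withDensity (hmodel : IsModel μ f Θ) {θ θ' : Param p} (hθ : θ ∈ Θ) (hθ' : θ' ∈ Θ) :
    law μ f θ' = (law μ f θ).withDensity fun x =>
      ENNReal.ofReal (Real.exp (Real.log (f θ' x) - Real.log (f θ x))) := by
  have h1 := hmodel.measurable_density θ
  have h2 := hmodel.measurable_density θ'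
  rw [law, law, ← withDensity_mul _ h1.ennreal_ofReal (by fun_prop)]
  congr 1
  ext x
  rw [Pi.mul_apply, ← ENNReal.ofReal_mul (hmodel.nonneg θ hθ x)]
  congr 1
  rcases hmodel.pos_or_zero x with hp | hz
  · rw [Real.exp_sub, Real.exp_log (hp _ hθ'), Real.exp_log (hp _ hθ),
      mul_div_cancel₀ _ (hp _ hθ).ne']
  · rw [hz _ hθ, hz _ hθ', zero_mul]

theorem sampleLaw_eq_withDensity (hmodel : IsModel μ f Θ) {θ θ' : Param p} (hθ : θ ∈ Θ)
    (hθ' : θ' ∈ Θ) (n : ℕ) :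
    sampleLaw μ f n θ' = (sampleLaw μ f n θ).withDensity fun X =>
      ENNReal.ofReal (Real.exp (∑ i, (Real.log (f θ' (X i)) - Real.log (f θ (X i))))) := by
  have := hmodel.isProbabilityMeasure_law hθ
  have := hmodel.isProbabilityMeasure_law hθ'
  have h1 := hmodel.measurable_density θ
  have h2 := hmodel.measurable_density θ'
  have h3 := law_eq_withDensity hmodel hθ hθ'
  have : IsProbabilityMeasure ((law μ f θ).withDensity fun x =>
      ENNReal.ofReal (Real.exp (Real.log (f θ' x) - Real.log (f θ x)))) := by
    rw [← h3]; infer_instance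
  rw [sampleLaw, sampleLaw, h3, pi_withDensity (fun _ : Fin n => law μ f θ)
    (g := fun _ x => ENNReal.ofReal (Real.exp (Real.log (f θ' x) - Real.log (f θ x))))
    fun _ => by fun_prop]
  congr 1
  ext X
  rw [← ENNReal.ofReal_prod_of_nonneg fun i _ => (Real.exp_pos _).le, Real.exp_sum]

/-- Change of measure from `θ'` to `θ`, on the space of infinite samples. -/
theorem integral_sampleLaw_eq (hmodel : IsModel μ f Θ) {θ θ' : Param p} (hθ : θ ∈ Θ)
    (hθ' : θ' ∈ Θ) [IsProbabilityMeasure (law μ f θ)] (n : ℕ) {q : (Fin n → 𝒳) → ℝ}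
    (hq : Measurable q) :
    ∫ X, q X ∂(sampleLaw μ f n θ') =
      ∫ s, q (firstObs n s) * Real.exp (logRatio f θ θ' n s) ∂(seqLaw (law μ f θ)) := by
  have h1 := hmodel.measurable_density θ
  have h2 := hmodel.measurable_density θ'
  rw [sampleLaw_eq_withDensity hmodel hθ hθ', integral_withDensity_exp (by fun_prop), sampleLaw,
    ← map_firstObs, integral_map (measurable_firstObs n).aemeasurable
      (Measurable.aestronglyMeasurable (by fun_prop))]
  refine integral_congr_ae (ae_of_all _ fun s => ?_)
  simp only [logRatio]
  rw [← sum_firstObs n s fun x => Real.log (f θ' x) - Real.log (f θ x)]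

theorem integral_exp_logRatio (hmodel : IsModel μ f Θ) {θ θ' : Param p} (hθ : θ ∈ Θ)
    (hθ' : θ' ∈ Θ) [IsProbabilityMeasure (law μ f θ)] (n : ℕ) :
    Integrable (fun s => Real.exp (logRatio f θ θ' n s)) (seqLaw (law μ f θ)) ∧
      ∫ s, Real.exp (logRatio f θ θ' n s) ∂(seqLaw (law μ f θ)) = 1 := by
  have := hmodel.isProbabilityMeasure_law hθ'
  have h := integral_sampleLaw_eq hmodel hθ hθ' n (q := fun _ => 1) measurable_const
  have h0 : ∫ _, (1 : ℝ) ∂(sampleLaw μ f n θ') = 1 := by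
    unfold sampleLaw
    simp
  simp only [one_mul, h0] at h
  exact ⟨Integrable.of_integral_ne_zero (by rw [← h]; exact one_ne_zero), h.symm⟩

theorem localAlt_eq (θ₀ d : Param p) (n : ℕ) : localAlt θ₀ d n = θ₀ + (√(n : ℝ))⁻¹ • d := by
  rw [localAlt, Real.rpow_neg (Nat.cast_nonneg n), ← Real.sqrt_eq_rpow]

theorem tendsto_inv_sqrt : Tendsto (fun n : ℕ => (√(n : ℝ))⁻¹) atTop (𝓝 0) :=
  tendsto_inv_atTop_zero.comp (Real.tendsto_sqrt_atTop.comp tendsto_natCast_atTop_atTop)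

theorem tendsto_localAlt (θ₀ d : Param p) : Tendsto (localAlt θ₀ d) atTop (𝓝 θ₀) := by
  have h := (tendsto_inv_sqrt.smul_const d).const_add θ₀
  rw [zero_smul, add_zero] at h
  exact h.congr fun n => (localAlt_eq θ₀ d n).symm

theorem norm_third_deriv_neg {E : Type*} [NormedAddCommGroup E] [NormedSpace ℝ E] (F : E → ℝ)
    (θ : E) : ‖fderiv ℝ (fderiv ℝ (fderiv ℝ fun t => -F t)) θ‖ =
      ‖fderiv ℝ (fderiv ℝ (fderiv ℝ F)) θ‖ := by
  have h1 : fderiv ℝ (fun t => -F t) = -fderiv ℝ F := by ext1 t; exact fderiv_fun_neg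
  have h2 : fderiv ℝ (-fderiv ℝ F) = -fderiv ℝ (fderiv ℝ F) := by ext1 t; exact fderiv_neg
  rw [h1, h2, fderiv_neg, norm_neg]

/-- Local asymptotic normality, almost sure form. -/
theorem ae_tendsto_logRatio_sub (hmodel : IsModel μ f Θ) (hω : IsOpen ω) (hωΘ : ω ⊆ Θ)
    (hθω : θ₀ ∈ ω) (hL : LehmannConditions μ f ω θ₀) (d : Param p)
    [IsProbabilityMeasure (law μ f θ₀)] :
    ∀ᵐ s ∂(seqLaw (law μ f θ₀)), Tendsto (fun n => logRatio f θ₀ (localAlt θ₀ d n) n s -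
      (normSum (obsVec μ f β θ₀ d) n s none -
        momentMatrix (law μ f θ₀) (obsVec μ f β θ₀ d) none none / 2)) atTop (𝓝 0) := by
  obtain ⟨M, m, hM, hm⟩ := hL.third_deriv.exists_norm_le
  obtain ⟨hMi, -⟩ := hm θ₀ rfl
  have hac : law μ f θ₀ ≪ μ := withDensity_absolutelyContinuous _ _
  obtain ⟨hHi, hHe⟩ := momentMatrix_none_none (β := β) hL d
  set C := momentMatrix (law μ f θ₀) (obsVec μ f β θ₀ d) none none with hC
  obtain ⟨ρ, hρ, hρω⟩ := Metric.isOpen_iff.1 hω θ₀ hθω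
  filter_upwards [ae_obs (hac.ae_le (hmodel.ae_nice hωΘ hL.smooth)), ae_obs (hac.ae_le hM),
    tendsto_sampleMean hMi, tendsto_sampleMean hHi] with s hs1 hs2 hs3 hs4
  rw [hHe] at hs4
  -- Each of the n summands has Taylor remainder at most M(s i)‖d‖³n^(-3/2), so the total is
  -- n^(-1/2) times a sample mean, which converges.
  have hbound : ∀ᶠ n in atTop, |logRatio f θ₀ (localAlt θ₀ d n) n s -
      normSum (obsVec μ f β θ₀ d) n s none - 1 / 2 * ((n : ℝ)⁻¹ * ∑ i ∈ Finset.range n,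
        fderiv ℝ (fderiv ℝ fun t => Real.log (f t (s i))) θ₀ d d)| ≤
      ((n : ℝ)⁻¹ * ∑ i ∈ Finset.range n, M (s i)) * ((√(n : ℝ))⁻¹ * ‖d‖ ^ 3) := by
    filter_upwards [(tendsto_localAlt θ₀ d).eventually (Metric.ball_mem_nhds θ₀ hρ)] with n hn
    have hsub : localAlt θ₀ d n - θ₀ = (√(n : ℝ))⁻¹ • d := by
      rw [localAlt_eq, add_sub_cancel_left]
    have hsq : (√(n : ℝ))⁻¹ * (√(n : ℝ))⁻¹ = (n : ℝ)⁻¹ := by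
      rw [← mul_inv, Real.mul_self_sqrt (Nat.cast_nonneg n)]
    have hterm : ∀ i, |Real.log (f (localAlt θ₀ d n) (s i)) - Real.log (f θ₀ (s i)) -
        (√(n : ℝ))⁻¹ * obsVec μ f β θ₀ d none (s i) - 1 / 2 * ((n : ℝ)⁻¹ *
          fderiv ℝ (fderiv ℝ fun t => Real.log (f t (s i))) θ₀ d d)| ≤
        M (s i) * ((n : ℝ)⁻¹ * ((√(n : ℝ))⁻¹ * ‖d‖ ^ 3)) := by
      intro i
      have h3 : ∀ θ ∈ Metric.ball θ₀ ρ,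
          ‖fderiv ℝ (fderiv ℝ (fderiv ℝ fun t => Real.log (f t (s i)))) θ‖ ≤ M (s i) := by
        intro θ hθ
        have h4 := hs2 i θ (hρω hθ)
        have e : (fun t => objTerm μ f 0 t (s i)) = fun t => -Real.log (f t (s i)) := by
          ext t; simp [objTerm]
        rwa [e, norm_third_deriv_neg] at h4
      have h5 := abs_sub_taylor_le Metric.isOpen_ball (convex_ball θ₀ ρ)
        (fun θ hθ => (hs1 i).d3_log hω θ (hρω hθ)) h3 (Metric.mem_ball_self hρ) hn
      have hq : ∀ T : Param p →L[ℝ] Param p →L[ℝ] ℝ,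
          T ((√(n : ℝ))⁻¹ • d) ((√(n : ℝ))⁻¹ • d) = (n : ℝ)⁻¹ * T d d := by
        intro T
        rw [(T _).map_smul, T.map_smul, smul_apply, smul_eq_mul, smul_eq_mul, ← mul_assoc, hsq]
      have hnorm : ‖(√(n : ℝ))⁻¹ • d‖ ^ 3 = (n : ℝ)⁻¹ * ((√(n : ℝ))⁻¹ * ‖d‖ ^ 3) := by
        rw [norm_smul, mul_pow, Real.norm_of_nonneg (by positivity : 0 ≤ (√(n : ℝ))⁻¹), pow_succ,
          sq (√(n : ℝ))⁻¹, hsq, mul_assoc]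
      rw [hsub, hq, hnorm, map_smul, smul_eq_mul, fderiv_apply_eq_dot _ d] at h5
      exact h5
    have e : logRatio f θ₀ (localAlt θ₀ d n) n s -
      normSum (obsVec μ f β θ₀ d) n s none - 1 / 2 * ((n : ℝ)⁻¹ * ∑ i ∈ Finset.range n,
        fderiv ℝ (fderiv ℝ fun t => Real.log (f t (s i))) θ₀ d d) = ∑ i ∈ Finset.range n,
        (Real.log (f (localAlt θ₀ d n) (s i)) - Real.log (f θ₀ (s i)) -
        (√(n : ℝ))⁻¹ * obsVec μ f β θ₀ d none (s i) - 1 / 2 * ((n : ℝ)⁻¹ *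
          fderiv ℝ (fderiv ℝ fun t => Real.log (f t (s i))) θ₀ d d)) := by
      simp only [logRatio, normSum, Finset.sum_sub_distrib, Finset.mul_sum]
    rw [e]
    refine (Finset.abs_sum_le_sum_abs _ _).trans
      ((Finset.sum_le_sum fun i _ => hterm i).trans (le_of_eq ?_))
    rw [← Finset.sum_mul]
    ring
  have h0 : Tendsto (fun n : ℕ => ((n : ℝ)⁻¹ * ∑ i ∈ Finset.range n, M (s i)) *
      ((√(n : ℝ))⁻¹ * ‖d‖ ^ 3)) atTop (𝓝 0) := by
    have := hs3.mul (tendsto_inv_sqrt.mul_const (‖d‖ ^ 3))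
    rwa [zero_mul, mul_zero] at this
  have h1 := squeeze_zero_norm' (f := fun n => logRatio f θ₀ (localAlt θ₀ d n) n s -
      normSum (obsVec μ f β θ₀ d) n s none - 1 / 2 * ((n : ℝ)⁻¹ * ∑ i ∈ Finset.range n,
        fderiv ℝ (fderiv ℝ fun t => Real.log (f t (s i))) θ₀ d d)) hbound h0
  have h2 := h1.add ((hs4.const_mul (1 / 2)).add_const (C / 2))
  have e : (0 : ℝ) + (1 / 2 * -C + C / 2) = 0 := by ring
  rw [e] at h2
  refine h2.congr fun n => ?_
  ring

end LikelihoodRatio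

/-! ### Asymptotic form of the test statistic. -/

section Statistic

variable {𝒳 : Type*} [MeasurableSpace 𝒳] {μ : Measure 𝒳} {p r : ℕ} {f : Param p → 𝒳 → ℝ}
  {Θ ω : Set (Param p)} {θ₀ : Param p} {β γ : ℝ}

/-- Joint measurability of the density makes the integral over x measurable in the sample. No
integrability is needed, so estimates outside Θ cause no difficulty. -/
theorem measurable_testStat [SFinite μ] (hmodel : IsModel μ f Θ)
    {est estR : ∀ n : ℕ, (Fin n → 𝒳) → Param p} (hest : ∀ n, Measurable (est n))
    (hestR : ∀ n, Measurable (estR n)) (n : ℕ) : Measurable (testStat μ f γ est estR n) := by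
  have h1 : Measurable fun z : (Fin n → 𝒳) × 𝒳 => f (est n z.1) z.2 :=
    hmodel.measurable.comp (((hest n).comp measurable_fst).prodMk measurable_snd)
  have h2 : Measurable fun z : (Fin n → 𝒳) × 𝒳 => f (estR n z.1) z.2 :=
    hmodel.measurable.comp (((hestR n).comp measurable_fst).prodMk measurable_snd)
  have h3 : Measurable fun X => divergence μ γ (f (est n X)) (f (estR n X)) := by
    by_cases hγ : γ = 0
    · simp only [divergence, if_pos hγ]
      refine StronglyMeasurable.measurable (StronglyMeasurable.integral_prod_right
        (f := fun X x => f (est n X) x * Real.log (f (est n X) x / f (estR n X) x)) ?_)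
      exact (h1.mul (Real.measurable_log.comp (h1.div h2))).stronglyMeasurable
    · simp only [divergence, if_neg hγ]
      refine StronglyMeasurable.measurable (StronglyMeasurable.integral_prod_right
        (f := fun X x => f (estR n X) x ^ (1 + γ) -
          (1 + 1 / γ) * (f (estR n X) x ^ γ * f (est n X) x) +
          1 / γ * f (est n X) x ^ (1 + γ)) ?_)
      exact (((h2.pow_const _).sub (((h2.pow_const _).mul h1).const_mul _)).add
        ((h1.pow_const _).const_mul _)).stronglyMeasurable
  exact h3.const_mul _

/-- The test statistic is asymptotically a quadratic form in the normalized estimating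
function. -/
theorem tendstoInMeasure_testStat_sub (hmodel : IsModel μ f Θ) (hω : IsOpen ω) (hωΘ : ω ⊆ Θ)
    (hβ : 0 ≤ β) (hγ : 0 ≤ γ) (hL : LehmannConditions μ f ω θ₀)
    (hBβ : BasuConditions μ f ω {θ₀} θ₀ β)
    (hBγ : BasuConditions μ f ω ω θ₀ γ) {g : Param p → EuclideanSpace ℝ (Fin r)}
    (hg : ContDiffOn ℝ 1 g Θ) (hG : ∀ θ ∈ Θ, (matG g θ).rank = r) (hθ₀ : θ₀ ∈ nullSet Θ g)
    (hθω : θ₀ ∈ ω) (hK : ∀ j k, Integrable (fun x =>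
      score f θ₀ x j * score f θ₀ x k * f θ₀ x ^ (1 + 2 * β)) μ)
    {est estR : ∀ n : ℕ, (Fin n → 𝒳) → Param p}
    (hest : IsConsistentSolution μ f θ₀ (fun _ X θ => IsMDPDE μ f Θ β X θ) est)
    (hestR : IsConsistentSolution μ f θ₀ (fun _ X θ => IsRMDPDE μ f Θ g β X θ) estR)
    (d : Param p) [IsProbabilityMeasure (law μ f θ₀)] :
    TendstoInMeasure (seqLaw (law μ f θ₀)) (fun n s => testStat μ f γ est estR n (firstObs n s) -
      (matB μ f g β θ₀ *ᵥ fun j => normSum (obsVec μ f β θ₀ d) n s (some j)) ⬝ᵥ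
        matA μ f γ θ₀ *ᵥ (matB μ f g β θ₀ *ᵥ fun j => normSum (obsVec μ f β θ₀ d) n s (some j)))
      atTop 0 := by
  set ψ := obsVec μ f β θ₀ d with hψ
  have hm := fun j : Fin p => memLp_obsVec hmodel hω hωΘ hθω hβ hL hBβ hK d (some j)
  have h0 := fun j : Fin p => integral_obsVec hmodel hω hωΘ hθω hβ hL hBβ d (some j)
  have hvar := fun (j : Fin p) (n : ℕ) => variance_sum_obs (hm j) (h0 j) n
  have hW : ∀ n (j : Fin p) s, normSum ψ n s (some j) ^ 2 =
      (n : ℝ)⁻¹ * (∑ i ∈ Finset.range n, ψ (some j) (s i)) ^ 2 := by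
    intro n j s
    simp only [normSum]
    rw [mul_pow, inv_pow, Real.sq_sqrt (Nat.cast_nonneg n)]
  have hWi : ∀ n (j : Fin p), Integrable (fun s => normSum ψ n s (some j) ^ 2)
      (seqLaw (law μ f θ₀)) := by
    intro n j
    simp only [hW]
    exact (hvar j n).1.const_mul _
  refine tendstoInMeasure_of_whp (W := fun n s => ∑ j : Fin p, normSum ψ n s (some j) ^ 2)
    (C := ∑ j : Fin p, ∫ x, ψ (some j) x ^ 2 ∂(law μ f θ₀))
    (fun n s => Finset.sum_nonneg fun j _ => sq_nonneg _)
    (fun n => integrable_finsetSum _ fun j _ => hWi n j) (fun n => ?_) fun δ hδ => ?_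
  · rw [integral_finsetSum _ fun j _ => hWi n j]
    refine Finset.sum_le_sum fun j _ => ?_
    simp only [hW]
    rw [integral_const_mul, (hvar j n).2, ← mul_assoc]
    -- An inequality rather than an equality, since the product is 0 for n = 0.
    have h1 : (n : ℝ)⁻¹ * n ≤ 1 := inv_mul_le_one
    exact mul_le_of_le_one_left (integral_nonneg fun x => sq_nonneg _) h1
  · obtain ⟨M, b, hgood⟩ := whp_goodSample hmodel hω hωΘ hβ hBβ hθω
    obtain ⟨e, he, ρ, hρ, H⟩ := exists_abs_divergence_estimates_sub_le hmodel hω hωΘ hβ hγ hBβ hBγ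
      hg hG hθ₀ hθω M b hδ
    have hc : ∀ {E : ∀ n : ℕ, (Fin n → 𝒳) → Param p → Prop}
        {est : ∀ n : ℕ, (Fin n → 𝒳) → Param p}, IsConsistentSolution μ f θ₀ E est →
        Whp (seqLaw (law μ f θ₀)) fun n s => E n (firstObs n s) (est n (firstObs n s)) ∧
          est n (firstObs n s) ∈ Metric.ball θ₀ ρ := by
      intro E est h
      refine Whp.and (whp_of_tendsto_pi (E := fun n X => E n X (est n X)) h.2.1)
        (whp_of_tendsto_pi (E := fun n X => est n X ∈ Metric.ball θ₀ ρ) ?_)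
      simp only [Metric.mem_ball, not_lt]
      exact h.2.2 ρ hρ
    refine (((hgood e he).and (hc hest)).and (hc hestR)).mono ?_
    filter_upwards [eventually_ne_atTop 0] with n hn s ⟨⟨h1, h2, h3⟩, h4, h5⟩
    have h6 := H n hn _ h1 _ h3 _ h5 h2 h4
    set z := estFun μ f β (firstObs n s) θ₀ with hz
    have hsome : (fun j => normSum ψ n s (some j)) = √(n : ℝ) • z := by
      ext j; exact normSum_obsVec_some hn s j
    have hsome' : ∀ j, normSum ψ n s (some j) = √(n : ℝ) * z j := normSum_obsVec_some hn s
    have hnn : √(n : ℝ) * √(n : ℝ) = n := Real.mul_self_sqrt (Nat.cast_nonneg n)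
    rw [hsome, Matrix.mulVec_smul, Matrix.mulVec_smul, smul_dotProduct, dotProduct_smul,
      smul_eq_mul, smul_eq_mul, ← mul_assoc, hnn]
    have e1 : testStat μ f γ est estR n (firstObs n s) - n * ((matB μ f g β θ₀ *ᵥ z) ⬝ᵥ
        matA μ f γ θ₀ *ᵥ (matB μ f g β θ₀ *ᵥ z)) = n * (2 * divergence μ γ
          (f (est n (firstObs n s))) (f (estR n (firstObs n s))) - (matB μ f g β θ₀ *ᵥ z) ⬝ᵥ
        matA μ f γ θ₀ *ᵥ (matB μ f g β θ₀ *ᵥ z)) := by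
      rw [testStat]; ring
    rw [e1, abs_mul, abs_of_nonneg (Nat.cast_nonneg n : (0 : ℝ) ≤ n)]
    have h7 : ‖z‖ ^ 2 ≤ ∑ j, z j ^ 2 := by
      have h8 : ‖z‖ ≤ √(∑ j, z j ^ 2) := by
        refine (pi_norm_le_iff_of_nonneg (Real.sqrt_nonneg _)).2 fun j => ?_
        rw [Real.norm_eq_abs]
        refine Real.abs_le_sqrt ?_
        exact Finset.single_le_sum (f := fun j => z j ^ 2) (fun _ _ => sq_nonneg _)
          (Finset.mem_univ j)
      calc ‖z‖ ^ 2 ≤ √(∑ j, z j ^ 2) ^ 2 := by gcongr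
        _ = _ := Real.sq_sqrt (Finset.sum_nonneg fun j _ => sq_nonneg _)
    have h9 : ∑ j, normSum ψ n s (some j) ^ 2 = n * ∑ j, z j ^ 2 := by
      simp only [hsome', mul_pow, sq (√(n : ℝ)), hnn, Finset.mul_sum]
    rw [h9]
    calc (n : ℝ) * _ ≤ n * (δ * ‖z‖ ^ 2) := by gcongr
      _ ≤ n * (δ * ∑ j, z j ^ 2) := by gcongr
      _ = _ := by ring

end Statistic

/-! ### Identification of the limit law. -/

section Limit

theorem transpose_matJ {𝒳 : Type*} [MeasurableSpace 𝒳] (μ : Measure 𝒳) {p : ℕ}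
    (f : Param p → 𝒳 → ℝ) (β : ℝ) (θ : Param p) : (matJ μ f β θ)ᵀ = matJ μ f β θ := by
  ext j k
  simp only [matJ, Matrix.transpose_apply, Matrix.of_apply, mul_comm (score f θ _ j)]

theorem transpose_matB {𝒳 : Type*} [MeasurableSpace 𝒳] (μ : Measure 𝒳) {p r : ℕ}
    (f : Param p → 𝒳 → ℝ) (g : Param p → EuclideanSpace ℝ (Fin r)) (β : ℝ) (θ : Param p) :
    (matB μ f g β θ)ᵀ = matB μ f g β θ := by
  simp only [matB, Matrix.transpose_mul, Matrix.transpose_transpose, Matrix.transpose_nonsing_inv,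
    transpose_matJ, Matrix.mul_assoc]

/-- Extension of a matrix by a zero column. -/
def extendZero {p : ℕ} (B : Matrix (Fin p) (Fin p) ℝ) : Matrix (Fin p) (Option (Fin p)) ℝ :=
  Matrix.of fun i o => o.elim 0 (B i)

theorem extendZero_mulVec {p : ℕ} (B : Matrix (Fin p) (Fin p) ℝ) (z : Option (Fin p) → ℝ) :
    extendZero B *ᵥ z = B *ᵥ fun j => z (some j) := by
  ext i
  simp [extendZero, Matrix.mulVec, dotProduct, Fintype.sum_option]

theorem extendZero_mul_mul {p : ℕ} (B : Matrix (Fin p) (Fin p) ℝ)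
    (C : Matrix (Option (Fin p)) (Option (Fin p)) ℝ) :
    extendZero B * C * (extendZero B)ᵀ = B * C.submatrix some some * Bᵀ := by
  ext i j
  simp [extendZero, Matrix.mul_apply, Fintype.sum_option]

/-- The law of the limiting quadratic form under the limiting tilted Gaussian measure. -/
theorem integral_quadraticForm_mul_exp {p m k : ℕ} {A B K : Matrix (Fin p) (Fin p) ℝ}
    (hA : A.PosDef) (hB : Bᵀ = B) {C : Matrix (Option (Fin p)) (Option (Fin p)) ℝ}
    (hC : C.PosSemidef) (hCK : C.submatrix some some = K) {lam : Fin k → ℝ}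
    (hlam : (A * (B * K * B)).charpoly.roots.filter (fun t => 0 < t) =
      (Finset.univ : Finset (Fin k)).val.map lam)
    {S : Matrix (Fin p) (Fin m) ℝ} (hS : S * Sᵀ = B * K * B)
    {V : Matrix (Fin m) (Fin k) ℝ} (hV : Vᵀ * V = 1)
    (hSV : (Sᵀ * A * S) * V = V * Matrix.diagonal lam)
    {b : Fin p → ℝ} (hb : b = B *ᵥ fun j => C (some j) none) {w : Fin k → ℝ}
    (hw : w = ((Matrix.diagonal lam)⁻¹ * Vᵀ * Sᵀ * A) *ᵥ b)
    {η : ℝ} (hη : η = b ⬝ᵥ A *ᵥ b - w ⬝ᵥ Matrix.diagonal lam *ᵥ w) (φ : ℝ →ᵇ ℝ) :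
    ∫ z, φ ((B *ᵥ fun j => z (some j)) ⬝ᵥ A *ᵥ (B *ᵥ fun j => z (some j))) *
        Real.exp (z none - C none none / 2) ∂(multivariateGaussian 0 C) =
      ∫ t, φ t ∂(shiftedChiSq lam w η) := by
  have hAT : Aᵀ = A := by
    have := hA.isHermitian
    rwa [Matrix.IsHermitian, Matrix.conjTranspose_eq_transpose_of_trivial] at this
  have hpos : ∀ i, lam i ≠ 0 := by
    intro i
    have : lam i ∈ (A * (B * K * B)).charpoly.roots.filter (fun t => 0 < t) := by
      rw [hlam]
      exact Multiset.mem_map_of_mem lam (Finset.mem_univ i)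
    exact (Multiset.mem_filter.1 this).2.ne'
  have hSVV : S = S * V * Vᵀ :=
    eq_mul_mul_transpose_of_eigenvectors hA (by rw [hS]; exact hlam) hV hSV
  set L := extendZero B with hL
  set R := S * V with hR
  -- Only the covariance matters: B K B = S Sᵀ = (S V)(S V)ᵀ reduces the Gaussian vector to k
  -- independent coordinates.
  have hLR : L * C * Lᵀ = R * Rᵀ := by
    rw [hL, extendZero_mul_mul, hCK, hB, ← hS, hR, Matrix.transpose_mul, ← Matrix.mul_assoc,
      ← hSVV]
  rw [← integral_withDensity_exp (P := multivariateGaussian 0 C)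
      (l := fun z => z none - C none none / 2) (by fun_prop),
    multivariateGaussian_withDensity_exp hC none,
    integral_map (by fun_prop) (Continuous.aestronglyMeasurable (by fun_prop))]
  -- The tilt translates by the score column of C, which B maps to b.
  have h1 : ∀ z : EuclideanSpace ℝ (Option (Fin p)),
      (B *ᵥ fun j => (z + WithLp.toLp 2 (C.col none)) (some j)) = L *ᵥ z.ofLp + b := by
    intro z
    rw [hL, extendZero_mulVec, hb, ← Matrix.mulVec_add]
    rfl
  simp only [h1]
  rw [← integral_map (μ := multivariateGaussian 0 C) (φ := fun z => WithLp.toLp 2 (L *ᵥ z.ofLp))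
    (f := fun y : EuclideanSpace ℝ (Fin p) => φ ((y.ofLp + b) ⬝ᵥ A *ᵥ (y.ofLp + b)))
    (by fun_prop) (Continuous.aestronglyMeasurable (by fun_prop)),
    map_multivariateGaussian_eq hC hLR,
    integral_map (by fun_prop) (Continuous.aestronglyMeasurable (by fun_prop))]
  simp only [quadraticForm_add_eq hAT hpos hV hSV b hw, ← hη, hR]
  rw [shiftedChiSq, integral_map (Measurable.aemeasurable (by fun_prop))
    φ.continuous.aestronglyMeasurable]

end Limit

end DPD

end

/-! ### The limit law under local alternatives. -/

theorem theorem9 {𝒳 : Type*} [MeasurableSpace 𝒳] (μ : Measure 𝒳) [SigmaFinite μ]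
    {p r : ℕ} (hrp : r < p)
    -- the parametric model
    (f : DPD.Param p → 𝒳 → ℝ) (Θ : Set (DPD.Param p)) (hmodel : DPD.IsModel μ f Θ)
    -- the restrictions defining the null hypothesis
    (g : DPD.Param p → EuclideanSpace ℝ (Fin r)) (hg : ContDiffOn ℝ 1 g Θ)
    (hG : ∀ θ ∈ Θ, (DPD.matG g θ).rank = r)
    (θ₀ : DPD.Param p) (hθ₀ : θ₀ ∈ DPD.nullSet Θ g)
    -- tuning parameters
    (β γ : ℝ) (hβ : 0 ≤ β) (hγ : 0 ≤ γ)
    -- the Lehmann and Basu et al. conditions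
    (ω : Set (DPD.Param p)) (hω : IsOpen ω) (hωΘ : ω ⊆ Θ) (hθω : θ₀ ∈ ω)
    (hL : DPD.LehmannConditions μ f ω θ₀)
    (hBβ : DPD.BasuConditions μ f ω {θ₀} θ₀ β)
    (hBγ : DPD.BasuConditions μ f ω ω θ₀ γ)
    (hK : ∀ j k, Integrable (fun x =>
      DPD.score f θ₀ x j * DPD.score f θ₀ x k * f θ₀ x ^ (1 + 2 * β)) μ)
    -- the unrestricted and the restricted estimator
    (est estR : ∀ n : ℕ, (Fin n → 𝒳) → DPD.Param p)
    (hest : DPD.IsConsistentSolution μ f θ₀ (fun _ X θ => DPD.IsMDPDE μ f Θ β X θ) est)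
    (hestR : DPD.IsConsistentSolution μ f θ₀ (fun _ X θ => DPD.IsRMDPDE μ f Θ g β X θ) estR)
    -- the direction of the alternatives
    (d : DPD.Param p)
    -- the matrices at the null parameter
    (A B J K : Matrix (Fin p) (Fin p) ℝ)
    (hA : A = DPD.matA μ f γ θ₀) (hB : B = DPD.matB μ f g β θ₀)
    (hJ : J = DPD.matJ μ f β θ₀) (hKdef : K = DPD.matK μ f β θ₀)
    -- the positive eigenvalues of A B K B, with multiplicity
    {k : ℕ} (lam : Fin k → ℝ)
    (hlam : (A * (B * K * B)).charpoly.roots.filter (fun t => 0 < t) =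
      (Finset.univ : Finset (Fin k)).val.map lam)
    -- a square root of B K B, and orthonormal eigenvectors
    {m : ℕ} (S : Matrix (Fin p) (Fin m) ℝ) (hS : S * Sᵀ = B * K * B)
    (V : Matrix (Fin m) (Fin k) ℝ) (hV : Vᵀ * V = 1)
    (hSV : (Sᵀ * A * S) * V = V * Matrix.diagonal lam)
    (w : Fin k → ℝ)
    (hw : w = ((Matrix.diagonal lam)⁻¹ * Vᵀ * Sᵀ * A * B * J) *ᵥ ⇑d)
    (η : ℝ)
    (hη : η = ((B * J) *ᵥ ⇑d) ⬝ᵥ (A *ᵥ ((B * J) *ᵥ ⇑d)) - w ⬝ᵥ (Matrix.diagonal lam *ᵥ w)) :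
    DPD.ConvergesInLaw (fun n => DPD.sampleLaw μ f n (DPD.localAlt θ₀ d n))
      (DPD.testStat μ f γ est estR) (DPD.shiftedChiSq lam w η) := by
  have hT := DPD.measurable_testStat (μ := μ) (γ := γ) hmodel hest.1 hestR.1
  refine ⟨fun n => (hT n).aemeasurable, fun φ => ?_⟩
  have hprob := hmodel.isProbabilityMeasure_law hθ₀.1
  set ψ := DPD.obsVec μ f β θ₀ d with hψ
  set ν := DPD.law μ f θ₀ with hν
  set C := DPD.momentMatrix ν ψ with hC
  have hm := DPD.memLp_obsVec hmodel hω hωΘ hθω hβ hL hBβ hK d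
  have hCpsd : C.PosSemidef := DPD.posSemidef_momentMatrix hm
  have hclt := DPD.tendstoInDistribution_normSum hm
    (DPD.integral_obsVec hmodel hω hωΘ hθω hβ hL hBβ d)
  have hApos : A.PosDef := by
    rw [hA, DPD.matA_eq hmodel hω hωΘ hγ hL.smooth hθω]
    exact (hBγ.J_posDef θ₀ hθω).smul (by linarith)
  have hl : Measurable fun z : EuclideanSpace ℝ (Option (Fin p)) => z none - C none none / 2 := by
    fun_prop
  have htilt : IsProbabilityMeasure ((multivariateGaussian 0 C).withDensity fun z =>
      ENNReal.ofReal (Real.exp (z none - C none none / 2))) := by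
    rw [DPD.multivariateGaussian_withDensity_exp hCpsd none]
    exact Measure.isProbabilityMeasure_map (by fun_prop)
  -- The limiting likelihood ratio keeps total mass one, so no mass escapes: this is the contiguity
  -- needed for Le Cam's lemma.
  obtain ⟨hN, hN1⟩ := DPD.integral_exp_eq_one (P := multivariateGaussian 0 C) hl
  have hΘ : ∀ᶠ n in atTop, DPD.localAlt θ₀ d n ∈ Θ :=
    (DPD.tendsto_localAlt θ₀ d).eventually (hmodel.isOpen.mem_nhds hθ₀.1)
  have hΛ := fun n => DPD.measurable_logRatio hmodel θ₀ (DPD.localAlt θ₀ d n) n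
  have hlan : TendstoInMeasure (DPD.seqLaw ν) (fun n s =>
      DPD.logRatio f θ₀ (DPD.localAlt θ₀ d n) n s -
        (DPD.normSum ψ n s none - C none none / 2)) atTop 0 := by
    refine tendstoInMeasure_of_tendsto_ae (fun n => ?_)
      (DPD.ae_tendsto_logRatio_sub hmodel hω hωΘ hθω hL d)
    have h1 := hl.comp_aemeasurable (hclt.forall_aemeasurable n)
    exact ((hΛ n).aemeasurable.sub h1).aestronglyMeasurable
  have key := DPD.tendsto_integral_mul_exp hclt
    (q := fun z => (B *ᵥ fun j => z (some j)) ⬝ᵥ A *ᵥ (B *ᵥ fun j => z (some j)))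
    (l := fun z => z none - C none none / 2) (by fun_prop) (by fun_prop)
    (fun n => ((hT n).comp (DPD.measurable_firstObs n)).aemeasurable)
    (fun n => (hΛ n).aemeasurable)
    (by
      rw [hA, hB]
      exact DPD.tendstoInMeasure_testStat_sub hmodel hω hωΘ hβ hγ hL hBβ hBγ hg hG hθ₀ hθω hK
        hest hestR d)
    hlan (hΘ.mono fun n hn => DPD.integral_exp_logRatio hmodel hθ₀.1 hn n) hN hN1 φ
  rw [DPD.integral_quadraticForm_mul_exp (b := (B * J) *ᵥ ⇑d) hApos
    (by rw [hB]; exact DPD.transpose_matB μ f g β θ₀) hCpsd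
    (by
      ext j k
      rw [hKdef]
      exact DPD.momentMatrix_some_some hmodel hω hωΘ hθω hβ hBβ hK d j k)
    hlam hS hV hSV
    (by
      rw [← Matrix.mulVec_mulVec, hJ]
      congr 1
      ext j
      exact (DPD.momentMatrix_some_none hmodel hω hωΘ hθω hβ hL hBβ hK d j).symm)
    (by rw [hw, Matrix.mulVec_mulVec, ← Matrix.mul_assoc]) hη φ] at key
  -- The change of measure is available only once θ_n lies in Θ, hence for all large n.
  refine key.congr' ?_
  filter_upwards [hΘ] with n hn
  exact (DPD.integral_sampleLaw_eq hmodel hθ₀.1 hn n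
    (φ.continuous.measurable.comp (hT n))).symm
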